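/- Let $\alpha>-\tfrac12$ and $\beta\in\mathbb R$, and let $$w(z)=C(1-z)^{\alpha+i\beta}(1-1/z)^{\alpha-i\beta},\qquad |z|=1,$$ be the pure Fisher–Hartwig weight (principal powers), with $C$ chosen so that $w_0=\frac1{2\pi}$, where $w_k=\int_{|z|=1}\frac{w(z)}{z^{k+1}}\frac{dz}{2\pi i}$. Let $\Delta_n=\det(w_{j-k})_{j,k=0}^{n-1}$. There is exactly one sequence of polynomials $\phi_n(z)=k_nz^n+\dots+\phi_n(0)$ with $k_n>0$ and $$\int_{|z|=1}\phi_m(z)\overline{\phi_n(z)}\,w(z)\frac{dz}{iz}=\delta_{m,n}\qquad(m,n\ge 0).$$ Put $r_n=\phi_n(0)/k_n$ and, for $n\ge1$, $a_n=\frac{k_{n-1}}{k_n}(i\beta-\alpha-n)$, $b_n=-n$. For a polynomial $\pi(z)=\gamma\prod_{j=1}^n(z-z_j)$ let $D[\pi]=\gamma^{2n-2}\prod_{1\le j<k\le n}(z_j-z_k)^2$. Let $G$ be the Barnes $G$-function. **Exact formulas.** For every $n\ge1$, $\Delta_n\neq 0$, $\phi_n(1)=\prod_{j=1}^n\frac{a_j}{b_j}$,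 and $$D[\phi_n]=(-1)^{n(n+1)/2}(i\beta-\alpha-n)^n\,\frac{r_n^{n-1}}{k_n}\Bigl(\prod_{j=1}^{n-1}k_j^2\Bigr)\prod_{j=1}^n\frac{b_j}{a_j} =(-1)^{n(n+3)/2}\Bigl(\frac{n+\alpha-i\beta}{2\pi}\Bigr)^n\frac{r_n^{n-1}}{k_n}\,\Delta_n^{-1}\prod_{j=1}^n\frac{b_j}{a_j},$$ where $$\prod_{j=1}^n\frac{b_j}{a_j}=\prod_{j=1}^n\sqrt{\frac{\alpha+i\beta+j}{\alpha-i\beta+j}\cdot\frac{j}{j+2\alpha}}$$ with principal square roots, so that $$\Bigl(\prod_{j=1}^n\frac{b_j}{a_j}\Bigr)^2=\frac{\Gamma(n+1+\alpha+i\beta)}{\Gamma(n+1+\alpha-i\beta)}\,\frac{\Gamma(\alpha-i\beta+1)}{\Gamma(\alpha+i\beta+1)}\,\frac{\Gamma(2\alpha+1)\Gamma(n+1)}{\Gamma(n+2\alpha+1)}.$$ Consequently $$\Delta_nk_n|D[\phi_n]|=\Bigl(\frac{|n+\alpha-i\beta|}{2\pi}\Bigr)^n|r_n|^{n-1}\,\Bigl|\prod_{j=1}^n\frac{b_j}{a_j}\Bigr|.$$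 **Asymptotics.** As $n\to\infty$, $$k_n\to\kappa:=\frac{\sqrt{\Gamma(2\alpha+1)}}{|\Gamma(\alpha+i\beta+1)|},\qquad \Bigl|\prod_{j=1}^n\frac{b_j}{a_j}\Bigr|\sim\frac{\sqrt{\Gamma(2\alpha+1)}}{n^\alpha},\qquad \Delta_n\sim\frac{|G(\alpha+i\beta+1)|^2}{G(2\alpha+1)}\,C^n\,n^{\alpha^2+\beta^2},$$ and, if $(\alpha,\beta)\ne(0,0)$, $$\phi_n(0)\sim\kappa\,\frac{\Gamma(\alpha+i\beta+1)}{\Gamma(\alpha-i\beta)}\,n^{-1-2i\beta},\qquad |r_n|^{n-1}\sim e^{-\alpha}\Bigl(\frac{|\alpha+i\beta|}{n}\Bigr)^{n-1},$$ $$|D[\phi_n]|\sim\frac{|\Gamma(\alpha+i\beta+1)|}{|\alpha+i\beta|}\,\frac{G(2\alpha+1)}{|G(\alpha+i\beta+1)|^2}\left(\frac{\Gamma(2\alpha+1)}{|\alpha+i\beta|\,|\Gamma(\alpha+i\beta)|^2}\right)^{n}n^{1-\alpha-\alpha^2-\beta^2}.$$ -/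

import Mathlib

open Filter Asymptotics Topology Polynomial

noncomputable section

namespace FisherHartwig

/-- The pure Fisher-Hartwig symbol `(1-z)^(α+iβ) (1-1/z)^(α-iβ)`. For `|z| = 1`, `z ≠ 1`, both bases
have positive real part, so the principal powers are the boundary values of the branch of the first
factor that is analytic in the disc and equal to one at `0`, and of the branch of the second factor
that is analytic outside the disc and equal to one at infinity. -/
def pureSymbol (α β : ℝ) (z : ℂ) : ℂ :=
  (1 - z) ^ ((α : ℂ) + Complex.I * β) * (1 - 1 / z) ^ ((α : ℂ) - Complex.I * β)

/-- The Fourier coefficient `w_k = ∫_{|z|=1} w(z) / z^(k+1) dz / (2πi)`. -/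
def symbolCoeff (w : ℂ → ℂ) (k : ℤ) : ℂ :=
  (2 * (Real.pi : ℂ) * Complex.I)⁻¹ * ∮ z in C(0, 1), w z / z ^ (k + 1)

/-- The normalisation constant `C`, for which the weight `C · pureSymbol` has zeroth Fourier
coefficient `1 / (2π)`. -/
def normConst (α β : ℝ) : ℂ :=
  (2 * (Real.pi : ℂ) * symbolCoeff (pureSymbol α β) 0)⁻¹

/-- The normalised Fisher-Hartwig weight. -/
def weight (α β : ℝ) (z : ℂ) : ℂ := normConst α β * pureSymbol α β z

/-- The Toeplitz determinant `Δ_n = det (w_{j-k})`, `0 ≤ j, k ≤ n - 1`. -/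
def toeplitzDet (w : ℂ → ℂ) (n : ℕ) : ℂ :=
  (Matrix.of fun j k : Fin n => symbolCoeff w (((j : ℕ) : ℤ) - ((k : ℕ) : ℤ))).det

/-- `φ_n` has degree `n` and positive leading coefficient, and the `φ_n` are orthonormal with respect
to `w(z) dz / (iz)` on the unit circle. -/
structure IsOrthonormalSystem (w : ℂ → ℂ) (φ : ℕ → ℂ[X]) : Prop where
  natDegree_eq : ∀ n, (φ n).natDegree = n
  leadingCoeff_im : ∀ n, (φ n).leadingCoeff.im = 0
  leadingCoeff_re_pos : ∀ n, 0 < (φ n).leadingCoeff.re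
  orthonormal : ∀ m n,
    (∮ z in C(0, 1), (φ m).eval z * (starRingEnd ℂ) ((φ n).eval z) * w z / (Complex.I * z)) =
      if m = n then 1 else 0

/-- The (real) leading coefficient `k_n` of `φ_n`. -/
def kCoeff (φ : ℕ → ℂ[X]) (n : ℕ) : ℝ := (φ n).leadingCoeff.re

/-- `r_n = φ_n(0) / k_n`. -/
def rCoeff (φ : ℕ → ℂ[X]) (n : ℕ) : ℂ := (φ n).eval 0 / (kCoeff φ n : ℂ)

/-- `a_n = m_{n-1} (iβ - α - n)`, where `m_{n-1} = k_{n-1} / k_n`; used for `n ≥ 1`. -/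
def aCoeff (α β : ℝ) (φ : ℕ → ℂ[X]) (n : ℕ) : ℂ :=
  ((kCoeff φ (n - 1) / kCoeff φ n : ℝ) : ℂ) * (Complex.I * β - α - n)

/-- `b_n = -n`. -/
def bCoeff (n : ℕ) : ℂ := -(n : ℂ)

/-- The discriminant `γ^(2n-2) ∏_{j<k} (z_j - z_k)^2` of a polynomial of degree `n ≥ 1` with leading
coefficient `γ` and zeros `z_1, …, z_n` (with multiplicity; the order of the zeros is immaterial). -/
def discriminant (p : ℂ[X]) : ℂ :=
  p.leadingCoeff ^ (2 * p.natDegree - 2) *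
    ∏ j : Fin p.roots.toList.length, ∏ k ∈ Finset.Ioi j,
      (p.roots.toList.get j - p.roots.toList.get k) ^ 2

/-- The Barnes `G`-function, through its Weierstrass product
`G(1+u) = (2π)^(u/2) exp(-(u + u²(1+γ))/2) ∏_{k≥1} (1+u/k)^k exp(u²/(2k) - u)`. -/
def barnesG (z : ℂ) : ℂ :=
  (2 * (Real.pi : ℂ)) ^ ((z - 1) / 2) *
    Complex.exp (-((z - 1) + (z - 1) ^ 2 * (1 + (Real.eulerMascheroniConstant : ℂ))) / 2) *
    ∏' k : ℕ, ((1 + (z - 1) / ((k : ℂ) + 1)) ^ (k + 1) *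
      Complex.exp ((z - 1) ^ 2 / (2 * ((k : ℂ) + 1)) - (z - 1)))

end FisherHartwig

end

open FisherHartwig

open Filter Asymptotics Topology Polynomial

noncomputable section

namespace FisherHartwig

/-! Write a = α + iβ and b = α - iβ. Everything rests on the explicit polynomials Q_n(z) = Σ_j
C(n,j) (1+a)_j (b)_{n-j} z^j (`rawPoly`), which are orthogonal for the weight and satisfy the
first-order relation (1-z) Q'_{n+1} = -(n+1) Q_{n+1} + (n+1)(n+1+a+b) Q_n and a three-term
recurrence.

Orthogonality needs only the recurrence (k-a) M_k = (k+1+b) M_{k+1} of the moments, which is an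
integration by parts: on the circle the weight is (2 sin(θ/2))^{2α} e^{-β(θ-π)} up to its constant.
With the first-order relation it gives ∫ Q_n z^{-k} dμ for 0 ≤ k ≤ n (`momentFun_rawPoly_of_lt`,
`momentFun_rawPoly_self`), hence the norms, the k_n, and Δ_n as a product of norms
(`toeplitzDet_eq`). The constant C is Cauchy's beta integral (`realCauchyIntegral_eq`), obtained by
a periodicity and monotonicity argument.

The discriminant is found by Schur's method. At a zero y of Q_{n+1} the first-order relation
replaces (1-y) Q'_{n+1}(y) by a multiple of Q_n(y). The product of the values Q_n(y) is a resultant,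
and its symmetry together with the three-term recurrence lets it descend in n (`crossProd_succ`).
The solution contains the product of the norms, which is how Δ_n enters.

For the asymptotics, Δ_n = C^n ∏_{j<n} g_j with g_j = Γ(j+1) Γ(j+1+2α) / |Γ(j+1+a)|² → 1.
Multiplicative summation by parts (`prod_gammaQuotient`) leaves g_n^n, whose limit is e^{α²+β²},
times powers of g_m / g_{m+1}. These powers are matched factor by factor with the Weierstrass
products of G(1+a), G(1+b) and G(1+2α) (`normSq_barnesFactor`). The mismatch is exp((α²+β²) H_n),
with H_n the harmonic number, which yields the power of n and the Euler constant. The other factors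
follow from Euler's limit for Γ. -/

/-! ### Rising factorials and the explicit polynomials -/

/-- The rising factorial `x (x + 1) ⋯ (x + n - 1)`. -/
def poch (x : ℂ) (n : ℕ) : ℂ := ∏ i ∈ Finset.range n, (x + i)

@[simp] lemma poch_zero (x : ℂ) : poch x 0 = 1 := by simp [poch]

lemma poch_succ (x : ℂ) (n : ℕ) : poch x (n + 1) = poch x n * (x + n) := by
  simp [poch, Finset.prod_range_succ]

lemma poch_succ' (x : ℂ) (n : ℕ) : poch x (n + 1) = x * poch (1 + x) n := by
  simp only [poch, Finset.prod_range_succ']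
  rw [mul_comm]
  congr 1
  · simp
  · refine Finset.prod_congr rfl fun i _ => ?_
    push_cast; ring

lemma poch_zero_left (n : ℕ) : poch 0 (n + 1) = 0 := by
  rw [poch_succ', zero_mul]

lemma poch_ne_zero {x : ℂ} (hx : ∀ i : ℕ, x + i ≠ 0) (n : ℕ) : poch x n ≠ 0 :=
  Finset.prod_ne_zero_iff.2 fun i _ => hx i

lemma conj_poch (x : ℂ) (n : ℕ) : (starRingEnd ℂ) (poch x n) = poch ((starRingEnd ℂ) x) n := by
  simp [poch, map_prod]

/-- The orthogonal polynomial of the Fisher-Hartwig weight, with leading coefficient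
`(1 + a) ⋯ (n + a)`. -/
def rawPoly (a b : ℂ) (n : ℕ) : ℂ[X] :=
  ∑ j ∈ Finset.range (n + 1), monomial j ((n.choose j : ℂ) * poch (1 + a) j * poch b (n - j))

lemma coeff_rawPoly (a b : ℂ) (n j : ℕ) :
    (rawPoly a b n).coeff j = (n.choose j : ℂ) * poch (1 + a) j * poch b (n - j) := by
  simp only [rawPoly, finsetSum_coeff, coeff_monomial]
  rw [Finset.sum_ite_eq' (Finset.range (n + 1)) j]
  split_ifs with h
  · rfl
  · have : n < j := by simpa [Nat.lt_succ_iff] using h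
    simp [Nat.choose_eq_zero_of_lt this]

@[simp] lemma rawPoly_zero (a b : ℂ) : rawPoly a b 0 = 1 := by
  simp [rawPoly]

lemma choose_succ_mul (n j : ℕ) :
    ((n.choose (j + 1) : ℕ) : ℂ) * (j + 1) = (n.choose j : ℂ) * ((n : ℂ) - j) := by
  rcases le_or_gt j n with h | h
  · have := Nat.choose_succ_right_eq n j
    rw [← Nat.cast_sub h]
    exact_mod_cast this
  · simp [Nat.choose_eq_zero_of_lt h, Nat.choose_eq_zero_of_lt (h.trans (Nat.lt_succ_self j))]

lemma succ_choose_mul (n j : ℕ) :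
    (((n + 1).choose j : ℕ) : ℂ) * ((n : ℂ) + 1 - j) = (n.choose j : ℂ) * ((n : ℂ) + 1) := by
  rcases le_or_gt j (n + 1) with h | h
  · have := Nat.choose_mul_succ_eq n j
    rw [show ((n : ℂ) + 1 - j) = ((n + 1 - j : ℕ) : ℂ) by rw [Nat.cast_sub h]; push_cast; ring]
    exact_mod_cast this.symm
  · simp [Nat.choose_eq_zero_of_lt h, Nat.choose_eq_zero_of_lt ((Nat.lt_succ_self n).trans h)]

/-- The first-order differential-difference relation of the orthogonal polynomials. -/
lemma one_sub_X_mul_derivative_rawPoly (a b : ℂ) (n : ℕ) :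
    (1 - X) * derivative (rawPoly a b (n + 1)) =
      C (-((n : ℂ) + 1)) * rawPoly a b (n + 1) +
        C (((n : ℂ) + 1) * (n + 1 + a + b)) * rawPoly a b n := by
  ext j
  have key : ∀ p : ℂ[X], ((1 - X) * derivative p).coeff j
      = p.coeff (j + 1) * (j + 1) - j * p.coeff j := by
    intro p
    rw [sub_mul, one_mul, coeff_sub, coeff_derivative]
    cases j with
    | zero => simp
    | succ j => rw [coeff_X_mul, coeff_derivative]; push_cast; ring
  rw [key, coeff_add, coeff_C_mul, coeff_C_mul, coeff_rawPoly, coeff_rawPoly, coeff_rawPoly]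
  have h1 := choose_succ_mul (n + 1) j
  have h2 := succ_choose_mul n j
  push_cast at h1
  rcases le_or_gt j n with h | h
  · obtain ⟨m, rfl⟩ := Nat.exists_eq_add_of_le h
    rw [show j + m + 1 - (j + 1) = m by omega, show j + m + 1 - j = m + 1 by omega,
      show j + m - j = m by omega, poch_succ, poch_succ]
    push_cast at h1 h2 ⊢
    linear_combination (poch (1 + a) j * (1 + a + j) * poch b m) * h1 +
      (poch (1 + a) j * poch b m * (j + m + 1 + a + b)) * h2
  -- Beyond `n` the truncated differences are all 0 and only `(n + 1).choose j` at `j = n + 1` can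
  -- survive; `h2` kills it, as its factor `n + 1 - j` vanishes there.
  · have e : n - j = 0 := by omega
    have e2 : n + 1 - j = 0 := by omega
    have e3 : n + 1 - (j + 1) = 0 := by omega
    rw [e, e2, e3, poch_succ, Nat.choose_eq_zero_of_lt h,
      Nat.choose_eq_zero_of_lt (show n + 1 < j + 1 by omega)]
    rw [Nat.choose_eq_zero_of_lt h] at h2
    simp only [Nat.cast_zero, zero_mul, poch_zero, mul_one] at h2 ⊢
    linear_combination (poch (1 + a) j) * h2

/-- The three-term recurrence of the orthogonal polynomials. -/
lemma rawPoly_add_two (a b : ℂ) (n : ℕ) :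
    rawPoly a b (n + 2) = (C (a + n + 2) * X + C (b + n + 1)) * rawPoly a b (n + 1) -
      C (((n : ℂ) + 1) * (n + 1 + a + b)) * (X * rawPoly a b n) := by
  ext j
  cases j with
  | zero =>
    simp only [coeff_sub, add_mul, mul_assoc, coeff_add, mul_coeff_zero, coeff_X_zero,
      zero_mul, mul_zero, zero_add, sub_zero, coeff_rawPoly, coeff_C_zero]
    simp only [Nat.choose_zero_right, Nat.cast_one, poch_zero, Nat.sub_zero]
    rw [show n + 2 = n + 1 + 1 by rfl, poch_succ b (n + 1)]
    push_cast; ring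
  | succ j =>
    simp only [coeff_sub, coeff_C_mul, add_mul, mul_assoc, coeff_add, coeff_X_mul, coeff_rawPoly]
    have h1 := choose_succ_mul (n + 1) j
    have h2 := succ_choose_mul n j
    have hP : (((n + 2).choose (j + 1) : ℕ) : ℂ) = (n + 1).choose j + (n + 1).choose (j + 1) := by
      rw [Nat.choose_succ_succ]; push_cast; ring
    push_cast at h1 h2
    rcases le_or_gt j n with h | h
    · obtain ⟨m, rfl⟩ := Nat.exists_eq_add_of_le h
      rw [show j + m + 2 - (j + 1) = m + 1 by omega, show j + m + 1 - j = m + 1 by omega,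
        show j + m - j = m by omega, show j + m + 1 - (j + 1) = m by omega, hP, poch_succ,
        poch_succ]
      push_cast at h1 h2 ⊢
      linear_combination (poch (1 + a) j * poch b m * (-(1 + a + j))) * h1 +
        (-poch (1 + a) j * poch b m * (j + m + 1 + a + b)) * h2
    · have e : n - j = 0 := by omega
      have e2 : n + 1 - j = 0 := by omega
      have e3 : n + 1 - (j + 1) = 0 := by omega
      have e4 : n + 2 - (j + 1) = 0 := by omega
      rw [e, e2, e3, e4, poch_succ, Nat.choose_eq_zero_of_lt h,
        Nat.choose_eq_zero_of_lt (show n + 1 < j + 1 by omega), hP,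
        Nat.choose_eq_zero_of_lt (show n + 1 < j + 1 by omega)]
      rw [Nat.choose_eq_zero_of_lt h] at h2
      simp only [Nat.cast_zero, zero_mul, poch_zero, mul_one, mul_zero, sub_zero, add_zero] at h2 ⊢
      linear_combination (-poch (1 + a) j) * h2

/-- At z = 1 the left side of the first-order relation vanishes, so it becomes a one-step recursion.
This is the Chu–Vandermonde identity, valid for arbitrary `a` and `b`. -/
lemma eval_one_rawPoly (a b : ℂ) (n : ℕ) : (rawPoly a b n).eval 1 = poch (1 + a + b) n := by
  induction n with
  | zero => simp
  | succ n ih =>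
    have h := congrArg (eval 1) (one_sub_X_mul_derivative_rawPoly a b n)
    simp only [eval_mul, eval_sub, eval_one, eval_X, sub_self, zero_mul, eval_add, eval_C, ih] at h
    have hn : (n : ℂ) + 1 ≠ 0 := by exact_mod_cast Nat.succ_ne_zero n
    rw [poch_succ]
    apply mul_left_cancel₀ hn
    linear_combination h

lemma eval_zero_rawPoly (a b : ℂ) (n : ℕ) : (rawPoly a b n).eval 0 = poch b n := by
  rw [← coeff_zero_eq_eval_zero, coeff_rawPoly]; simp

lemma rawPoly_natDegree_le (a b : ℂ) (n : ℕ) : (rawPoly a b n).natDegree ≤ n := by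
  rw [natDegree_le_iff_coeff_eq_zero]
  intro j hj
  rw [coeff_rawPoly, Nat.choose_eq_zero_of_lt hj]; simp

lemma coeff_rawPoly_self (a b : ℂ) (n : ℕ) : (rawPoly a b n).coeff n = poch (1 + a) n := by
  simp [coeff_rawPoly]

/-! ### Moment functionals and orthogonality -/

/-- The functional `p ↦ ∫ p(z) z^(-k) dμ(z)` on polynomials, for a measure with moments `M`. -/
def momentFun (M : ℤ → ℂ) (k : ℤ) : ℂ[X] →ₗ[ℂ] ℂ :=
  Polynomial.lsum fun i => LinearMap.lsmul ℂ ℂ (M (k - i))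

lemma momentFun_monomial (M : ℤ → ℂ) (k : ℤ) (i : ℕ) (c : ℂ) :
    momentFun M k (monomial i c) = M (k - i) * c := by
  simp [momentFun, Polynomial.lsum_apply]

/-- Integration by parts against a weight whose moments satisfy a hypergeometric recurrence. -/
lemma momentFun_one_sub_X_mul_derivative {M : ℤ → ℂ} {a b : ℂ}
    (hM : ∀ k : ℤ, (k - a) * M k = (k + 1 + b) * M (k + 1)) (k : ℤ) (p : ℂ[X]) :
    momentFun M k ((1 - X) * derivative p) =
      (b + k + 1) * momentFun M (k + 1) p - (k - a) * momentFun M k p := by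
  induction p using Polynomial.induction_on' with
  | add p q hp hq => simp only [mul_add, map_add, hp, hq]; ring
  | monomial i c =>
    rw [derivative_monomial, sub_mul, one_mul, map_sub, X_mul_monomial]
    simp only [momentFun_monomial]
    cases i with
    | zero =>
      have := hM k
      simp only [Nat.cast_zero, mul_zero, sub_zero]
      linear_combination c * this
    | succ i =>
      have := hM (k - (i + 1))
      rw [show k - ((i : ℤ) + 1) + 1 = k - i by ring] at this
      push_cast at this
      simp only [Nat.add_sub_cancel]
      push_cast
      rw [show k + 1 - ((i : ℤ) + 1) = k - i by ring]
      linear_combination c * this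

/-- Run downwards, the recurrence turns (1+a)_j M_{-j} into (-b)_j M_0, and what remains is
Chu–Vandermonde for (-b + b)_{n+1} = 0. No division is needed, so `a` is unrestricted. -/
lemma momentFun_zero_rawPoly {M : ℤ → ℂ} {a b : ℂ}
    (hM : ∀ k : ℤ, (k - a) * M k = (k + 1 + b) * M (k + 1)) (n : ℕ) :
    momentFun M 0 (rawPoly a b (n + 1)) = 0 := by
  have hneg : ∀ j : ℕ, poch (1 + a) j * M (-j) = poch (-b) j * M 0 := by
    intro j
    induction j with
    | zero => simp
    | succ j ih =>
      have h := hM (-(j + 1 : ℤ))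
      rw [show -((j : ℤ) + 1) + 1 = -(j : ℤ) by ring] at h
      push_cast at h ⊢
      rw [poch_succ, poch_succ]
      linear_combination (-poch (1 + a) j) * h + (j - b) * ih
  -- The instance of Chu–Vandermonde whose first parameter 1 + a equals -b.
  have hV := eval_one_rawPoly (-b - 1) b (n + 1)
  rw [show 1 + (-b - 1) + b = 0 by ring, poch_zero_left, rawPoly, eval_finsetSum] at hV
  simp only [rawPoly, map_sum, momentFun_monomial]
  rw [← zero_mul (M 0), ← hV, Finset.sum_mul]
  refine Finset.sum_congr rfl fun j _ => ?_
  rw [eval_monomial, one_pow, zero_sub, show 1 + (-b - 1) = -b by ring]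
  linear_combination (((n + 1).choose j : ℂ) * poch b (n + 1 - j)) * hneg j

/-- The functional of (1-X) Q'_{n+1} computed twice, by parts and by the first-order relation. It
raises the frequency `k` by one. -/
lemma momentFun_rawPoly_step {M : ℤ → ℂ} {a b : ℂ}
    (hM : ∀ k : ℤ, (k - a) * M k = (k + 1 + b) * M (k + 1)) (n : ℕ) (k : ℤ) :
    (b + k + 1) * momentFun M (k + 1) (rawPoly a b (n + 1)) =
      (k - a - (n + 1)) * momentFun M k (rawPoly a b (n + 1)) +
        ((n : ℂ) + 1) * (n + 1 + a + b) * momentFun M k (rawPoly a b n) := by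
  have h := momentFun_one_sub_X_mul_derivative hM k (rawPoly a b (n + 1))
  rw [one_sub_X_mul_derivative_rawPoly, map_add, ← smul_eq_C_mul, ← smul_eq_C_mul, map_smul,
    map_smul, smul_eq_mul, smul_eq_mul] at h
  linear_combination -h

/-- Induction on the degree and, inside it, on the frequency: the step expresses the value at k + 1
through two vanishing ones, and `hb` permits division by b + k + 1. -/
lemma momentFun_rawPoly_of_lt {M : ℤ → ℂ} {a b : ℂ}
    (hM : ∀ k : ℤ, (k - a) * M k = (k + 1 + b) * M (k + 1)) (hb : ∀ i : ℕ, 1 + b + i ≠ 0)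
    (n k : ℕ) (hk : k < n) :
    momentFun M k (rawPoly a b n) = 0 := by
  induction n generalizing k with
  | zero => omega
  | succ n ih =>
    induction k with
    | zero => exact momentFun_zero_rawPoly hM n
    | succ k ihk =>
      have h := momentFun_rawPoly_step hM n k
      rw [ihk (by omega), ih k (by omega)] at h
      have hne : b + (k : ℤ) + 1 ≠ 0 := by
        have := hb k
        push_cast
        intro h0; apply this; rw [← h0]; ring
      simp only [mul_zero, add_zero, mul_eq_zero] at h
      push_cast
      exact h.resolve_left hne

/-- The same step at k = n, where Q_{n+1} already annihilates the frequency n, so only the Q_n term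
survives. -/
lemma momentFun_rawPoly_self {M : ℤ → ℂ} {a b : ℂ}
    (hM : ∀ k : ℤ, (k - a) * M k = (k + 1 + b) * M (k + 1)) (hb : ∀ i : ℕ, 1 + b + i ≠ 0) (n : ℕ) :
    poch (1 + b) n * momentFun M n (rawPoly a b n) =
      (n.factorial : ℂ) * poch (1 + a + b) n * M 0 := by
  induction n with
  | zero =>
    rw [rawPoly_zero, ← monomial_zero_one, momentFun_monomial]; simp
  | succ n ih =>
    have h := momentFun_rawPoly_step hM n n
    rw [momentFun_rawPoly_of_lt hM hb (n + 1) n (Nat.lt_succ_self n)] at h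
    rw [poch_succ, poch_succ, Nat.factorial_succ]
    push_cast at h ⊢
    linear_combination (poch (1 + b) n) * h + ((n : ℂ) + 1) * (n + 1 + a + b) * ih


/-! ### Discriminants, resultants and Schur's recursion -/

/-- Each of the m(m-1)/2 unordered pairs contributes -(z_j - z_k)² to the product over ordered
pairs. -/
lemma prod_Ioi_sq_sub {m : ℕ} (z : Fin m → ℂ) :
    ∏ j : Fin m, ∏ k ∈ Finset.Ioi j, (z j - z k) ^ 2 =
      (-1) ^ (m * (m - 1) / 2) * ∏ j : Fin m, ∏ k ∈ Finset.univ.erase j, (z j - z k) := by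
  have h := Finset.prod_prod_Ioi_mul_eq_prod_prod_off_diag (fun j k : Fin m => z k - z j)
  have h1 : ∏ j : Fin m, ∏ k ∈ Finset.univ.erase j, (z j - z k) =
      ∏ j : Fin m, ∏ k ∈ Finset.Ioi j, ((-1) * (z j - z k) ^ 2) := by
    simp only [Finset.compl_singleton] at h
    rw [← h]
    refine Finset.prod_congr rfl fun j _ => Finset.prod_congr rfl fun k _ => ?_
    ring
  have h2 : ∑ j : Fin m, (Finset.Ioi j).card = m * (m - 1) / 2 := by
    simp only [Fin.card_Ioi]
    rw [Fin.sum_univ_eq_sum_range (fun j => m - 1 - j) m, Finset.sum_range_reflect (fun j => j) m,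
      Finset.sum_range_id]
  rw [h1]
  simp only [Finset.prod_mul_distrib, Finset.prod_const]
  rw [Finset.prod_pow_eq_pow_sum, h2, ← mul_assoc, ← mul_pow]
  norm_num

lemma roots_map_prod_eq {M : Type*} [CommMonoid M] (p : ℂ[X]) (f : ℂ → M) :
    (p.roots.map f).prod = ∏ j : Fin p.roots.toList.length, f (p.roots.toList.get j) := by
  conv_lhs => rw [← Multiset.coe_toList p.roots]
  rw [Multiset.map_coe, Multiset.prod_coe]
  generalize p.roots.toList = l
  rw [← List.prod_ofFn]
  congr 1
  exact List.ext_get (by simp) (by simp)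

lemma eval_derivative_root (p : ℂ[X]) (j : Fin p.roots.toList.length) :
    (derivative p).eval (p.roots.toList.get j) =
      p.leadingCoeff * ∏ k ∈ Finset.univ.erase j, (p.roots.toList.get j - p.roots.toList.get k) := by
  have hp : p = C p.leadingCoeff * ∏ k, (X - C (p.roots.toList.get k)) := by
    rw [← roots_map_prod_eq p (fun x => X - C x)]
    exact (IsAlgClosed.splits p).eq_prod_roots
  generalize hz : (fun k => p.roots.toList.get k) = z at *
  have hz' : ∀ k, p.roots.toList.get k = z k := fun k => congrFun hz k
  simp only [hz'] at hp ⊢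
  rw [congrArg derivative hp, derivative_C_mul, derivative_prod_finset, eval_mul, eval_C, eval_finsetSum]
  congr 1
  rw [Finset.sum_eq_single j]
  · simp [eval_prod]
  · intro k _ hk
    simp only [eval_mul, eval_prod]
    rw [Finset.prod_eq_zero (Finset.mem_erase.2 ⟨hk.symm, Finset.mem_univ j⟩) (by simp), zero_mul]
  · simp

lemma discriminant_eq (p : ℂ[X]) :
    p.leadingCoeff ^ p.natDegree * discriminant p =
      (-1) ^ (p.natDegree * (p.natDegree - 1) / 2) * p.leadingCoeff ^ (2 * p.natDegree - 2) *
        (p.roots.map (derivative p).eval).prod := by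
  have hcard : p.roots.toList.length = p.natDegree := by
    rw [Multiset.length_toList]; exact ((IsAlgClosed.splits p).natDegree_eq_card_roots).symm
  rw [discriminant, prod_Ioi_sq_sub (fun j => p.roots.toList.get j), roots_map_prod_eq]
  simp only [eval_derivative_root, Finset.prod_mul_distrib, Finset.prod_const, Finset.card_univ,
    Fintype.card_fin, hcard]
  ring

lemma discriminant_C_mul {c : ℂ} (hc : c ≠ 0) (p : ℂ[X]) :
    discriminant (C c * p) = c ^ (2 * p.natDegree - 2) * discriminant p := by
  unfold discriminant
  rw [roots_C_mul p hc, natDegree_C_mul hc, leadingCoeff_mul, leadingCoeff_C]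
  ring

lemma eval_eq_leadingCoeff_mul_prod (p : ℂ[X]) (x : ℂ) :
    p.eval x = p.leadingCoeff * (p.roots.map (fun y => x - y)).prod :=
  (IsAlgClosed.splits p).eval_eq_prod_roots x

/-- Each side is a resultant of `p` and `q`, which is symmetric up to sign. -/
lemma prod_eval_roots_comm (p q : ℂ[X]) :
    p.leadingCoeff ^ q.natDegree * (p.roots.map q.eval).prod =
      (-1) ^ (p.natDegree * q.natDegree) *
        (q.leadingCoeff ^ p.natDegree * (q.roots.map p.eval).prod) := by
  rw [← resultant_eq_prod_eval p q _ le_rfl (IsAlgClosed.splits p),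
    ← resultant_eq_prod_eval q p _ le_rfl (IsAlgClosed.splits q), resultant_comm]

section
variable {a b : ℂ}

lemma natDegree_rawPoly (ha : ∀ i : ℕ, 1 + a + i ≠ 0) (n : ℕ) : (rawPoly a b n).natDegree = n :=
  natDegree_eq_of_le_of_coeff_ne_zero (rawPoly_natDegree_le a b n)
    (by rw [coeff_rawPoly_self]; exact poch_ne_zero ha n)

lemma leadingCoeff_rawPoly (ha : ∀ i : ℕ, 1 + a + i ≠ 0) (n : ℕ) :
    (rawPoly a b n).leadingCoeff = poch (1 + a) n := by
  rw [leadingCoeff, natDegree_rawPoly ha, coeff_rawPoly_self]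

lemma prod_map_mul_left_const (s : Multiset ℂ) (c : ℂ) (f : ℂ → ℂ) :
    (s.map fun x => c * f x).prod = c ^ s.card * (s.map f).prod := by
  rw [Multiset.prod_map_mul]; simp

lemma card_roots_rawPoly (ha : ∀ i : ℕ, 1 + a + i ≠ 0) (n : ℕ) :
    (rawPoly a b n).roots.card = n := by
  rw [← (IsAlgClosed.splits _).natDegree_eq_card_roots, natDegree_rawPoly ha]

/-- The product of the values of `rawPoly a b n` at the zeros of `rawPoly a b (n + 1)`. -/
def crossProd (a b : ℂ) (n : ℕ) : ℂ := ((rawPoly a b (n + 1)).roots.map (rawPoly a b n).eval).prod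

/-- Symmetry of the resultant moves the product to the zeros y of Q_{n+1}. There the recurrence
leaves only -(n+1)(n+1+a+b) y Q_n(y), and ∏(-y) is Q_{n+1}(0) over the leading coefficient. The sign
disappears because (n+1)(n+2) is even. -/
lemma crossProd_succ (ha : ∀ i : ℕ, 1 + a + i ≠ 0) (n : ℕ) :
    poch (1 + a) (n + 2) ^ (n + 1) * crossProd a b (n + 1) =
      poch (1 + a) (n + 1) ^ (n + 1) * (((n : ℂ) + 1) * (n + 1 + a + b)) ^ (n + 1) *
        poch b (n + 1) * crossProd a b n := by
  have h := prod_eval_roots_comm (rawPoly a b (n + 2)) (rawPoly a b (n + 1))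
  rw [natDegree_rawPoly ha, natDegree_rawPoly ha, leadingCoeff_rawPoly ha,
    leadingCoeff_rawPoly ha, Even.neg_one_pow (by rw [mul_comm]; exact Nat.even_mul_succ_self _),
    one_mul] at h
  have hev : (rawPoly a b (n + 1)).roots.map (rawPoly a b (n + 2)).eval =
      (rawPoly a b (n + 1)).roots.map
        (fun y => (((n : ℂ) + 1) * (n + 1 + a + b)) * ((0 - y) * (rawPoly a b n).eval y)) := by
    refine Multiset.map_congr rfl fun y hy => ?_
    have hy' : (rawPoly a b (n + 1)).eval y = 0 := (mem_roots'.1 hy).2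
    rw [rawPoly_add_two]
    simp only [eval_sub, eval_mul, eval_add, eval_C, eval_X, hy']
    ring
  rw [crossProd, h, hev, prod_map_mul_left_const, Multiset.prod_map_mul, card_roots_rawPoly ha]
  have h0 := eval_eq_leadingCoeff_mul_prod (rawPoly a b (n + 1)) 0
  rw [eval_zero_rawPoly, leadingCoeff_rawPoly ha] at h0
  rw [h0, crossProd]
  ring

/-- The product over `j` is that of the squared norms of the monic polynomials when b is the
conjugate of a. Denominators outside it are cleared, and `b` is never divided by, because b = 0 is
allowed. -/
lemma crossProd_closed (ha : ∀ i : ℕ, 1 + a + i ≠ 0) (hb : ∀ i : ℕ, 1 + b + i ≠ 0) (n : ℕ) :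
    crossProd a b n * (∏ j ∈ Finset.range (n + 1), ((j.factorial : ℂ) * poch (1 + a + b) j /
      (poch (1 + a) j * poch (1 + b) j))) * poch (1 + a) (n + 1) ^ n * poch (1 + b) n =
      b ^ n * ((n.factorial : ℂ) * poch (1 + a + b) n) ^ (n + 1) := by
  induction n with
  | zero => simp [crossProd]
  | succ n ih =>
    rw [Finset.prod_range_succ]
    have h := crossProd_succ (b := b) ha n
    set H := ∏ j ∈ Finset.range (n + 1), ((j.factorial : ℂ) * poch (1 + a + b) j /
      (poch (1 + a) j * poch (1 + b) j))
    have hA := poch_ne_zero ha (n + 1)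
    have hB := poch_ne_zero hb (n + 1)
    have hd : (((n + 1).factorial : ℕ) : ℂ) * poch (1 + a + b) (n + 1) =
        (((n : ℂ) + 1) * (n + 1 + a + b)) * ((n.factorial : ℂ) * poch (1 + a + b) n) := by
      rw [poch_succ, Nat.factorial_succ]; push_cast; ring
    -- Splitting off `b` leaves (1+b)_n, which does not vanish; this is where the power b^n
    -- originates.
    rw [poch_succ' b n] at h
    rw [hd]
    generalize (n.factorial : ℂ) * poch (1 + a + b) n = d at *
    generalize ((n : ℂ) + 1) * (n + 1 + a + b) = l at *
    field_simp
    linear_combination (H * l * d) * h + (l ^ (n + 2) * poch (1 + a) (n + 1) * b * d) * ih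

/-- The discriminant of the orthogonal polynomial in terms of the cross product. -/
lemma discriminant_rawPoly (ha : ∀ i : ℕ, 1 + a + i ≠ 0) (n : ℕ) :
    discriminant (rawPoly a b (n + 1)) * poch (1 + a + b) (n + 1) * poch (1 + a) (n + 1) =
      (-1) ^ ((n + 1) * n / 2) * poch (1 + a) (n + 1) ^ (n + 1) *
        (((n : ℂ) + 1) * (n + 1 + a + b)) ^ (n + 1) * crossProd a b n := by
  have h := discriminant_eq (rawPoly a b (n + 1))
  rw [natDegree_rawPoly ha, leadingCoeff_rawPoly ha] at h
  -- At a zero of Q_{n+1} the first-order relation reads (1-y) Q'_{n+1}(y) = (n+1)(n+1+a+b) Q_n(y).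
  have hev : ((rawPoly a b (n + 1)).roots.map (fun y => 1 - y)).prod *
      ((rawPoly a b (n + 1)).roots.map (derivative (rawPoly a b (n + 1))).eval).prod =
      (((n : ℂ) + 1) * (n + 1 + a + b)) ^ (n + 1) * crossProd a b n := by
    rw [← Multiset.prod_map_mul, crossProd]
    have hc := prod_map_mul_left_const (rawPoly a b (n + 1)).roots
      (((n : ℂ) + 1) * (n + 1 + a + b)) (rawPoly a b n).eval
    rw [card_roots_rawPoly ha] at hc
    rw [← hc]
    congr 1
    refine Multiset.map_congr rfl fun y hy => ?_
    have hy' : (rawPoly a b (n + 1)).eval y = 0 := (mem_roots'.1 hy).2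
    have := congrArg (eval y) (one_sub_X_mul_derivative_rawPoly a b n)
    simpa [hy'] using this
  -- The product of the 1 - y is known from the value at 1.
  have h1 := eval_eq_leadingCoeff_mul_prod (rawPoly a b (n + 1)) 1
  rw [eval_one_rawPoly, leadingCoeff_rawPoly ha] at h1
  have hA := poch_ne_zero ha (n + 1)
  rw [show 2 * (n + 1) - 2 = 2 * n by omega, show n + 1 - 1 = n by omega] at h
  apply mul_left_cancel₀ (pow_ne_zero (n + 1) hA)
  rw [h1]
  generalize poch (1 + a) (n + 1) = A at *
  linear_combination (A ^ 2 * ((rawPoly a b (n + 1)).roots.map (fun y => 1 - y)).prod) * h +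
    ((-1) ^ ((n + 1) * n / 2) * A ^ (2 * n + 2)) * hev
end


/-! ### Euler's limit and ratios of Gamma functions -/

lemma Gamma_add_nat (z : ℂ) (hz : ∀ i : ℕ, z + i ≠ 0) (n : ℕ) :
    Complex.Gamma (z + n) = Complex.Gamma z * poch z n := by
  induction n with
  | zero => simp
  | succ n ih =>
    rw [poch_succ, ← mul_assoc, ← ih, mul_comm, ← Complex.Gamma_add_one _ (hz n)]
    push_cast; ring_nf

lemma one_add_add_nat_ne_zero {z : ℂ} (hz : -1 < z.re) (i : ℕ) : 1 + z + i ≠ 0 := by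
  intro h
  have := congrArg Complex.re h
  simp only [Complex.add_re, Complex.one_re, Complex.natCast_re, Complex.zero_re] at this
  have hi : (0 : ℝ) ≤ i := Nat.cast_nonneg i
  linarith

lemma Gamma_one_add_ne_zero {z : ℂ} (hz : -1 < z.re) : Complex.Gamma (1 + z) ≠ 0 :=
  Complex.Gamma_ne_zero_of_re_pos (by simp; linarith)

lemma tendsto_natCast_div_add (z : ℂ) :
    Tendsto (fun n : ℕ => (n : ℂ) / (z + n)) atTop (𝓝 1) := by
  have h := tendsto_natCast_div_add_atTop (𝕜 := ℂ) z
  simpa [add_comm] using h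

/-- Euler's limit formula inverted; `GammaSeq` has one more factor in its denominator, which n /
(1+z+n) → 1 removes. -/
lemma tendsto_poch {z : ℂ} (hz : -1 < z.re) :
    Tendsto (fun n : ℕ => poch (1 + z) n / ((n.factorial : ℂ) * (n : ℂ) ^ z)) atTop
      (𝓝 (Complex.Gamma (1 + z))⁻¹) := by
  have h := ((Complex.GammaSeq_tendsto_Gamma (1 + z)).inv₀ (Gamma_one_add_ne_zero hz)).mul
    (tendsto_natCast_div_add (1 + z))
  rw [mul_one] at h
  refine h.congr' ?_
  filter_upwards [eventually_gt_atTop 0] with n hn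
  have hn' : (n : ℂ) ≠ 0 := by exact_mod_cast hn.ne'
  have h1 := poch_ne_zero (one_add_add_nat_ne_zero hz) n
  have h2 := one_add_add_nat_ne_zero hz n
  have hf : (n.factorial : ℂ) ≠ 0 := by exact_mod_cast n.factorial_ne_zero
  have hp : (n : ℂ) ^ z ≠ 0 := by simp [Complex.cpow_eq_zero_iff, hn']
  have hG : Complex.GammaSeq (1 + z) n =
      (n : ℂ) * (n : ℂ) ^ z * n.factorial / (poch (1 + z) n * (1 + z + n)) := by
    rw [Complex.GammaSeq, Complex.cpow_add _ _ hn', Complex.cpow_one, ← poch_succ, poch]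
  rw [hG]
  field_simp

lemma tendsto_Gamma_add_nat {z : ℂ} (hz : -1 < z.re) :
    Tendsto (fun n : ℕ => Complex.Gamma (1 + z + n) / ((n.factorial : ℂ) * (n : ℂ) ^ z)) atTop
      (𝓝 1) := by
  have h := (tendsto_poch hz).const_mul (Complex.Gamma (1 + z))
  rw [mul_inv_cancel₀ (Gamma_one_add_ne_zero hz)] at h
  refine h.congr fun n => ?_
  rw [Gamma_add_nat _ (one_add_add_nat_ne_zero hz), mul_div_assoc]

lemma norm_natCast_cpow {n : ℕ} (hn : 0 < n) (z : ℂ) : ‖(n : ℂ) ^ z‖ = (n : ℝ) ^ z.re :=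
  Complex.norm_natCast_cpow_of_pos hn z

lemma tendsto_norm_Gamma_add_nat {z : ℂ} (hz : -1 < z.re) :
    Tendsto (fun n : ℕ => ‖Complex.Gamma (1 + z + n)‖ / ((n.factorial : ℝ) * (n : ℝ) ^ z.re)) atTop
      (𝓝 1) := by
  have h := (tendsto_Gamma_add_nat hz).norm
  rw [norm_one] at h
  refine h.congr' ?_
  filter_upwards [eventually_gt_atTop 0] with n hn
  rw [norm_div, norm_mul, norm_natCast_cpow hn, Complex.norm_natCast]

lemma tendsto_real_Gamma_add_nat {s : ℝ} (hs : -1 < s) :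
    Tendsto (fun n : ℕ => Real.Gamma (1 + s + n) / ((n.factorial : ℝ) * (n : ℝ) ^ s)) atTop
      (𝓝 1) := by
  refine (tendsto_norm_Gamma_add_nat (z := (s : ℂ)) (by simpa using hs)).congr fun n => ?_
  have hpos : 0 < 1 + s + n := by
    have : (0 : ℝ) ≤ n := Nat.cast_nonneg n
    linarith
  rw [show (1 : ℂ) + s + n = ((1 + s + n : ℝ) : ℂ) by push_cast; ring, Complex.Gamma_ofReal,
    Complex.norm_real, Real.norm_of_nonneg (Real.Gamma_pos_of_pos hpos).le, Complex.ofReal_re]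

/-! ### Cauchy's beta integral -/

/-- `(2 sin (θ/2))^s exp (l (θ - π))`. -/
def cauchyIntegrand (s : ℝ) (l : ℂ) (θ : ℝ) : ℂ :=
  (((2 * Real.sin (θ / 2)) ^ s : ℝ) : ℂ) * Complex.exp (l * (θ - Real.pi))

/-- `∫_0^{2π} (2 sin (θ/2))^s exp (l (θ - π)) dθ`. -/
def cauchyIntegral (s : ℝ) (l : ℂ) : ℂ := ∫ θ in (0 : ℝ)..(2 * Real.pi), cauchyIntegrand s l θ

lemma two_sin_half_pos {θ : ℝ} (h0 : 0 < θ) (h1 : θ < 2 * Real.pi) : 0 < 2 * Real.sin (θ / 2) :=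
  mul_pos two_pos (Real.sin_pos_of_pos_of_lt_pi (by linarith) (by linarith))

lemma intervalIntegrable_two_sin_half_left {s : ℝ} (hs : -1 < s) (hs0 : s ≤ 0) :
    IntervalIntegrable (fun θ => (2 * Real.sin (θ / 2)) ^ s) MeasureTheory.volume 0 Real.pi := by
  have hg : IntervalIntegrable (fun θ : ℝ => (2 / Real.pi) ^ s * θ ^ s)
      MeasureTheory.volume 0 Real.pi :=
    (intervalIntegral.intervalIntegrable_rpow' hs).const_mul _
  refine hg.mono_fun ((by fun_prop : Measurable fun θ : ℝ =>
    2 * Real.sin (θ / 2)).pow_const s).aestronglyMeasurable ?_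
  rw [Filter.EventuallyLE, MeasureTheory.ae_restrict_iff' measurableSet_uIoc]
  refine Eventually.of_forall fun θ hθ => ?_
  rw [Set.uIoc_of_le Real.pi_pos.le] at hθ
  have hpi := Real.pi_pos
  -- Jordan's inequality: near 0 the sine is bounded below by a line, and s ≤ 0 reverses this for
  -- the powers.
  have hj := Real.mul_le_sin (x := θ / 2) (by linarith [hθ.1]) (by linarith [hθ.2])
  have hq : 0 < 2 / Real.pi * θ := mul_pos (by positivity) hθ.1
  have hle : 2 / Real.pi * θ ≤ 2 * Real.sin (θ / 2) := by
    calc 2 / Real.pi * θ = 2 * (2 / Real.pi * (θ / 2)) := by ring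
      _ ≤ _ := by linarith
  rw [Real.norm_of_nonneg (Real.rpow_nonneg (hq.le.trans hle) _), Real.norm_of_nonneg
    (mul_nonneg (Real.rpow_nonneg (by positivity) _) (Real.rpow_nonneg hθ.1.le _)),
    ← Real.mul_rpow (by positivity) hθ.1.le]
  exact Real.rpow_le_rpow_of_nonpos hq hle hs0

lemma intervalIntegrable_two_sin_half {s : ℝ} (hs : -1 < s) :
    IntervalIntegrable (fun θ => (2 * Real.sin (θ / 2)) ^ s) MeasureTheory.volume 0
      (2 * Real.pi) := by
  rcases le_or_gt 0 s with h | h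
  · apply Continuous.intervalIntegrable
    exact Continuous.rpow_const (by fun_prop) fun _ => Or.inr h
  · have h1 := intervalIntegrable_two_sin_half_left hs h.le
    refine h1.trans ?_
    have h2 := (h1.comp_sub_left (2 * Real.pi)).symm
    rw [sub_zero, show 2 * Real.pi - Real.pi = Real.pi by ring] at h2
    refine h2.congr fun θ _ => ?_
    rw [show (2 * Real.pi - θ) / 2 = Real.pi - θ / 2 by ring, Real.sin_pi_sub]

lemma intervalIntegrable_cauchyIntegrand {s : ℝ} (hs : -1 < s) (l : ℂ) :
    IntervalIntegrable (cauchyIntegrand s l) MeasureTheory.volume 0 (2 * Real.pi) := by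
  refine IntervalIntegrable.mul_continuousOn ?_ (by fun_prop)
  have h := intervalIntegrable_two_sin_half hs
  rw [intervalIntegrable_iff] at h ⊢
  exact h.ofReal

/-- Together with its conjugate, this turns factors sin(θ/2) and cos(θ/2) into shifts of the
frequency `l` by ±i/2. -/
lemma exp_half_shift (θ : ℝ) :
    Complex.exp (Complex.I / 2 * (θ - Real.pi)) =
      Real.sin (θ / 2) - Complex.I * Real.cos (θ / 2) := by
  rw [show Complex.I / 2 * ((θ : ℂ) - Real.pi) =
    ((θ / 2 : ℝ) : ℂ) * Complex.I + -(((Real.pi / 2 : ℝ) : ℂ) * Complex.I) by push_cast; ring,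
    Complex.exp_add, Complex.exp_neg, Complex.exp_mul_I, Complex.exp_mul_I]
  simp only [← Complex.ofReal_cos, ← Complex.ofReal_sin, Real.cos_pi_div_two, Real.sin_pi_div_two]
  simp only [Complex.ofReal_zero, Complex.ofReal_one, zero_add, one_mul, Complex.inv_I]
  ring_nf
  rw [Complex.I_sq]; ring

lemma exp_neg_half_shift (θ : ℝ) :
    Complex.exp (-(Complex.I / 2) * (θ - Real.pi)) =
      Real.sin (θ / 2) + Complex.I * Real.cos (θ / 2) := by
  have h := congrArg (starRingEnd ℂ) (exp_half_shift θ)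
  rw [← Complex.exp_conj] at h
  simpa [-Complex.ofReal_sin, -Complex.ofReal_cos, map_div₀, neg_div, map_ofNat] using h

lemma hasDerivAt_cauchyPrimitive (s : ℝ) (l : ℂ) {θ : ℝ} (h0 : 0 < θ) (h1 : θ < 2 * Real.pi) :
    HasDerivAt (cauchyIntegrand (s + 1) l)
      ((l + Complex.I * (s + 1) / 2) * cauchyIntegrand s (l + Complex.I / 2) θ +
        (l - Complex.I * (s + 1) / 2) * cauchyIntegrand s (l - Complex.I / 2) θ) θ := by
  have hpos := two_sin_half_pos h0 h1
  have hd1 : HasDerivAt (fun θ : ℝ => 2 * Real.sin (θ / 2)) (Real.cos (θ / 2)) θ := by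
    have := ((Real.hasDerivAt_sin (θ / 2)).comp θ ((hasDerivAt_id θ).div_const 2)).const_mul 2
    refine this.congr_deriv ?_
    ring
  have hd2 := (hd1.rpow_const (p := s + 1) (Or.inl hpos.ne')).ofReal_comp
  have hd3 : HasDerivAt (fun θ : ℝ => Complex.exp (l * (θ - Real.pi)))
      (Complex.exp (l * (θ - Real.pi)) * l) θ := by
    have h := (((hasDerivAt_id (θ : ℂ)).sub_const (Real.pi : ℂ)).const_mul l).cexp.comp_ofReal
    simpa using h
  refine (hd2.mul hd3).congr_deriv ?_
  unfold cauchyIntegrand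
  rw [add_mul l (Complex.I / 2) ((θ : ℂ) - Real.pi), sub_eq_add_neg l (Complex.I / 2),
    add_mul l (-(Complex.I / 2)) ((θ : ℂ) - Real.pi), Complex.exp_add, Complex.exp_add,
    exp_half_shift, exp_neg_half_shift, Real.rpow_add_one hpos.ne', add_sub_cancel_right]
  push_cast
  ring_nf
  rw [Complex.I_sq]; ring

/-- The integral of the derivative of (2 sin(θ/2))^{s+1} e^{l(θ-π)}. The boundary values vanish
because s + 1 > 0. -/
lemma cauchyIntegral_shift {s : ℝ} (hs : -1 < s) (l : ℂ) :
    (l + Complex.I * (s + 1) / 2) * cauchyIntegral s (l + Complex.I / 2) +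
      (l - Complex.I * (s + 1) / 2) * cauchyIntegral s (l - Complex.I / 2) = 0 := by
  have hc : Continuous (cauchyIntegrand (s + 1) l) := by
    unfold cauchyIntegrand
    refine Continuous.mul (Complex.continuous_ofReal.comp ?_) (by fun_prop)
    exact Continuous.rpow_const (by fun_prop) fun _ => Or.inr (by linarith)
  have hi1 := (intervalIntegrable_cauchyIntegrand hs (l + Complex.I / 2)).const_mul
    (l + Complex.I * (s + 1) / 2)
  have hi2 := (intervalIntegrable_cauchyIntegrand hs (l - Complex.I / 2)).const_mul
    (l - Complex.I * (s + 1) / 2)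
  have h := intervalIntegral.integral_eq_sub_of_hasDerivAt_of_le (by positivity) hc.continuousOn
    (fun θ hθ => hasDerivAt_cauchyPrimitive s l hθ.1 hθ.2) (hi1.add hi2)
  rw [intervalIntegral.integral_add hi1 hi2, intervalIntegral.integral_const_mul,
    intervalIntegral.integral_const_mul] at h
  have hs1 : s + 1 ≠ 0 := by linarith
  unfold cauchyIntegral
  rw [h]
  simp [cauchyIntegrand, Real.zero_rpow hs1]

/-- This is 4 sin²(θ/2) = 2 + e^{i(θ-π)} + e^{-i(θ-π)}. -/
lemma cauchyIntegrand_add_two {s : ℝ} (l : ℂ) {θ : ℝ} (h0 : 0 < θ) (h1 : θ < 2 * Real.pi) :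
    cauchyIntegrand (s + 2) l θ = cauchyIntegrand s (l + Complex.I) θ + 2 * cauchyIntegrand s l θ +
      cauchyIntegrand s (l - Complex.I) θ := by
  unfold cauchyIntegrand
  rw [show l + Complex.I = l + (Complex.I / 2 + Complex.I / 2) by ring,
    show l - Complex.I = l + (-(Complex.I / 2) + -(Complex.I / 2)) by ring,
    add_mul l, add_mul l, add_mul, add_mul, Complex.exp_add, Complex.exp_add, Complex.exp_add,
    Complex.exp_add, exp_half_shift, exp_neg_half_shift,
    Real.rpow_add (two_sin_half_pos h0 h1), Real.rpow_two]
  have h := Complex.sin_sq_add_cos_sq ((θ / 2 : ℝ) : ℂ)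
  push_cast at h ⊢
  linear_combination (-((((2 * Real.sin (θ / 2)) ^ s : ℝ) : ℂ) *
    Complex.exp (l * (θ - Real.pi)))) * (2 * Complex.cos (θ / 2) ^ 2 * Complex.I_sq - 2 * h)

lemma cauchyIntegral_add_two {s : ℝ} (hs : -1 < s) (l : ℂ) :
    cauchyIntegral (s + 2) l = cauchyIntegral s (l + Complex.I) + 2 * cauchyIntegral s l +
      cauchyIntegral s (l - Complex.I) := by
  have hi := fun l => intervalIntegrable_cauchyIntegrand hs l
  unfold cauchyIntegral
  rw [← intervalIntegral.integral_const_mul, ← intervalIntegral.integral_add (hi _)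
    ((hi _).const_mul 2), ← intervalIntegral.integral_add ((hi _).add ((hi _).const_mul 2)) (hi _)]
  exact intervalIntegral.integral_congr_Ioo_of_le (by positivity) fun θ hθ =>
    cauchyIntegrand_add_two l hθ.1 hθ.2

/-- The moments with an integer frequency shift obey a hypergeometric recurrence. -/
lemma cauchyIntegral_recurrence {α : ℝ} (hα : -1 / 2 < α) (β : ℝ) (k : ℤ) :
    (α + Complex.I * β - k) * cauchyIntegral (2 * α) (-β - Complex.I * k) =
      (1 + (α - Complex.I * β) + k) *
        cauchyIntegral (2 * α) (-β - Complex.I * (k + 1 : ℤ)) := by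
  -- This frequency is the midpoint between those of the two moments k and k + 1.
  have h := cauchyIntegral_shift (s := 2 * α) (by linarith)
    (-β - Complex.I * k - Complex.I / 2)
  rw [show -(β : ℂ) - Complex.I * k - Complex.I / 2 + Complex.I / 2 = -β - Complex.I * k by ring,
    show -(β : ℂ) - Complex.I * k - Complex.I / 2 - Complex.I / 2 =
      -β - Complex.I * (k + 1 : ℤ) by push_cast; ring] at h
  push_cast at h ⊢
  generalize cauchyIntegral (2 * α) (-β - Complex.I * k) = A at *
  generalize cauchyIntegral (2 * α) (-β - Complex.I * (k + 1)) = B at *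
  linear_combination (-Complex.I) * h + (A * (α - k) - B * (1 + α + k)) * Complex.I_sq

/-- Raising s by 2 brings in the two neighbouring frequencies, which the recurrences at k = 0 and k
= -1 reduce to the central one. -/
lemma cauchyIntegral_add_two_real {s : ℝ} (hs : -1 < s) (β : ℝ) :
    (1 + s / 2 + Complex.I * β) * (1 + s / 2 - Complex.I * β) * cauchyIntegral (s + 2) (-β) =
      (1 + s) * (2 + s) * cauchyIntegral s (-β) := by
  have h0 := cauchyIntegral_recurrence (α := s / 2) (by linarith) β 0
  have h1 := cauchyIntegral_recurrence (α := s / 2) (by linarith) β (-1)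
  have h2 := cauchyIntegral_add_two hs (-β)
  rw [mul_div_cancel₀ _ (two_ne_zero' ℝ)] at h0 h1
  push_cast at h0 h1
  simp only [mul_zero, mul_one, sub_zero, mul_neg, sub_neg_eq_add] at h0 h1
  rw [h2]
  generalize cauchyIntegral s (-β + Complex.I) = A at *
  generalize cauchyIntegral s (-β - Complex.I) = B at *
  generalize cauchyIntegral s (-β) = D at *
  linear_combination (1 + s / 2 - Complex.I * β) * h1 - (1 + s / 2 + Complex.I * β) * h0


lemma cauchyIntegrand_ofReal (s l θ : ℝ) :
    cauchyIntegrand s l θ =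
      (((2 * Real.sin (θ / 2)) ^ s * Real.exp (l * (θ - Real.pi)) : ℝ) : ℂ) := by
  simp [cauchyIntegrand]

/-- The Cauchy integral with real frequency. -/
def realCauchyIntegral (s l : ℝ) : ℝ :=
  ∫ θ in (0 : ℝ)..(2 * Real.pi), (2 * Real.sin (θ / 2)) ^ s * Real.exp (l * (θ - Real.pi))

lemma cauchyIntegral_ofReal (s l : ℝ) : cauchyIntegral s l = (realCauchyIntegral s l : ℂ) := by
  rw [cauchyIntegral, realCauchyIntegral, ← intervalIntegral.integral_ofReal]
  simp only [cauchyIntegrand_ofReal]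

lemma intervalIntegrable_realCauchyIntegrand {s : ℝ} (hs : -1 < s) (l : ℝ) :
    IntervalIntegrable (fun θ => (2 * Real.sin (θ / 2)) ^ s * Real.exp (l * (θ - Real.pi)))
      MeasureTheory.volume 0 (2 * Real.pi) :=
  (intervalIntegrable_two_sin_half hs).mul_continuousOn (by fun_prop)

lemma realCauchyIntegral_pos {s : ℝ} (hs : -1 < s) (l : ℝ) : 0 < realCauchyIntegral s l :=
  intervalIntegral.intervalIntegral_pos_of_pos_on (intervalIntegrable_realCauchyIntegrand hs l)
    (fun _ hθ => mul_pos (Real.rpow_pos_of_pos (two_sin_half_pos hθ.1 hθ.2) _) (Real.exp_pos _))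
    (by positivity)

lemma realCauchyIntegral_le {s t : ℝ} (hs : -1 < s) (hst : s ≤ t) (l : ℝ) :
    realCauchyIntegral t l ≤ 2 ^ (t - s) * realCauchyIntegral s l := by
  unfold realCauchyIntegral
  rw [← intervalIntegral.integral_const_mul]
  refine intervalIntegral.integral_mono_on_of_le_Ioo (by positivity)
    (intervalIntegrable_realCauchyIntegrand (hs.trans_le hst) l)
    ((intervalIntegrable_realCauchyIntegrand hs l).const_mul _) fun θ hθ => ?_
  have hpos := two_sin_half_pos hθ.1 hθ.2
  rw [← mul_assoc]
  refine mul_le_mul_of_nonneg_right ?_ (Real.exp_pos _).le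
  conv_lhs => rw [← sub_add_cancel t s, Real.rpow_add hpos]
  exact mul_le_mul_of_nonneg_right (Real.rpow_le_rpow hpos.le
    (by linarith [Real.sin_le_one (θ / 2)]) (by linarith)) (Real.rpow_nonneg hpos.le _)

/-- The ratio of the Cauchy integral and its Gamma function evaluation, up to the factor `2π`. -/
def cauchyRatio (β s : ℝ) : ℝ :=
  realCauchyIntegral s (-β) * (‖Complex.Gamma (1 + (s / 2 + Complex.I * β))‖ ^ 2 /
    Real.Gamma (1 + s))

lemma norm_Gamma_half_add_one {s : ℝ} (hs : -1 < s) (β : ℝ) :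
    ‖Complex.Gamma (1 + ((s + 2 : ℝ) / 2 + Complex.I * β))‖ =
      ‖1 + (s / 2 + Complex.I * β)‖ * ‖Complex.Gamma (1 + (s / 2 + Complex.I * β))‖ := by
  have hne : (1 : ℂ) + (s / 2 + Complex.I * β) ≠ 0 := by
    simpa using one_add_add_nat_ne_zero (z := s / 2 + Complex.I * β) (by simp; linarith) 0
  rw [← norm_mul, ← Complex.Gamma_add_one _ hne]
  congr 2
  push_cast; ring

/-- The factor gained by the integral when s grows by 2 is exactly the one lost by the Gamma
quotient. This periodicity replaces an analytic continuation in s. -/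
lemma cauchyRatio_add_two {s : ℝ} (hs : -1 < s) (β : ℝ) :
    cauchyRatio β (s + 2) = cauchyRatio β s := by
  have h := cauchyIntegral_add_two_real hs β
  have e : (-β : ℂ) = ((-β : ℝ) : ℂ) := by push_cast; rfl
  rw [e, cauchyIntegral_ofReal, cauchyIntegral_ofReal] at h
  have hn : (1 + (s : ℂ) / 2 + Complex.I * β) * (1 + s / 2 - Complex.I * β) =
      ((‖(1 : ℂ) + (s / 2 + Complex.I * β)‖ ^ 2 : ℝ) : ℂ) := by
    push_cast
    rw [← Complex.mul_conj']
    simp only [map_add, map_mul, map_div₀, map_one, Complex.conj_ofReal, Complex.conj_I, map_ofNat]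
    ring
  rw [hn] at h
  have h' : ‖(1 : ℂ) + (s / 2 + Complex.I * β)‖ ^ 2 * realCauchyIntegral (s + 2) (-β) =
      (1 + s) * (2 + s) * realCauchyIntegral s (-β) := by exact_mod_cast h
  unfold cauchyRatio
  have hs1 : (1 + s) ≠ 0 := by linarith
  have hs2 : (2 + s) ≠ 0 := by linarith
  have hG : Real.Gamma (1 + (s + 2)) = (2 + s) * ((1 + s) * Real.Gamma (1 + s)) := by
    rw [← Real.Gamma_add_one hs1, show 1 + s + 1 = 2 + s by ring, ← Real.Gamma_add_one hs2]
    congr 1; ring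
  have hG0 : Real.Gamma (1 + s) ≠ 0 := (Real.Gamma_pos_of_pos (by linarith)).ne'
  rw [hG, norm_Gamma_half_add_one hs]
  generalize ‖Complex.Gamma (1 + (s / 2 + Complex.I * β))‖ = g
  generalize ‖(1 : ℂ) + (s / 2 + Complex.I * β)‖ = r at *
  field_simp
  linear_combination g ^ 2 * h'

lemma cauchyRatio_add_two_mul {s : ℝ} (hs : -1 < s) (β : ℝ) (n : ℕ) :
    cauchyRatio β (s + 2 * n) = cauchyRatio β s := by
  induction n with
  | zero => simp
  | succ n ih =>
    have hn : (0 : ℝ) ≤ n := n.cast_nonneg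
    rw [← ih, ← cauchyRatio_add_two (s := s + 2 * n) (by linarith)]
    congr 1; push_cast; ring

/-- The factorial factor does not depend on `s`. It cancels when two exponents are compared, leaving
the ratio of the powers of 2. -/
lemma tendsto_Gamma_quotient {s : ℝ} (hs : -1 < s) (β : ℝ) :
    Tendsto (fun n : ℕ => ‖Complex.Gamma (1 + ((s + 2 * n : ℝ) / 2 + Complex.I * β))‖ ^ 2 /
      Real.Gamma (1 + (s + 2 * n)) * (((2 * n).factorial : ℝ) / (n.factorial : ℝ) ^ 2) * 2 ^ s)
      atTop (𝓝 1) := by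
  have h1 := (tendsto_norm_Gamma_add_nat (z := s / 2 + Complex.I * β) (by simp; linarith)).pow 2
  have h2 := (tendsto_real_Gamma_add_nat hs).comp
    (tendsto_id.const_mul_atTop' (two_pos : (0 : ℕ) < 2))
  have h3 := h1.div h2 one_ne_zero
  rw [one_pow, div_one] at h3
  refine h3.congr' ?_
  filter_upwards [eventually_gt_atTop 0] with n hn
  have hn' : (0 : ℝ) < n := by exact_mod_cast hn
  have hre : (s / 2 + Complex.I * β : ℂ).re = s / 2 := by simp
  simp only [Pi.div_apply, Function.comp, id]
  rw [hre, show (1 : ℂ) + (s / 2 + Complex.I * β) + n =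
    1 + ((s + 2 * n : ℝ) / 2 + Complex.I * β) by push_cast; ring]
  push_cast
  rw [show 1 + s + 2 * (n : ℝ) = 1 + (s + 2 * n) by ring, Real.mul_rpow two_pos.le hn'.le, div_pow,
    mul_pow ((n.factorial : ℝ)), ← Real.rpow_natCast ((n : ℝ) ^ (s / 2)) 2, ← Real.rpow_mul hn'.le,
    show s / 2 * ((2 : ℕ) : ℝ) = s by push_cast; ring]
  have hG : Real.Gamma (1 + (s + 2 * n)) ≠ 0 := (Real.Gamma_pos_of_pos (by linarith)).ne'
  have hp : (n : ℝ) ^ s ≠ 0 := (Real.rpow_pos_of_pos hn' _).ne'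
  have hf : ((2 * n).factorial : ℝ) ≠ 0 := by exact_mod_cast (2 * n).factorial_ne_zero
  field_simp

/-- By periodicity both exponents may be raised by 2n. Then 2 sin(θ/2) ≤ 2 costs a factor 2^{t-s},
and the quotient of the Gamma factors tends to 2^{s-t}, so nothing is lost in the limit. -/
lemma cauchyRatio_antitone {s t : ℝ} (hs : -1 < s) (hst : s ≤ t) (β : ℝ) :
    cauchyRatio β t ≤ cauchyRatio β s := by
  have ht := hs.trans_le hst
  have hlim := ((tendsto_Gamma_quotient ht β).div (tendsto_Gamma_quotient hs β)
    one_ne_zero).const_mul (cauchyRatio β s)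
  rw [div_one, mul_one] at hlim
  refine ge_of_tendsto' hlim fun n => ?_
  have hn : (0 : ℝ) ≤ n := n.cast_nonneg
  have hc : (0 : ℝ) < ((2 * n).factorial : ℝ) / (n.factorial : ℝ) ^ 2 := by positivity
  have hle := realCauchyIntegral_le (s := s + 2 * n) (t := t + 2 * n) (by linarith) (by linarith)
    (-β)
  rw [← cauchyRatio_add_two_mul hs β n, ← cauchyRatio_add_two_mul ht β n, Pi.div_apply]
  unfold cauchyRatio
  rw [show t + 2 * n - (s + 2 * (n : ℝ)) = t - s by ring, Real.rpow_sub two_pos] at hle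
  have hGs : 0 < Real.Gamma (1 + (s + 2 * n)) := Real.Gamma_pos_of_pos (by linarith)
  have hGt : 0 < Real.Gamma (1 + (t + 2 * n)) := Real.Gamma_pos_of_pos (by linarith)
  have hGc : 0 < ‖Complex.Gamma (1 + ((s + 2 * n : ℝ) / 2 + Complex.I * β))‖ :=
    norm_pos_iff.2 (Gamma_one_add_ne_zero (by simp; linarith))
  have h2s : (0 : ℝ) < 2 ^ s := by positivity
  set u := ‖Complex.Gamma (1 + ((s + 2 * n : ℝ) / 2 + Complex.I * β))‖ ^ 2 /
    Real.Gamma (1 + (s + 2 * n)) with hu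
  have hu0 : 0 < u := by positivity
  set v := ‖Complex.Gamma (1 + ((t + 2 * n : ℝ) / 2 + Complex.I * β))‖ ^ 2 /
    Real.Gamma (1 + (t + 2 * n)) with hv
  have hv0 : 0 ≤ v := by positivity
  calc _ ≤ 2 ^ t / 2 ^ s * realCauchyIntegral (s + 2 * n) (-β) * v :=
        mul_le_mul_of_nonneg_right hle hv0
    _ = _ := by field_simp

/-- An antitone function of period 2 is constant: s lies between -2 and 2n for some n. -/
lemma cauchyRatio_eq_zero_arg {s : ℝ} (hs : -1 < s) (β : ℝ) :
    cauchyRatio β s = cauchyRatio β 0 := by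
  apply le_antisymm
  · rw [← cauchyRatio_add_two hs]
    exact cauchyRatio_antitone (by norm_num) (by linarith) β
  · obtain ⟨n, hn⟩ := exists_nat_ge s
    rw [← cauchyRatio_add_two_mul (by norm_num : (-1 : ℝ) < 0) β n]
    refine cauchyRatio_antitone hs ?_ β
    have : (0 : ℝ) ≤ n := n.cast_nonneg
    linarith

/-- At s = 0 the integral is elementary, 2 sinh(πβ)/β, and the reflection formula gives |Γ(1+iβ)|² =
πβ / sinh(πβ). -/
lemma cauchyRatio_zero (β : ℝ) : cauchyRatio β 0 = 2 * Real.pi := by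
  unfold cauchyRatio realCauchyIntegral
  rcases eq_or_ne β 0 with rfl | hβ
  · simp
  have hβc : (β : ℂ) ≠ 0 := by exact_mod_cast hβ
  have hI : ∫ θ in (0 : ℝ)..(2 * Real.pi), (2 * Real.sin (θ / 2)) ^ (0 : ℝ) *
      Real.exp (-β * (θ - Real.pi)) = 2 * Real.sinh (Real.pi * β) / β := by
    have hd : ∀ θ ∈ Set.uIcc 0 (2 * Real.pi), HasDerivAt
        (fun θ : ℝ => -Real.exp (-β * (θ - Real.pi)) / β) (Real.exp (-β * (θ - Real.pi))) θ := by
      intro θ _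
      have := ((((hasDerivAt_id θ).sub_const Real.pi).const_mul (-β)).exp.neg).div_const β
      refine this.congr_deriv ?_
      simp only [id]; field_simp
    simp only [Real.rpow_zero, one_mul]
    rw [intervalIntegral.integral_eq_sub_of_hasDerivAt hd
      (Continuous.intervalIntegrable (by fun_prop) _ _), Real.sinh_eq]
    rw [show -β * (2 * Real.pi - Real.pi) = -(Real.pi * β) by ring,
      show -β * (0 - Real.pi) = Real.pi * β by ring]
    field_simp; ring
  have hG : ‖Complex.Gamma (1 + ((0 : ℝ) / 2 + Complex.I * β))‖ ^ 2 =
      Real.pi * β / Real.sinh (Real.pi * β) := by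
    have h1 : ((‖Complex.Gamma (1 + ((0 : ℝ) / 2 + Complex.I * β))‖ ^ 2 : ℝ) : ℂ) =
        ((Real.pi * β / Real.sinh (Real.pi * β) : ℝ) : ℂ) := by
      push_cast
      rw [← Complex.mul_conj', ← Complex.Gamma_conj]
      simp only [map_add, map_mul, map_one, Complex.conj_ofReal, Complex.conj_I, zero_div, zero_add]
      have hr := Complex.Gamma_mul_Gamma_one_sub (Complex.I * β)
      rw [show (Real.pi : ℂ) * (Complex.I * β) = (Real.pi * β) * Complex.I by ring,
        Complex.sin_mul_I] at hr
      rw [add_comm 1 (Complex.I * (β : ℂ)), Complex.Gamma_add_one _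
        (mul_ne_zero Complex.I_ne_zero hβc), neg_mul, ← sub_eq_add_neg, mul_assoc, hr]
      have : Complex.sinh (Real.pi * β) ≠ 0 := by
        rw [← Complex.ofReal_mul, ← Complex.ofReal_sinh]
        have : Real.sinh (Real.pi * β) ≠ 0 := by
          rw [Ne, Real.sinh_eq_zero]; exact mul_ne_zero Real.pi_ne_zero hβ
        exact_mod_cast this
      have := Complex.I_ne_zero
      field_simp
    exact_mod_cast h1
  rw [hI]
  have hsh : Real.sinh (Real.pi * β) ≠ 0 := by
    rw [Ne, Real.sinh_eq_zero]; exact mul_ne_zero Real.pi_ne_zero hβ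
  rw [hG, add_zero, Real.Gamma_one]
  field_simp

/-- Cauchy's beta integral. -/
lemma realCauchyIntegral_eq {α : ℝ} (hα : -1 / 2 < α) (β : ℝ) :
    realCauchyIntegral (2 * α) (-β) =
      2 * Real.pi * Real.Gamma (1 + 2 * α) / ‖Complex.Gamma (1 + (α + Complex.I * β))‖ ^ 2 := by
  have h := (cauchyRatio_eq_zero_arg (s := 2 * α) (by linarith) β).trans (cauchyRatio_zero β)
  unfold cauchyRatio at h
  rw [show ((2 * α : ℝ) : ℂ) / 2 = α by push_cast; ring] at h
  have h1 : ‖Complex.Gamma (1 + (α + Complex.I * β))‖ ≠ 0 :=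
    norm_ne_zero_iff.2 (Gamma_one_add_ne_zero (by simp; linarith))
  have h2 : Real.Gamma (1 + 2 * α) ≠ 0 := (Real.Gamma_pos_of_pos (by linarith)).ne'
  field_simp at h ⊢
  linear_combination h


/-! ### The symbol on the circle and its moments -/

lemma log_polar {r t : ℝ} (hr : 0 < r) (h0 : -Real.pi < t) (h1 : t ≤ Real.pi) :
    Complex.log ((r : ℂ) * Complex.exp (t * Complex.I)) = Real.log r + t * Complex.I := by
  rw [Complex.log_ofReal_mul hr (Complex.exp_ne_zero _), Complex.log_exp (by simpa using h0)
    (by simpa using h1)]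

lemma one_sub_exp_I (θ : ℝ) : 1 - Complex.exp (θ * Complex.I) =
    ((2 * Real.sin (θ / 2) : ℝ) : ℂ) * Complex.exp (((θ - Real.pi) / 2 : ℝ) * Complex.I) := by
  rw [show (((θ - Real.pi) / 2 : ℝ) : ℂ) * Complex.I = Complex.I / 2 * (θ - Real.pi) by
    push_cast; ring, exp_half_shift,
    show (θ : ℂ) * Complex.I = ((2 * (θ / 2) : ℝ) : ℂ) * Complex.I by push_cast; ring,
    Complex.exp_mul_I, ← Complex.ofReal_cos, ← Complex.ofReal_sin, Real.cos_two_mul,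
    Real.sin_two_mul]
  have h := Complex.sin_sq_add_cos_sq ((θ / 2 : ℝ) : ℂ)
  push_cast at h ⊢
  linear_combination (-2) * h

lemma one_sub_exp_neg_I (θ : ℝ) : 1 - 1 / Complex.exp (θ * Complex.I) =
    ((2 * Real.sin (θ / 2) : ℝ) : ℂ) * Complex.exp ((-((θ - Real.pi) / 2) : ℝ) * Complex.I) := by
  have h := congrArg (starRingEnd ℂ) (one_sub_exp_I θ)
  rw [map_sub, map_mul, ← Complex.exp_conj, ← Complex.exp_conj, Complex.conj_ofReal] at h
  rw [one_div, ← Complex.exp_neg]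
  simpa [-Complex.ofReal_sin, -Complex.ofReal_mul, map_ofNat] using h

/-- The arguments of the two bases are ±(θ-π)/2, inside (-π/2, π/2), so the principal logarithms are
explicit. In particular the symbol is positive off z = 1. -/
lemma pureSymbol_exp (α β : ℝ) {θ : ℝ} (h0 : 0 < θ) (h1 : θ < 2 * Real.pi) :
    pureSymbol α β (Complex.exp (θ * Complex.I)) = cauchyIntegrand (2 * α) (-β) θ := by
  have hpos := two_sin_half_pos h0 h1
  have hpi := Real.pi_pos
  have hne : ((2 * Real.sin (θ / 2) : ℝ) : ℂ) ≠ 0 := by exact_mod_cast hpos.ne'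
  rw [pureSymbol, one_sub_exp_I, one_sub_exp_neg_I,
    Complex.cpow_def_of_ne_zero (mul_ne_zero hne (Complex.exp_ne_zero _)),
    Complex.cpow_def_of_ne_zero (mul_ne_zero hne (Complex.exp_ne_zero _)),
    log_polar hpos (by linarith) (by linarith), log_polar hpos (by linarith) (by linarith),
    ← Complex.exp_add, cauchyIntegrand, Real.rpow_def_of_pos hpos, Complex.ofReal_exp,
    ← Complex.exp_add]
  congr 1
  push_cast
  linear_combination ((θ - Real.pi) * β) * Complex.I_sq

lemma circleMap_zero_one (θ : ℝ) : circleMap 0 1 θ = Complex.exp (θ * Complex.I) := by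
  simp [circleMap]

/-- The integrand of a Fourier coefficient of the symbol. -/
lemma fourierIntegrand_eq (α β : ℝ) (k : ℤ) {θ : ℝ} (h0 : 0 < θ) (h1 : θ < 2 * Real.pi) :
    pureSymbol α β (circleMap 0 1 θ) / circleMap 0 1 θ ^ (k + 1) =
      (-1) ^ k * cauchyIntegrand (2 * α) (-β - Complex.I * k) θ *
        Complex.exp (-(θ * Complex.I)) := by
  rw [circleMap_zero_one, pureSymbol_exp α β h0 h1, cauchyIntegrand, cauchyIntegrand,
    zpow_add₀ (Complex.exp_ne_zero _), zpow_one, ← Complex.exp_int_mul, Complex.exp_neg, sub_mul,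
    sub_eq_add_neg (-(β : ℂ) * _), Complex.exp_add,
    show -(Complex.I * (k : ℂ) * ((θ : ℂ) - Real.pi)) =
      k * (Real.pi * Complex.I) + -(k * (θ * Complex.I)) by ring, Complex.exp_add,
    Complex.exp_int_mul (Real.pi * Complex.I) k, Complex.exp_pi_mul_I, Complex.exp_neg]
  -- The sign comes from centring the frequency at π: e^{-ikθ} = (-1)^k e^{-ik(θ-π)}.
  have h2 : ((-1 : ℂ) ^ k) * (-1) ^ k = 1 := by
    rw [← mul_zpow]; norm_num
  have := Complex.exp_ne_zero (k * (θ * Complex.I))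
  have := Complex.exp_ne_zero (θ * Complex.I)
  field_simp
  linear_combination (-((((2 * Real.sin (θ / 2)) ^ (2 * α) : ℝ) : ℂ))) * h2

lemma circleIntegrable_pureSymbol {α : ℝ} (hα : -1 / 2 < α) (β : ℝ) (k : ℤ) :
    CircleIntegrable (fun z => pureSymbol α β z / z ^ (k + 1)) 0 1 := by
  rw [CircleIntegrable]
  have h := ((intervalIntegrable_cauchyIntegrand (s := 2 * α) (by linarith)
    (-β - Complex.I * k)).const_mul ((-1) ^ k)).mul_continuousOn
    (g := fun θ : ℝ => Complex.exp (-(θ * Complex.I))) (by fun_prop)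
  refine h.congr_ae ?_
  rw [Set.uIoc_of_le (by positivity), ← MeasureTheory.Measure.restrict_congr_set
    MeasureTheory.Ioo_ae_eq_Ioc]
  rw [Filter.EventuallyEq, MeasureTheory.ae_restrict_iff' measurableSet_Ioo]
  exact Eventually.of_forall fun θ hθ => (fourierIntegrand_eq α β k hθ.1 hθ.2).symm

lemma symbolCoeff_pureSymbol (α β : ℝ) (k : ℤ) :
    symbolCoeff (pureSymbol α β) k =
      (-1) ^ k / (2 * Real.pi) * cauchyIntegral (2 * α) (-β - Complex.I * k) := by
  rw [symbolCoeff, circleIntegral]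
  have h : ∫ θ in (0 : ℝ)..(2 * Real.pi), deriv (circleMap 0 1) θ •
      (pureSymbol α β (circleMap 0 1 θ) / circleMap 0 1 θ ^ (k + 1)) =
      ∫ θ in (0 : ℝ)..(2 * Real.pi), (Complex.I * (-1) ^ k) *
        cauchyIntegrand (2 * α) (-β - Complex.I * k) θ := by
    refine intervalIntegral.integral_congr_Ioo_of_le (by positivity) fun θ hθ => ?_
    rw [fourierIntegrand_eq α β k hθ.1 hθ.2, deriv_circleMap, circleMap_zero_one, Complex.exp_neg,
      smul_eq_mul]
    have := Complex.exp_ne_zero (θ * Complex.I)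
    field_simp
  rw [h, intervalIntegral.integral_const_mul, ← cauchyIntegral]
  have := Complex.I_ne_zero
  have : (Real.pi : ℂ) ≠ 0 := by exact_mod_cast Real.pi_ne_zero
  field_simp

lemma normConst_eq_inv (α β : ℝ) :
    normConst α β = ((realCauchyIntegral (2 * α) (-β))⁻¹ : ℝ) := by
  have : (Real.pi : ℂ) ≠ 0 := by exact_mod_cast Real.pi_ne_zero
  rw [normConst, symbolCoeff_pureSymbol]
  simp only [Int.cast_zero, mul_zero, sub_zero, zpow_zero]
  rw [show (-β : ℂ) = ((-β : ℝ) : ℂ) by push_cast; rfl, cauchyIntegral_ofReal]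
  push_cast
  congr 1
  field_simp

lemma normConst_eq {α : ℝ} (hα : -1 / 2 < α) (β : ℝ) :
    normConst α β = ((‖Complex.Gamma (1 + (α + Complex.I * β))‖ ^ 2 /
      (2 * Real.pi * Real.Gamma (1 + 2 * α)) : ℝ) : ℂ) := by
  rw [normConst_eq_inv, realCauchyIntegral_eq hα, inv_div]

/-- The moments of the normalised weight with respect to `dz / (iz)`. -/
def moment (α β : ℝ) (k : ℤ) : ℂ := 2 * Real.pi * symbolCoeff (weight α β) k

lemma symbolCoeff_weight (α β : ℝ) (k : ℤ) :
    symbolCoeff (weight α β) k = normConst α β * symbolCoeff (pureSymbol α β) k := by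
  unfold symbolCoeff weight
  simp only [mul_div_assoc, circleIntegral.integral_const_mul]
  ring

lemma moment_eq (α β : ℝ) (k : ℤ) :
    moment α β k =
      normConst α β * (-1) ^ k * cauchyIntegral (2 * α) (-β - Complex.I * k) := by
  have : (Real.pi : ℂ) ≠ 0 := by exact_mod_cast Real.pi_ne_zero
  rw [moment, symbolCoeff_weight, symbolCoeff_pureSymbol]
  field_simp

lemma moment_zero {α : ℝ} (hα : -1 / 2 < α) (β : ℝ) : moment α β 0 = 1 := by
  rw [moment_eq, normConst_eq_inv]
  simp only [Int.cast_zero, mul_zero, sub_zero, zpow_zero]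
  rw [show (-β : ℂ) = ((-β : ℝ) : ℂ) by push_cast; rfl, cauchyIntegral_ofReal, mul_one]
  have := (realCauchyIntegral_pos (s := 2 * α) (by linarith) (-β)).ne'
  rw [← Complex.ofReal_mul, inv_mul_cancel₀ this, Complex.ofReal_one]

lemma moment_recurrence {α : ℝ} (hα : -1 / 2 < α) (β : ℝ) (k : ℤ) :
    (k - (α + Complex.I * β)) * moment α β k =
      (k + 1 + (α - Complex.I * β)) * moment α β (k + 1) := by
  have h := cauchyIntegral_recurrence hα β k
  rw [moment_eq, moment_eq, zpow_add_one₀ (by norm_num : (-1 : ℂ) ≠ 0)]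
  linear_combination (-normConst α β * (-1) ^ k) * h

lemma conj_cauchyIntegral (s : ℝ) (l : ℂ) :
    (starRingEnd ℂ) (cauchyIntegral s l) = cauchyIntegral s ((starRingEnd ℂ) l) := by
  unfold cauchyIntegral
  rw [← intervalIntegral.intervalIntegral_conj]
  congr 1
  ext θ
  simp [cauchyIntegrand, ← Complex.exp_conj, Complex.conj_ofReal, -Complex.ofReal_sin]

lemma conj_moment (α β : ℝ) (k : ℤ) :
    (starRingEnd ℂ) (moment α β k) = moment α β (-k) := by
  rw [moment_eq, moment_eq, map_mul, map_mul, conj_cauchyIntegral, normConst_eq_inv,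
    Complex.conj_ofReal, map_zpow₀, zpow_neg, ← inv_zpow]
  simp [Complex.conj_ofReal]

/-! ### The sesquilinear form of the weight -/

/-- The sesquilinear form of the weight. -/
def circleForm (α β : ℝ) (p q : ℂ[X]) : ℂ :=
  ∮ z in C(0, 1), p.eval z * (starRingEnd ℂ) (q.eval z) * weight α β z / (Complex.I * z)

lemma conj_eval_of_mem_sphere (q : ℂ[X]) {z : ℂ} (hz : ‖z‖ = 1) :
    (starRingEnd ℂ) (q.eval z) = ∑ j ∈ q.support, (starRingEnd ℂ) (q.coeff j) * (z ^ j)⁻¹ := by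
  rw [eval_eq_sum, Polynomial.sum, map_sum]
  refine Finset.sum_congr rfl fun j _ => ?_
  rw [map_mul, map_pow, ← Complex.inv_eq_conj hz, inv_pow]

/-- On the circle the conjugate of z is 1/z, so the conjugated polynomial only shifts frequencies
and the form becomes a finite sum of moments. -/
lemma circleForm_eq {α : ℝ} (hα : -1 / 2 < α) (β : ℝ) (p q : ℂ[X]) :
    circleForm α β p q =
      ∑ j ∈ q.support, (starRingEnd ℂ) (q.coeff j) * momentFun (moment α β) j p := by
  have hi : ∀ (c : ℂ) (k : ℤ), CircleIntegrable
      (fun z => c * (pureSymbol α β z / z ^ (k + 1))) 0 1 := fun c k =>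
    (circleIntegrable_pureSymbol hα β k).const_fun_smul (a := c)
  have hcongr : circleForm α β p q = ∮ z in C(0, 1), ∑ j ∈ q.support, ∑ i ∈ p.support,
      ((starRingEnd ℂ) (q.coeff j) * p.coeff i * normConst α β / Complex.I) *
        (pureSymbol α β z / z ^ (((j : ℤ) - i) + 1)) := by
    refine circleIntegral.integral_congr zero_le_one fun z hz => ?_
    have hz1 : ‖z‖ = 1 := by simpa using hz
    have hz0 : z ≠ 0 := by rintro rfl; simp at hz1
    rw [conj_eval_of_mem_sphere q hz1, eval_eq_sum, Polynomial.sum, Finset.sum_mul_sum,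
      Finset.sum_comm, Finset.sum_mul, Finset.sum_div]
    refine Finset.sum_congr rfl fun j _ => ?_
    rw [Finset.sum_mul, Finset.sum_div]
    refine Finset.sum_congr rfl fun i _ => ?_
    rw [weight, zpow_add_one₀ hz0, zpow_sub₀ hz0, zpow_natCast, zpow_natCast]
    have := Complex.I_ne_zero
    field_simp
  have hpi : (Real.pi : ℂ) ≠ 0 := by exact_mod_cast Real.pi_ne_zero
  rw [hcongr, circleIntegral.integral_fun_sum fun j _ => CircleIntegrable.fun_sum _ fun i _ => hi _ _]
  refine Finset.sum_congr rfl fun j _ => ?_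
  rw [circleIntegral.integral_fun_sum fun i _ => hi _ _, momentFun, Polynomial.lsum_apply,
    Polynomial.sum, Finset.mul_sum]
  refine Finset.sum_congr rfl fun i _ => ?_
  rw [circleIntegral.integral_const_mul]
  simp only [LinearMap.lsmul_apply, smul_eq_mul]
  rw [moment, symbolCoeff_weight, symbolCoeff]
  have := Complex.I_ne_zero
  field_simp


lemma momentFun_eq_sum (M : ℤ → ℂ) (k : ℤ) (p : ℂ[X]) {N : ℕ} (hN : p.natDegree < N) :
    momentFun M k p = ∑ i ∈ Finset.range N, M (k - i) * p.coeff i := by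
  rw [momentFun, Polynomial.lsum_apply]
  exact Polynomial.sum_over_range' p (by simp) N hN

lemma circleForm_conj {α : ℝ} (hα : -1 / 2 < α) (β : ℝ) (p q : ℂ[X]) :
    (starRingEnd ℂ) (circleForm α β p q) = circleForm α β q p := by
  rw [circleForm_eq hα, circleForm_eq hα, map_sum]
  simp only [momentFun, Polynomial.lsum_apply, Polynomial.sum, Finset.mul_sum, map_sum]
  rw [Finset.sum_comm]
  refine Finset.sum_congr rfl fun i _ => Finset.sum_congr rfl fun j _ => ?_
  simp only [LinearMap.lsmul_apply, smul_eq_mul, map_mul, Complex.conj_conj, conj_moment, neg_sub]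
  ring

lemma circleForm_C_mul_left {α : ℝ} (hα : -1 / 2 < α) (β : ℝ) (c : ℂ) (p q : ℂ[X]) :
    circleForm α β (C c * p) q = c * circleForm α β p q := by
  rw [circleForm_eq hα, circleForm_eq hα, Finset.mul_sum]
  refine Finset.sum_congr rfl fun i _ => ?_
  rw [← smul_eq_C_mul, map_smul, smul_eq_mul]
  ring

lemma circleForm_C_mul_right {α : ℝ} (hα : -1 / 2 < α) (β : ℝ) (c : ℂ) (p q : ℂ[X]) :
    circleForm α β p (C c * q) = (starRingEnd ℂ) c * circleForm α β p q := by
  rw [← circleForm_conj hα, circleForm_C_mul_left hα, map_mul, circleForm_conj hα]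

/-- Only the top coefficient of `q` sees `p`. `q` may have smaller degree, and then both sides are
0. -/
lemma circleForm_eq_of_orthogonal {α : ℝ} (hα : -1 / 2 < α) (β : ℝ) {p q : ℂ[X]} {n : ℕ}
    (hp : ∀ k < n, momentFun (moment α β) k p = 0) (hq : q.natDegree ≤ n) :
    circleForm α β p q = (starRingEnd ℂ) (q.coeff n) * momentFun (moment α β) n p := by
  rw [circleForm_eq hα]
  apply Finset.sum_eq_single n
  · intro j hj hjn
    have : j ≤ q.natDegree := le_natDegree_of_mem_supp j hj
    rw [hp j (by omega), mul_zero]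
  · intro hn
    rw [notMem_support_iff.1 hn, map_zero, zero_mul]

/-! ### The orthonormal system and the Toeplitz determinant -/

section
variable {α : ℝ} (β : ℝ)

lemma one_add_exponent_ne_zero (hα : -1 / 2 < α) (i : ℕ) :
    1 + ((α : ℂ) + Complex.I * β) + i ≠ 0 :=
  one_add_add_nat_ne_zero (by simp; linarith) i

lemma one_add_conj_exponent_ne_zero (hα : -1 / 2 < α) (i : ℕ) :
    1 + ((α : ℂ) - Complex.I * β) + i ≠ 0 :=
  one_add_add_nat_ne_zero (by simp; linarith) i

lemma one_add_two_mul_ne_zero (hα : -1 / 2 < α) (i : ℕ) : 1 + (2 * α : ℂ) + i ≠ 0 :=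
  one_add_add_nat_ne_zero (by simp; linarith) i

lemma conj_exponent (α β : ℝ) :
    (starRingEnd ℂ) ((α : ℂ) + Complex.I * β) = (α : ℂ) - Complex.I * β := by
  simp [Complex.conj_ofReal, sub_eq_add_neg]

lemma conj_poch_exponent (α β : ℝ) (n : ℕ) :
    (starRingEnd ℂ) (poch (1 + ((α : ℂ) + Complex.I * β)) n) =
      poch (1 + ((α : ℂ) - Complex.I * β)) n := by
  rw [conj_poch, map_add, conj_exponent, map_one]

/-- The orthogonal polynomial of the Fisher-Hartwig weight, up to normalisation. -/
def orthPoly (α β : ℝ) (n : ℕ) : ℂ[X] := rawPoly (α + Complex.I * β) (α - Complex.I * β) n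

/-- The squared norm of the monic orthogonal polynomial. -/
def normSqMonic (α β : ℝ) (n : ℕ) : ℝ :=
  n.factorial * (∏ i ∈ Finset.range n, (1 + 2 * α + i)) /
    ‖poch (1 + ((α : ℂ) + Complex.I * β)) n‖ ^ 2

lemma normSqMonic_pos (hα : -1 / 2 < α) (n : ℕ) : 0 < normSqMonic α β n := by
  have h1 : 0 < ∏ i ∈ Finset.range n, (1 + 2 * α + i) := Finset.prod_pos fun i _ => by
    have : (0 : ℝ) ≤ i := i.cast_nonneg
    linarith
  have h2 := norm_pos_iff.2 (poch_ne_zero (one_add_exponent_ne_zero β hα) n)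
  have h3 : (0 : ℝ) < n.factorial := by exact_mod_cast n.factorial_pos
  unfold normSqMonic
  positivity

lemma poch_ofReal (x : ℝ) (n : ℕ) : poch x n = ((∏ i ∈ Finset.range n, (x + i) : ℝ) : ℂ) := by
  simp [poch]

lemma normSqMonic_eq (α β : ℝ) (n : ℕ) : (normSqMonic α β n : ℂ) =
    (n.factorial : ℂ) * poch (1 + (α + Complex.I * β) + (α - Complex.I * β)) n /
      (poch (1 + (α + Complex.I * β)) n * poch (1 + (α - Complex.I * β)) n) := by
  rw [normSqMonic, show (1 : ℂ) + (α + Complex.I * β) + (α - Complex.I * β) =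
    ((1 + 2 * α : ℝ) : ℂ) by push_cast; ring, poch_ofReal, ← conj_poch_exponent, Complex.mul_conj']
  push_cast
  rfl

/-- The leading coefficient of the orthonormal polynomial. -/
def leadCoeff (α β : ℝ) (n : ℕ) : ℝ := √((normSqMonic α β n)⁻¹)

lemma leadCoeff_pos (hα : -1 / 2 < α) (n : ℕ) : 0 < leadCoeff α β n :=
  Real.sqrt_pos.2 (inv_pos.2 (normSqMonic_pos β hα n))

lemma leadCoeff_sq (hα : -1 / 2 < α) (n : ℕ) : leadCoeff α β n ^ 2 = (normSqMonic α β n)⁻¹ :=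
  Real.sq_sqrt (inv_pos.2 (normSqMonic_pos β hα n)).le

lemma momentFun_orthPoly_of_lt (hα : -1 / 2 < α) {n k : ℕ} (hk : k < n) :
    momentFun (moment α β) k (orthPoly α β n) = 0 :=
  momentFun_rawPoly_of_lt (moment_recurrence hα β) (one_add_conj_exponent_ne_zero β hα) n k hk

lemma momentFun_orthPoly_self (hα : -1 / 2 < α) (n : ℕ) :
    momentFun (moment α β) n (orthPoly α β n) =
      poch (1 + (α + Complex.I * β)) n * normSqMonic α β n := by
  have h := momentFun_rawPoly_self (moment_recurrence hα β) (one_add_conj_exponent_ne_zero β hα) n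
  rw [moment_zero hα, mul_one] at h
  have h1 := poch_ne_zero (one_add_exponent_ne_zero β hα) n
  have h2 := poch_ne_zero (one_add_conj_exponent_ne_zero β hα) n
  rw [normSqMonic_eq, ← h, orthPoly]
  field_simp

lemma natDegree_orthPoly (hα : -1 / 2 < α) (n : ℕ) : (orthPoly α β n).natDegree = n :=
  natDegree_rawPoly (one_add_exponent_ne_zero β hα) n

lemma coeff_orthPoly_self (α β : ℝ) (n : ℕ) :
    (orthPoly α β n).coeff n = poch (1 + (α + Complex.I * β)) n := coeff_rawPoly_self _ _ n

/-- The orthonormal polynomial of the Fisher-Hartwig weight. -/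
def orthonormalPoly (α β : ℝ) (n : ℕ) : ℂ[X] :=
  C (leadCoeff α β n / poch (1 + (α + Complex.I * β)) n) * orthPoly α β n

lemma normalizer_ne_zero (hα : -1 / 2 < α) (n : ℕ) :
    (leadCoeff α β n / poch (1 + (α + Complex.I * β)) n : ℂ) ≠ 0 :=
  div_ne_zero (by exact_mod_cast (leadCoeff_pos β hα n).ne')
    (poch_ne_zero (one_add_exponent_ne_zero β hα) n)

lemma natDegree_orthonormalPoly (hα : -1 / 2 < α) (n : ℕ) :
    (orthonormalPoly α β n).natDegree = n := by
  rw [orthonormalPoly, natDegree_C_mul (normalizer_ne_zero β hα n), natDegree_orthPoly β hα]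

lemma leadingCoeff_orthonormalPoly (hα : -1 / 2 < α) (n : ℕ) :
    (orthonormalPoly α β n).leadingCoeff = leadCoeff α β n := by
  rw [leadingCoeff, natDegree_orthonormalPoly β hα, orthonormalPoly, coeff_C_mul,
    coeff_orthPoly_self, div_mul_cancel₀ _ (poch_ne_zero (one_add_exponent_ne_zero β hα) n)]

lemma circleForm_orthPoly_of_lt (hα : -1 / 2 < α) {m n : ℕ} (h : n < m) :
    circleForm α β (orthPoly α β m) (orthPoly α β n) = 0 := by
  rw [circleForm_eq_of_orthogonal hα β (n := n)
    (fun k hk => momentFun_orthPoly_of_lt β hα (hk.trans h)) (natDegree_orthPoly β hα n).le,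
    momentFun_orthPoly_of_lt β hα h, mul_zero]

lemma circleForm_orthonormalPoly (hα : -1 / 2 < α) (m n : ℕ) :
    circleForm α β (orthonormalPoly α β m) (orthonormalPoly α β n) = if m = n then 1 else 0 := by
  rw [orthonormalPoly, orthonormalPoly, circleForm_C_mul_left hα, circleForm_C_mul_right hα]
  rcases lt_trichotomy m n with h | rfl | h
  · rw [← circleForm_conj hα, circleForm_orthPoly_of_lt β hα h, if_neg h.ne]; simp
  · rw [circleForm_eq_of_orthogonal hα β (n := m)
      (fun k hk => momentFun_orthPoly_of_lt β hα hk) (natDegree_orthPoly β hα m).le,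
      momentFun_orthPoly_self β hα, if_pos rfl, coeff_orthPoly_self, map_div₀, Complex.conj_ofReal]
    have h1 := poch_ne_zero (one_add_exponent_ne_zero β hα) m
    have h2 : (starRingEnd ℂ) (poch (1 + (α + Complex.I * β)) m) ≠ 0 := by simpa using h1
    have h3 : (leadCoeff α β m : ℂ) ^ 2 * normSqMonic α β m = 1 := by
      rw [← Complex.ofReal_pow, leadCoeff_sq β hα, ← Complex.ofReal_mul,
        inv_mul_cancel₀ (normSqMonic_pos β hα m).ne', Complex.ofReal_one]
    field_simp
    linear_combination h3
  · rw [circleForm_orthPoly_of_lt β hα h, if_neg h.ne']; simp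

lemma isOrthonormalSystem_orthonormalPoly (hα : -1 / 2 < α) :
    IsOrthonormalSystem (weight α β) (orthonormalPoly α β) where
  natDegree_eq := natDegree_orthonormalPoly β hα
  leadingCoeff_im n := by rw [leadingCoeff_orthonormalPoly β hα, Complex.ofReal_im]
  leadingCoeff_re_pos n := by
    rw [leadingCoeff_orthonormalPoly β hα, Complex.ofReal_re]; exact leadCoeff_pos β hα n
  orthonormal := circleForm_orthonormalPoly β hα

/-- Nondegeneracy without positivity of the integral: if d had degree m, pairing it with the
orthogonal polynomial of degree m gives 0 on one side, and on the other the nonzero product of its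
conjugated leading coefficient, (1+a)_m and the squared norm. -/
lemma eq_zero_of_momentFun_eq_zero (hα : -1 / 2 < α) {d : ℂ[X]} {n : ℕ} (hd : d.degree < n)
    (h : ∀ k < n, momentFun (moment α β) k d = 0) : d = 0 := by
  by_contra hne
  rw [← natDegree_lt_iff_degree_lt hne] at hd
  set m := d.natDegree with hm
  have h1 := circleForm_eq_of_orthogonal hα β (p := orthPoly α β m) (q := d) (n := m)
    (fun k hk => momentFun_orthPoly_of_lt β hα hk) le_rfl
  have h2 := circleForm_eq_of_orthogonal hα β (p := d) (q := orthPoly α β m) (n := m)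
    (fun k hk => h k (hk.trans hd)) (natDegree_orthPoly β hα m).le
  rw [h m hd, mul_zero] at h2
  rw [← circleForm_conj hα, h2, map_zero, momentFun_orthPoly_self β hα] at h1
  have h3 : d.coeff m ≠ 0 := leadingCoeff_ne_zero.2 hne
  have h4 := poch_ne_zero (one_add_exponent_ne_zero β hα) m
  have h5 : (normSqMonic α β m : ℂ) ≠ 0 := by exact_mod_cast (normSqMonic_pos β hα m).ne'
  exact mul_ne_zero ((_root_.map_ne_zero _).2 h3) (mul_ne_zero h4 h5) h1.symm

lemma IsOrthonormalSystem.eq_orthonormalPoly (hα : -1 / 2 < α) {φ : ℕ → ℂ[X]}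
    (hφ : IsOrthonormalSystem (weight α β) φ) : φ = orthonormalPoly α β := by
  funext n
  have hlc : ∀ n, (φ n).coeff n = ((φ n).leadingCoeff.re : ℂ) := by
    intro n
    have : (φ n).coeff n = (φ n).leadingCoeff := by rw [leadingCoeff, hφ.natDegree_eq]
    rw [this]
    exact Complex.ext rfl (by simp [hφ.leadingCoeff_im n])
  have hpos := hφ.leadingCoeff_re_pos
  have hform : ∀ m n, circleForm α β (φ m) (φ n) = if m = n then 1 else 0 := hφ.orthonormal
  -- Orthogonality to φ_k is triangular in the frequencies, since the coefficient of z^k in φ_k is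
  -- nonzero.
  have horth : ∀ k < n, momentFun (moment α β) k (φ n) = 0 := by
    intro k
    induction k using Nat.strong_induction_on with
    | _ k ih =>
      intro hk
      have h := circleForm_eq_of_orthogonal hα β (p := φ n) (q := φ k) (n := k)
        (fun j hj => ih j hj (hj.trans hk)) (hφ.natDegree_eq k).le
      rw [hform, if_neg hk.ne', hlc, Complex.conj_ofReal] at h
      refine (mul_eq_zero.1 h.symm).resolve_left ?_
      exact_mod_cast (hpos k).ne'
  have hA := poch_ne_zero (one_add_exponent_ne_zero β hα) n
  set r := (φ n).leadingCoeff.re with hr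
  -- With matching leading coefficients the difference has degree below n and annihilates all
  -- frequencies below n.
  have heq : φ n = C (r / poch (1 + (α + Complex.I * β)) n) * orthPoly α β n := by
    rw [← sub_eq_zero]
    refine eq_zero_of_momentFun_eq_zero β hα (n := n) ?_ ?_
    · rw [degree_lt_iff_coeff_zero]
      intro j hj
      rcases hj.eq_or_lt with rfl | hj
      · rw [coeff_sub, coeff_C_mul, coeff_orthPoly_self, hlc, ← hr, div_mul_cancel₀ _ hA, sub_self]
      · rw [coeff_sub, coeff_C_mul, coeff_eq_zero_of_natDegree_lt (by rwa [hφ.natDegree_eq]),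
          coeff_eq_zero_of_natDegree_lt (by rwa [natDegree_orthPoly β hα])]
        simp
    · intro k hk
      rw [map_sub, ← smul_eq_C_mul, map_smul, horth k hk, momentFun_orthPoly_of_lt β hα hk]
      simp
  have hone := hform n n
  have hs := circleForm_orthonormalPoly β hα n n
  have hrel : φ n = C ((r / leadCoeff α β n : ℝ) : ℂ) * orthonormalPoly α β n := by
    rw [heq, orthonormalPoly, ← mul_assoc, ← C_mul]
    have : (leadCoeff α β n : ℂ) ≠ 0 := by exact_mod_cast (leadCoeff_pos β hα n).ne'
    congr 2
    push_cast
    field_simp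
  rw [hrel, circleForm_C_mul_left hα, circleForm_C_mul_right hα, hs, if_pos rfl,
    Complex.conj_ofReal, mul_one, ← Complex.ofReal_mul] at hone
  have hone' : (r / leadCoeff α β n) * (r / leadCoeff α β n) = 1 := by exact_mod_cast hone
  -- Both normalisations force the square of this ratio to be 1, and positivity selects the root.
  have : r / leadCoeff α β n = 1 := by
    have := div_pos (hpos n) (leadCoeff_pos β hα n)
    rw [← hr] at this
    nlinarith
  rw [hrel, this]; simp

/-- Multiply the moment matrix by the upper triangular matrix of coefficients of the orthogonal
polynomials. Orthogonality makes the result lower triangular, and the two diagonals differ exactly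
by the squared norms. -/
lemma toeplitzDet_eq (hα : -1 / 2 < α) (n : ℕ) : toeplitzDet (weight α β) n =
    ((((2 * Real.pi)⁻¹) ^ n * ∏ j ∈ Finset.range n, normSqMonic α β j : ℝ) : ℂ) := by
  have hpi : (Real.pi : ℂ) ≠ 0 := by exact_mod_cast Real.pi_ne_zero
  set T : Matrix (Fin n) (Fin n) ℂ := Matrix.of fun j k => moment α β ((j : ℕ) - (k : ℕ) : ℤ)
  set L : Matrix (Fin n) (Fin n) ℂ := Matrix.of fun k i => (orthPoly α β i).coeff k
  have h1 : toeplitzDet (weight α β) n = (2 * Real.pi : ℂ)⁻¹ ^ n * T.det := by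
    rw [toeplitzDet]
    have hsm := Matrix.det_smul T (2 * Real.pi : ℂ)⁻¹
    rw [Fintype.card_fin] at hsm
    rw [← hsm]
    congr 1
    ext j k
    simp only [T, Matrix.of_apply, Matrix.smul_apply, moment, smul_eq_mul]
    field_simp
  have hL : L.det = ∏ i : Fin n, poch (1 + (α + Complex.I * β)) i := by
    rw [Matrix.det_of_isUpperTriangular]
    · exact Finset.prod_congr rfl fun i _ => coeff_orthPoly_self α β i
    · intro k i hik
      refine coeff_eq_zero_of_natDegree_lt (p := orthPoly α β i) ?_
      rw [natDegree_orthPoly β hα]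
      exact hik
  have hTL : ∀ j i : Fin n, (T * L) j i = momentFun (moment α β) (j : ℕ) (orthPoly α β i) := by
    intro j i
    rw [momentFun_eq_sum _ _ _ (N := n) (by rw [natDegree_orthPoly β hα]; exact i.2),
      Matrix.mul_apply, ← Fin.sum_univ_eq_sum_range
        (fun k => moment α β ((j : ℕ) - (k : ℕ)) * (orthPoly α β i).coeff k)]
    rfl
  have hdet : (T * L).det = ∏ i : Fin n, (poch (1 + (α + Complex.I * β)) i * normSqMonic α β i) := by
    rw [Matrix.det_of_isLowerTriangular]
    · exact Finset.prod_congr rfl fun i _ => by rw [hTL, momentFun_orthPoly_self β hα]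
    · intro j i hij
      rw [hTL]
      exact momentFun_orthPoly_of_lt β hα (by exact_mod_cast hij)
  rw [Matrix.det_mul, hL, Finset.prod_mul_distrib, mul_comm] at hdet
  have hne : ∏ i : Fin n, poch (1 + (α + Complex.I * β)) i ≠ 0 :=
    Finset.prod_ne_zero_iff.2 fun i _ => poch_ne_zero (one_add_exponent_ne_zero β hα) i
  rw [h1, mul_left_cancel₀ hne hdet, Fin.prod_univ_eq_prod_range
    (fun i => (normSqMonic α β i : ℂ)) n]
  push_cast
  rfl
end


/-! ### Exact formulas -/

section
variable {α : ℝ} (β : ℝ)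

lemma kCoeff_orthonormalPoly (hα : -1 / 2 < α) (n : ℕ) :
    kCoeff (orthonormalPoly α β) n = leadCoeff α β n := by
  rw [kCoeff, leadingCoeff_orthonormalPoly β hα, Complex.ofReal_re]

lemma leadCoeff_zero (α β : ℝ) : leadCoeff α β 0 = 1 := by
  simp [leadCoeff, normSqMonic]

lemma leadCoeff_ne_zero (hα : -1 / 2 < α) (n : ℕ) : (leadCoeff α β n : ℂ) ≠ 0 := by
  exact_mod_cast (leadCoeff_pos β hα n).ne'

lemma eval_zero_orthonormalPoly (α β : ℝ) (n : ℕ) :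
    (orthonormalPoly α β n).eval 0 = leadCoeff α β n *
      (poch (α - Complex.I * β) n / poch (1 + (α + Complex.I * β)) n) := by
  rw [orthonormalPoly, orthPoly, eval_mul, eval_C, eval_zero_rawPoly]
  ring

lemma rCoeff_orthonormalPoly (hα : -1 / 2 < α) (n : ℕ) :
    rCoeff (orthonormalPoly α β) n =
      poch (α - Complex.I * β) n / poch (1 + (α + Complex.I * β)) n := by
  rw [rCoeff, kCoeff_orthonormalPoly β hα, eval_zero_orthonormalPoly,
    mul_div_cancel_left₀ _ (leadCoeff_ne_zero β hα n)]

lemma poch_sum_ne_zero (hα : -1 / 2 < α) (n : ℕ) :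
    poch (1 + (α + Complex.I * β) + (α - Complex.I * β)) n ≠ 0 := by
  refine poch_ne_zero (fun i => ?_) n
  have := one_add_two_mul_ne_zero hα i
  rwa [show (1 : ℂ) + (α + Complex.I * β) + (α - Complex.I * β) = 1 + 2 * α by ring]

lemma leadCoeff_sq_mul (hα : -1 / 2 < α) (n : ℕ) :
    (leadCoeff α β n : ℂ) ^ 2 *
        ((n.factorial : ℂ) * poch (1 + (α + Complex.I * β) + (α - Complex.I * β)) n) =
      poch (1 + (α + Complex.I * β)) n * poch (1 + (α - Complex.I * β)) n := by
  rw [← Complex.ofReal_pow, leadCoeff_sq β hα, Complex.ofReal_inv, normSqMonic_eq, inv_div,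
    div_mul_cancel₀]
  exact mul_ne_zero (by exact_mod_cast n.factorial_ne_zero) (poch_sum_ne_zero β hα n)

lemma bCoeff_div_aCoeff (hα : -1 / 2 < α) (n : ℕ) :
    bCoeff (n + 1) / aCoeff α β (orthonormalPoly α β) (n + 1) =
      (leadCoeff α β (n + 1) / leadCoeff α β n) *
        (((n : ℂ) + 1) / (1 + (α - Complex.I * β) + n)) := by
  rw [bCoeff, aCoeff, Nat.add_sub_cancel, kCoeff_orthonormalPoly β hα,
    kCoeff_orthonormalPoly β hα]
  have h1 := leadCoeff_ne_zero β hα n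
  have h2 := leadCoeff_ne_zero β hα (n + 1)
  have h3 := one_add_conj_exponent_ne_zero β hα n
  rw [show Complex.I * (β : ℂ) - α - ((n + 1 : ℕ) : ℂ) = -(1 + (α - Complex.I * β) + n) by
    push_cast; ring]
  push_cast
  field_simp

/-- The ratios of leading coefficients telescope, starting from k_0 = 1. -/
lemma prod_bCoeff_div_aCoeff (hα : -1 / 2 < α) (n : ℕ) :
    ∏ j ∈ Finset.Icc 1 n, bCoeff j / aCoeff α β (orthonormalPoly α β) j =
      n.factorial * leadCoeff α β n / poch (1 + (α - Complex.I * β)) n := by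
  induction n with
  | zero => simp [leadCoeff_zero]
  | succ n ih =>
    rw [Finset.prod_Icc_succ_top (by omega), ih, bCoeff_div_aCoeff β hα, poch_succ,
      Nat.factorial_succ]
    have h1 := leadCoeff_ne_zero β hα n
    have h3 := one_add_conj_exponent_ne_zero β hα n
    have h4 := poch_ne_zero (one_add_conj_exponent_ne_zero β hα) n
    push_cast
    field_simp

lemma eval_one_orthonormalPoly (hα : -1 / 2 < α) (n : ℕ) :
    (orthonormalPoly α β n).eval 1 =
      ∏ j ∈ Finset.Icc 1 n, aCoeff α β (orthonormalPoly α β) j / bCoeff j := by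
  have h : ∏ j ∈ Finset.Icc 1 n, aCoeff α β (orthonormalPoly α β) j / bCoeff j =
      (∏ j ∈ Finset.Icc 1 n, bCoeff j / aCoeff α β (orthonormalPoly α β) j)⁻¹ := by
    rw [← Finset.prod_inv_distrib]
    simp only [inv_div]
  rw [h, prod_bCoeff_div_aCoeff β hα, inv_div, orthonormalPoly, orthPoly, eval_mul, eval_C,
    eval_one_rawPoly]
  have h0 := leadCoeff_sq_mul β hα n
  have h1 := leadCoeff_ne_zero β hα n
  have h2 := poch_ne_zero (one_add_exponent_ne_zero β hα) n
  have h3 : (n.factorial : ℂ) ≠ 0 := by exact_mod_cast n.factorial_ne_zero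
  field_simp
  linear_combination h0

lemma prod_normSqMonic (hα : -1 / 2 < α) (n : ℕ) :
    ∏ j ∈ Finset.Icc 1 n, (leadCoeff α β j : ℂ) ^ 2 =
      (∏ j ∈ Finset.range (n + 1), (normSqMonic α β j : ℂ))⁻¹ := by
  rw [← Finset.prod_inv_distrib, Finset.prod_range_succ', Finset.range_eq_Ico,
    Finset.prod_Ico_add' (fun j => ((normSqMonic α β j : ℂ))⁻¹) 0 n 1]
  have : (normSqMonic α β 0 : ℂ)⁻¹ = 1 := by simp [normSqMonic]
  rw [this, mul_one]
  refine Finset.prod_congr (by ext; simp) fun j _ => ?_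
  rw [← Complex.ofReal_pow, leadCoeff_sq β hα, Complex.ofReal_inv]

/-- The discriminant of the orthonormal polynomial. -/
lemma discriminant_orthonormalPoly (hα : -1 / 2 < α) (n : ℕ) :
    discriminant (orthonormalPoly α β (n + 1)) =
      (-1) ^ ((n + 1) * n / 2) * (1 + (α - Complex.I * β) + n) ^ (n + 1) *
        ((poch (α - Complex.I * β) (n + 1) / poch (1 + (α + Complex.I * β)) (n + 1)) ^ n /
          leadCoeff α β (n + 1)) *
        (∏ j ∈ Finset.range (n + 1), (normSqMonic α β j : ℂ))⁻¹ *
        ((n + 1).factorial * leadCoeff α β (n + 1) /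
          poch (1 + (α - Complex.I * β)) (n + 1)) := by
  rw [orthonormalPoly, discriminant_C_mul (normalizer_ne_zero β hα _), natDegree_orthPoly β hα,
    show 2 * (n + 1) - 2 = 2 * n by omega]
  have hD := discriminant_rawPoly (b := α - Complex.I * β) (one_add_exponent_ne_zero β hα) n
  have hX := crossProd_closed (one_add_exponent_ne_zero β hα)
    (one_add_conj_exponent_ne_zero β hα) n
  have hk := leadCoeff_sq_mul β hα (n + 1)
  have hk0 := leadCoeff_ne_zero β hα (n + 1)
  have hA := poch_ne_zero (one_add_exponent_ne_zero β hα) (n + 1)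
  have hB := poch_ne_zero (one_add_conj_exponent_ne_zero β hα) n
  have hBs := one_add_conj_exponent_ne_zero β hα n
  have hS := poch_sum_ne_zero β hα (n + 1)
  have hH : ∏ j ∈ Finset.range (n + 1), (normSqMonic α β j : ℂ) ≠ 0 :=
    Finset.prod_ne_zero_iff.2 fun j _ => by exact_mod_cast (normSqMonic_pos β hα j).ne'
  simp only [← normSqMonic_eq] at hX
  change discriminant (orthPoly α β (n + 1)) * _ * _ = _ at hD
  have hd : (((n + 1).factorial : ℕ) : ℂ) *
      poch (1 + (α + Complex.I * β) + (α - Complex.I * β)) (n + 1) =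
      (((n : ℂ) + 1) * (n + 1 + (α + Complex.I * β) + (α - Complex.I * β))) *
        ((n.factorial : ℂ) * poch (1 + (α + Complex.I * β) + (α - Complex.I * β)) n) := by
    rw [poch_succ, Nat.factorial_succ]; push_cast; ring
  rw [poch_succ (1 + (α - Complex.I * β))] at hk ⊢
  -- Isolating b keeps every denominator nonzero even when α = β = 0.
  rw [poch_succ' (α - Complex.I * β)]
  generalize (n.factorial : ℂ) * poch (1 + (α + Complex.I * β) + (α - Complex.I * β)) n = d at *
  generalize ((n : ℂ) + 1) * (n + 1 + (α + Complex.I * β) + (α - Complex.I * β)) = l at *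
  generalize poch (1 + (α + Complex.I * β) + (α - Complex.I * β)) (n + 1) = S at *
  generalize poch (1 + (α + Complex.I * β)) (n + 1) = A at *
  generalize poch (1 + (α - Complex.I * β)) n = B at *
  generalize (1 + (α - Complex.I * β) + n : ℂ) = c at *
  generalize ((α : ℂ) - Complex.I * β) = b at *
  generalize (leadCoeff α β (n + 1) : ℂ) = k at *
  generalize ∏ j ∈ Finset.range (n + 1), (normSqMonic α β j : ℂ) = H at *
  generalize crossProd (α + Complex.I * β) b n = X at *
  generalize discriminant (orthPoly α β (n + 1)) = E at *
  generalize (((n + 1).factorial : ℕ) : ℂ) = f at *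
  generalize (-1 : ℂ) ^ ((n + 1) * n / 2) = ε at *
  -- The discriminant is homogeneous of degree 2n, so normalising brings in k^{2n}; this converts it
  -- back to rising factorials.
  have hkn : k ^ (2 * n) * (f * S) ^ n = (A * (B * c)) ^ n := by rw [← hk]; ring
  have hX' : X = b ^ n * d ^ (n + 1) / (H * A ^ n * B) := by
    rw [eq_div_iff (by positivity)]; linear_combination hX
  have hE : E = ε * A ^ n * l ^ (n + 1) * X / S := by
    rw [eq_div_iff hS]
    apply mul_right_cancel₀ hA
    rw [hD]; ring
  have hld : l ^ (n + 1) * d ^ (n + 1) = (f * S) ^ n * (f * S) := by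
    rw [← mul_pow, ← hd]; ring
  rw [hE, hX']
  calc (k / A) ^ (2 * n) * (ε * A ^ n * l ^ (n + 1) * (b ^ n * d ^ (n + 1) / (H * A ^ n * B)) / S)
      = ε * (k ^ (2 * n) / A ^ (2 * n)) * b ^ n * (l ^ (n + 1) * d ^ (n + 1)) / (H * B * S) := by
        rw [div_pow]; field_simp
    _ = ε * ((k ^ (2 * n) * (f * S) ^ n) / A ^ (2 * n)) * b ^ n * f / (H * B) := by
        rw [hld]; field_simp
    _ = _ := by
        rw [hkn]
        have : A ^ (2 * n) = A ^ n * A ^ n := by ring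
        rw [this, mul_pow A, mul_pow B, div_pow, mul_pow b]
        field_simp
        ring

/-- Each factor b_j/a_j is a positive multiple of 1/(j+α-iβ), hence has positive real part and is
the principal root of its square. No statement about the root of the whole product is needed. -/
lemma prod_eq_prod_sqrt (hα : -1 / 2 < α) (n : ℕ) :
    ∏ j ∈ Finset.Icc 1 n, bCoeff j / aCoeff α β (orthonormalPoly α β) j =
      ∏ j ∈ Finset.Icc 1 n,
        (((α : ℂ) + Complex.I * β + j) / ((α : ℂ) - Complex.I * β + j) *
          ((j : ℂ) / (j + 2 * α))) ^ (1 / 2 : ℂ) := by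
  refine Finset.prod_congr rfl fun j hj => ?_
  obtain ⟨m, rfl⟩ : ∃ m, j = m + 1 := ⟨j - 1, by have := (Finset.mem_Icc.1 hj).1; omega⟩
  rw [bCoeff_div_aCoeff β hα]
  set x : ℂ := (leadCoeff α β (m + 1) / leadCoeff α β m) *
    (((m : ℂ) + 1) / (1 + (α - Complex.I * β) + m)) with hx
  have hm : (0 : ℝ) ≤ m := m.cast_nonneg
  have hre : 0 < x.re := by
    have h1 : x = ((leadCoeff α β (m + 1) / leadCoeff α β m * (m + 1) : ℝ) : ℂ) *
        (1 + (α - Complex.I * β) + m)⁻¹ := by rw [hx]; push_cast; ring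
    rw [h1, Complex.re_ofReal_mul, Complex.inv_re]
    have h2 := leadCoeff_pos β hα (m + 1)
    have h3 := leadCoeff_pos β hα m
    refine mul_pos (by positivity) (div_pos ?_ (Complex.normSq_pos.2
      (one_add_conj_exponent_ne_zero β hα m)))
    simp; linarith
  have hsq : ((α : ℂ) + Complex.I * β + (m + 1 : ℕ)) / ((α : ℂ) - Complex.I * β + (m + 1 : ℕ)) *
      (((m + 1 : ℕ) : ℂ) / ((m + 1 : ℕ) + 2 * α)) = x ^ 2 := by
    have e1 := leadCoeff_sq_mul β hα m
    have e2 := leadCoeff_sq_mul β hα (m + 1)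
    have n0 := leadCoeff_ne_zero β hα m
    have n1 := poch_ne_zero (one_add_exponent_ne_zero β hα) m
    have n2 := poch_ne_zero (one_add_conj_exponent_ne_zero β hα) m
    have n3 := poch_sum_ne_zero β hα m
    have n4 := one_add_conj_exponent_ne_zero β hα m
    have n5 := one_add_two_mul_ne_zero hα m
    have nf : (m.factorial : ℂ) ≠ 0 := by exact_mod_cast m.factorial_ne_zero
    have nm : (m : ℂ) + 1 ≠ 0 := by exact_mod_cast m.succ_ne_zero
    have n6 : (α : ℂ) - Complex.I * β + ((m : ℂ) + 1) ≠ 0 := by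
      intro h; apply n4; rw [← h]; ring
    have n7 : ((m : ℂ) + 1) + 2 * α ≠ 0 := by intro h; apply n5; rw [← h]; ring
    have hr : (leadCoeff α β (m + 1) : ℂ) ^ 2 * (((m : ℂ) + 1) * (m + 1 + 2 * α)) =
        (leadCoeff α β m : ℂ) ^ 2 * (((α : ℂ) + Complex.I * β + (m + 1)) *
          (α - Complex.I * β + (m + 1))) := by
      rw [poch_succ, poch_succ, poch_succ, Nat.factorial_succ] at e2
      push_cast at e2
      apply mul_left_cancel₀ (mul_ne_zero nf n3)
      linear_combination e2 - (((α : ℂ) + Complex.I * β + (m + 1)) *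
          (α - Complex.I * β + (m + 1))) * e1
    rw [hx, show (1 + (α - Complex.I * β) + m : ℂ) = α - Complex.I * β + ((m : ℂ) + 1) by ring]
    push_cast
    generalize (m : ℂ) + 1 + 2 * α = u at *
    generalize (α : ℂ) - Complex.I * β + ((m : ℂ) + 1) = v at *
    generalize (α : ℂ) + Complex.I * β + ((m : ℂ) + 1) = w at *
    generalize (m : ℂ) + 1 = y at *
    field_simp
    linear_combination -hr
  rw [hsq, one_div, Complex.sq_cpow_two_inv hre]

lemma prod_sq_eq_Gamma (hα : -1 / 2 < α) (n : ℕ) :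
    (∏ j ∈ Finset.Icc 1 n, bCoeff j / aCoeff α β (orthonormalPoly α β) j) ^ 2 =
      Complex.Gamma (n + 1 + α + Complex.I * β) / Complex.Gamma (n + 1 + α - Complex.I * β) *
        (Complex.Gamma (α - Complex.I * β + 1) / Complex.Gamma (α + Complex.I * β + 1)) *
        (Complex.Gamma (2 * α + 1) * Complex.Gamma (n + 1) /
          Complex.Gamma (n + 2 * α + 1)) := by
  rw [prod_bCoeff_div_aCoeff β hα,
    show (n + 1 + α + Complex.I * β : ℂ) = 1 + (α + Complex.I * β) + n by ring,
    show (n + 1 + α - Complex.I * β : ℂ) = 1 + (α - Complex.I * β) + n by ring,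
    show (n + 2 * α + 1 : ℂ) = 1 + 2 * α + n by ring,
    Gamma_add_nat _ (one_add_exponent_ne_zero β hα),
    Gamma_add_nat _ (one_add_conj_exponent_ne_zero β hα),
    Gamma_add_nat _ (one_add_two_mul_ne_zero hα), Complex.Gamma_nat_eq_factorial,
    add_comm (α - Complex.I * β : ℂ) 1, add_comm (α + Complex.I * β : ℂ) 1,
    add_comm (2 * α : ℂ) 1]
  have e1 := leadCoeff_sq_mul β hα n
  have n3 := poch_sum_ne_zero β hα n
  rw [show (1 : ℂ) + (α + Complex.I * β) + (α - Complex.I * β) = 1 + 2 * α by ring] at e1 n3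
  have n1 := poch_ne_zero (one_add_exponent_ne_zero β hα) n
  have n2 := poch_ne_zero (one_add_conj_exponent_ne_zero β hα) n
  have g1 : Complex.Gamma (1 + (α + Complex.I * β)) ≠ 0 :=
    Gamma_one_add_ne_zero (by simp; linarith)
  have g2 : Complex.Gamma (1 + (α - Complex.I * β)) ≠ 0 :=
    Gamma_one_add_ne_zero (by simp; linarith)
  have g3 : Complex.Gamma (1 + 2 * α) ≠ 0 := Gamma_one_add_ne_zero (by simp; linarith)
  generalize poch (1 + 2 * (α : ℂ)) n = S at *
  generalize poch (1 + (α + Complex.I * β)) n = A at *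
  generalize poch (1 + (α - Complex.I * β)) n = B at *
  generalize Complex.Gamma (1 + (α + Complex.I * β)) = G1 at *
  generalize Complex.Gamma (1 + (α - Complex.I * β)) = G2 at *
  generalize Complex.Gamma (1 + 2 * α) = G3 at *
  field_simp
  linear_combination (n.factorial : ℂ) * e1

/-- The real value of the Toeplitz determinant. -/
def toeplitzValue (α β : ℝ) (n : ℕ) : ℝ :=
  ((2 * Real.pi)⁻¹) ^ n * ∏ j ∈ Finset.range n, normSqMonic α β j

lemma toeplitzValue_pos (hα : -1 / 2 < α) (n : ℕ) : 0 < toeplitzValue α β n :=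
  mul_pos (by positivity) (Finset.prod_pos fun j _ => normSqMonic_pos β hα j)

lemma neg_one_pow_sign_one (n : ℕ) :
    (-1 : ℂ) ^ ((n + 1) * (n + 1 + 1) / 2) * (-1) ^ (n + 1) = (-1) ^ ((n + 1) * n / 2) := by
  obtain ⟨t, ht⟩ := Nat.even_mul_succ_self n
  rw [show (n + 1) * n / 2 = t by rw [mul_comm, ht]; omega,
    show (n + 1) * (n + 1 + 1) / 2 = t + (n + 1) by
      rw [show (n + 1) * (n + 1 + 1) = n * (n + 1) + 2 * (n + 1) by ring, ht]; omega,
    ← pow_add, show t + (n + 1) + (n + 1) = t + 2 * (n + 1) by ring, pow_add, pow_mul]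
  simp

lemma neg_one_pow_sign_two (n : ℕ) :
    (-1 : ℂ) ^ ((n + 1) * (n + 1 + 3) / 2) = (-1) ^ ((n + 1) * n / 2) := by
  obtain ⟨t, ht⟩ := Nat.even_mul_succ_self n
  rw [show (n + 1) * n / 2 = t by rw [mul_comm, ht]; omega,
    show (n + 1) * (n + 1 + 3) / 2 = t + 2 * (n + 1) by
      rw [show (n + 1) * (n + 1 + 3) = n * (n + 1) + 4 * (n + 1) by ring, ht]; omega,
    pow_add, pow_mul]
  simp

lemma discriminant_formula_leadCoeff (hα : -1 / 2 < α) {n : ℕ} (hn : 1 ≤ n) :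
    discriminant (orthonormalPoly α β n) =
      (-1) ^ (n * (n + 1) / 2) * (Complex.I * β - α - n) ^ n *
        (rCoeff (orthonormalPoly α β) n ^ (n - 1) / (kCoeff (orthonormalPoly α β) n : ℂ)) *
        (∏ j ∈ Finset.Icc 1 (n - 1), (kCoeff (orthonormalPoly α β) j : ℂ) ^ 2) *
        ∏ j ∈ Finset.Icc 1 n, bCoeff j / aCoeff α β (orthonormalPoly α β) j := by
  obtain ⟨m, rfl⟩ := Nat.exists_eq_add_of_le' hn
  simp only [kCoeff_orthonormalPoly β hα, Nat.add_sub_cancel]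
  rw [discriminant_orthonormalPoly β hα, prod_normSqMonic β hα, prod_bCoeff_div_aCoeff β hα,
    rCoeff_orthonormalPoly β hα, ← neg_one_pow_sign_one,
    show (Complex.I * β - α - (m + 1 : ℕ) : ℂ) = (-1) * (1 + (α - Complex.I * β) + m) by
      push_cast; ring, mul_pow (-1 : ℂ)]
  ring

lemma discriminant_formula_toeplitzDet (hα : -1 / 2 < α) {n : ℕ} (hn : 1 ≤ n) :
    discriminant (orthonormalPoly α β n) =
      (-1) ^ (n * (n + 3) / 2) * (((n : ℂ) + α - Complex.I * β) / (2 * Real.pi)) ^ n *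
        (rCoeff (orthonormalPoly α β) n ^ (n - 1) / (kCoeff (orthonormalPoly α β) n : ℂ)) *
        (toeplitzDet (weight α β) n)⁻¹ *
        ∏ j ∈ Finset.Icc 1 n, bCoeff j / aCoeff α β (orthonormalPoly α β) j := by
  obtain ⟨m, rfl⟩ := Nat.exists_eq_add_of_le' hn
  have hpi : (2 * Real.pi : ℂ) ≠ 0 :=
    mul_ne_zero two_ne_zero (by exact_mod_cast Real.pi_ne_zero)
  rw [kCoeff_orthonormalPoly β hα, Nat.add_sub_cancel, discriminant_orthonormalPoly β hα,
    prod_bCoeff_div_aCoeff β hα, rCoeff_orthonormalPoly β hα, neg_one_pow_sign_two,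
    toeplitzDet_eq β hα, show ((m + 1 : ℕ) + α - Complex.I * β : ℂ) =
      1 + (α - Complex.I * β) + m by push_cast; ring]
  push_cast
  generalize (2 * Real.pi : ℂ) = t at *
  rw [mul_inv, div_pow _ t, inv_pow, inv_inv]
  field_simp

lemma toeplitz_discriminant_norm (hα : -1 / 2 < α) {n : ℕ} (hn : 1 ≤ n) :
    toeplitzValue α β n * leadCoeff α β n * ‖discriminant (orthonormalPoly α β n)‖ =
      (‖(n : ℂ) + α - Complex.I * β‖ / (2 * Real.pi)) ^ n *
        ‖rCoeff (orthonormalPoly α β) n‖ ^ (n - 1) *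
        ‖∏ j ∈ Finset.Icc 1 n, bCoeff j / aCoeff α β (orthonormalPoly α β) j‖ := by
  have hT := toeplitzValue_pos β hα n
  have hk := leadCoeff_pos β hα n
  rw [discriminant_formula_toeplitzDet β hα hn, kCoeff_orthonormalPoly β hα, toeplitzDet_eq β hα,
    ← toeplitzValue]
  simp only [norm_mul, norm_div, norm_pow, norm_inv, Complex.norm_real, norm_neg, norm_one, one_pow,
    one_mul, Real.norm_of_nonneg hT.le, Real.norm_of_nonneg hk.le, Complex.norm_ofNat,
    Real.norm_of_nonneg Real.pi_pos.le]
  field_simp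
end


/-! ### Asymptotics of the leading coefficient and of the values at 0 and 1 -/

lemma tendsto_norm_poch {z : ℂ} (hz : -1 < z.re) :
    Tendsto (fun n : ℕ => ‖poch (1 + z) n‖ / ((n.factorial : ℝ) * (n : ℝ) ^ z.re)) atTop
      (𝓝 ‖Complex.Gamma (1 + z)‖⁻¹) := by
  have h := (tendsto_poch hz).norm
  rw [norm_inv] at h
  refine h.congr' ?_
  filter_upwards [eventually_gt_atTop 0] with n hn
  rw [norm_div, norm_mul, norm_natCast_cpow hn, Complex.norm_natCast]

section
variable {α : ℝ} (β : ℝ)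

lemma norm_poch_one_add_two_mul (hα : -1 / 2 < α) (n : ℕ) :
    ‖poch (1 + (2 * α : ℝ)) n‖ = ∏ i ∈ Finset.range n, (1 + 2 * α + i) := by
  rw [show (1 : ℂ) + (2 * α : ℝ) = ((1 + 2 * α : ℝ) : ℂ) by push_cast; ring, poch_ofReal,
    Complex.norm_real, Real.norm_of_nonneg]
  refine Finset.prod_nonneg fun i _ => ?_
  have : (0 : ℝ) ≤ i := i.cast_nonneg
  linarith

lemma tendsto_leadCoeff (hα : -1 / 2 < α) : Tendsto (fun n => leadCoeff α β n) atTop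
    (𝓝 (√(Real.Gamma (2 * α + 1)) / ‖Complex.Gamma (α + Complex.I * β + 1)‖)) := by
  have h1 := (tendsto_norm_poch (z := α + Complex.I * β) (by simp; linarith)).pow 2
  have h2 := tendsto_norm_poch (z := (2 * α : ℝ)) (by rw [Complex.ofReal_re]; linarith)
  have hG : 0 < Real.Gamma (1 + 2 * α) := Real.Gamma_pos_of_pos (by linarith)
  have e : ‖Complex.Gamma (1 + (2 * α : ℝ))‖ = Real.Gamma (1 + 2 * α) := by
    rw [show (1 : ℂ) + (2 * α : ℝ) = ((1 + 2 * α : ℝ) : ℂ) by push_cast; ring,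
      Complex.Gamma_ofReal, Complex.norm_real, Real.norm_of_nonneg hG.le]
  rw [e] at h2
  have h3 := (h1.div h2 (inv_ne_zero hG.ne')).sqrt
  have hlim : √(‖Complex.Gamma (1 + (α + Complex.I * β))‖⁻¹ ^ 2 / (Real.Gamma (1 + 2 * α))⁻¹) =
      √(Real.Gamma (2 * α + 1)) / ‖Complex.Gamma (α + Complex.I * β + 1)‖ := by
    rw [div_inv_eq_mul, mul_comm, Real.sqrt_mul hG.le, Real.sqrt_sq (by positivity),
      add_comm 1 (2 * α), add_comm (1 : ℂ), div_eq_mul_inv]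
  rw [hlim] at h3
  refine h3.congr' ?_
  filter_upwards [eventually_gt_atTop 0] with n hn
  have hn' : (0 : ℝ) < n := by exact_mod_cast hn
  have hre : (α + Complex.I * β : ℂ).re = α := by simp
  rw [leadCoeff, normSqMonic, Pi.div_apply, hre, Complex.ofReal_re, norm_poch_one_add_two_mul hα,
    mul_comm 2 α, Real.rpow_mul hn'.le, Real.rpow_two]
  congr 1
  have : (n : ℝ) ^ α ≠ 0 := (Real.rpow_pos_of_pos hn' _).ne'
  have : (n.factorial : ℝ) ≠ 0 := by exact_mod_cast n.factorial_ne_zero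
  field_simp

lemma leadCoeffLimit_pos (hα : -1 / 2 < α) :
    0 < √(Real.Gamma (2 * α + 1)) / ‖Complex.Gamma (α + Complex.I * β + 1)‖ := by
  refine div_pos (Real.sqrt_pos.2 (Real.Gamma_pos_of_pos (by linarith))) (norm_pos_iff.2 ?_)
  rw [add_comm]
  exact Gamma_one_add_ne_zero (by simp; linarith)

lemma isEquivalent_leadCoeff (hα : -1 / 2 < α) : (fun n => leadCoeff α β n) ~[atTop]
    fun _ => √(Real.Gamma (2 * α + 1)) / ‖Complex.Gamma (α + Complex.I * β + 1)‖ :=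
  (isEquivalent_const_iff_tendsto (leadCoeffLimit_pos β hα).ne').2 (tendsto_leadCoeff β hα)

lemma isEquivalent_norm_prod (hα : -1 / 2 < α) :
    (fun n : ℕ => ‖∏ j ∈ Finset.Icc 1 n, bCoeff j / aCoeff α β (orthonormalPoly α β) j‖) ~[atTop]
      (fun n : ℕ => √(Real.Gamma (2 * α + 1)) / (n : ℝ) ^ α) := by
  have h1 := tendsto_norm_poch (z := α + Complex.I * β) (by simp; linarith)
  have hG : Complex.Gamma (1 + (α + Complex.I * β)) ≠ 0 := Gamma_one_add_ne_zero (by simp; linarith)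
  have h2 := (tendsto_leadCoeff β hα).div h1 (inv_ne_zero (norm_ne_zero_iff.2 hG))
  have hs : √(Real.Gamma (2 * α + 1)) ≠ 0 :=
    (Real.sqrt_pos.2 (Real.Gamma_pos_of_pos (by linarith))).ne'
  have h3 := h2.div_const √(Real.Gamma (2 * α + 1))
  apply isEquivalent_of_tendsto_one
  rw [add_comm _ (1 : ℂ), div_inv_eq_mul, div_mul_cancel₀ _ (norm_ne_zero_iff.2 hG), div_self hs]
    at h3
  refine h3.congr' ?_
  filter_upwards [eventually_gt_atTop 0] with n hn
  have hn' : (0 : ℝ) < n := by exact_mod_cast hn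
  have hre : (α + Complex.I * β : ℂ).re = α := by simp
  rw [Pi.div_apply, Pi.div_apply, prod_bCoeff_div_aCoeff β hα, hre, norm_div, norm_mul,
    ← conj_poch_exponent, RCLike.norm_conj, Complex.norm_natCast, Complex.norm_real,
    Real.norm_of_nonneg (leadCoeff_pos β hα n).le]
  have : (n : ℝ) ^ α ≠ 0 := (Real.rpow_pos_of_pos hn' _).ne'
  have : (n.factorial : ℝ) ≠ 0 := by exact_mod_cast n.factorial_ne_zero
  have : ‖poch (1 + (α + Complex.I * β)) n‖ ≠ 0 :=
    norm_ne_zero_iff.2 (poch_ne_zero (one_add_exponent_ne_zero β hα) n)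
  field_simp

lemma poch_mul_add (x : ℂ) (n : ℕ) : poch x n * (x + n) = x * poch (1 + x) n := by
  rw [← poch_succ, poch_succ']

lemma conj_exponent_add_ne_zero (hα : -1 / 2 < α) {n : ℕ} (hn : 0 < n) :
    (α - Complex.I * β : ℂ) + n ≠ 0 := by
  obtain ⟨m, rfl⟩ : ∃ m, n = m + 1 := ⟨n - 1, by omega⟩
  intro h
  apply one_add_conj_exponent_ne_zero β hα m
  rw [← h]; push_cast; ring

lemma isEquivalent_eval_zero (hα : -1 / 2 < α) (h0 : (α : ℂ) + Complex.I * β ≠ 0) :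
    (fun n : ℕ => (orthonormalPoly α β n).eval 0) ~[atTop]
      (fun n : ℕ =>
        ((√(Real.Gamma (2 * α + 1)) / ‖Complex.Gamma (α + Complex.I * β + 1)‖ : ℝ) : ℂ) *
        (Complex.Gamma (α + Complex.I * β + 1) / Complex.Gamma (α - Complex.I * β)) *
        (n : ℂ) ^ (-1 - 2 * Complex.I * β)) := by
  have hb0 : (α : ℂ) - Complex.I * β ≠ 0 := by
    rw [← conj_exponent]; exact (_root_.map_ne_zero _).2 h0
  have hGa : Complex.Gamma (1 + (α + Complex.I * β)) ≠ 0 :=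
    Gamma_one_add_ne_zero (by simp; linarith)
  have hGb : Complex.Gamma (1 + (α - Complex.I * β)) ≠ 0 :=
    Gamma_one_add_ne_zero (by simp; linarith)
  have hGb' : Complex.Gamma (1 + (α - Complex.I * β)) =
      (α - Complex.I * β) * Complex.Gamma (α - Complex.I * β) := by
    rw [add_comm, Complex.Gamma_add_one _ hb0]
  have hGb0 : Complex.Gamma (α - Complex.I * β) ≠ 0 := fun h => hGb (by rw [hGb', h, mul_zero])
  have hκ := leadCoeffLimit_pos β hα
  have hA := tendsto_poch (z := α + Complex.I * β) (by simp; linarith)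
  have hB := tendsto_poch (z := α - Complex.I * β) (by simp; linarith)
  have hN := tendsto_natCast_div_add (α - Complex.I * β)
  have hk := (Complex.continuous_ofReal.tendsto _).comp (tendsto_leadCoeff β hα)
  set κ := √(Real.Gamma (2 * α + 1)) / ‖Complex.Gamma (α + Complex.I * β + 1)‖
  have hκc : (κ : ℂ) ≠ 0 := by exact_mod_cast hκ.ne'
  have h := ((hk.mul ((hB.div hA (inv_ne_zero hGa)).mul hN)).mul_const
    ((α - Complex.I * β) / (κ * (Complex.Gamma (1 + (α + Complex.I * β)) /
      Complex.Gamma (α - Complex.I * β)))))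
  apply isEquivalent_of_tendsto_one
  have hlim : (κ : ℂ) * ((Complex.Gamma (1 + (α - Complex.I * β)))⁻¹ /
      (Complex.Gamma (1 + (α + Complex.I * β)))⁻¹ * 1) *
      ((α - Complex.I * β) / (κ * (Complex.Gamma (1 + (α + Complex.I * β)) /
        Complex.Gamma (α - Complex.I * β)))) = 1 := by
    rw [hGb']; field_simp
  rw [hlim] at h
  refine h.congr' ?_
  filter_upwards [eventually_gt_atTop 0] with n hn
  have hnc : (n : ℂ) ≠ 0 := by exact_mod_cast hn.ne'
  have hbn := conj_exponent_add_ne_zero β hα hn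
  have hpA := poch_ne_zero (one_add_exponent_ne_zero β hα) n
  have hf : (n.factorial : ℂ) ≠ 0 := by exact_mod_cast n.factorial_ne_zero
  have hp : ∀ z : ℂ, (n : ℂ) ^ z ≠ 0 := fun z => by simp [Complex.cpow_eq_zero_iff, hnc]
  have hcp : (n : ℂ) ^ (-1 - 2 * Complex.I * β) =
      (n : ℂ) ^ (α - Complex.I * β) / ((n : ℂ) ^ (α + Complex.I * β) * n) := by
    rw [eq_div_iff (mul_ne_zero (hp _) hnc)]
    nth_rw 3 [← Complex.cpow_one (n : ℂ)]
    rw [← Complex.cpow_add _ _ hnc, ← Complex.cpow_add _ _ hnc]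
    congr 1; ring
  -- `tendsto_poch` for (b)_n itself would require Re b > 0. Passing to (1+b)_n covers α > -1/2, and
  -- the denominator b + n supplies the exponent -1.
  have hpb : poch (α - Complex.I * β) n =
      (α - Complex.I * β) * poch (1 + (α - Complex.I * β)) n / ((α - Complex.I * β) + n) := by
    rw [eq_div_iff hbn, poch_mul_add]
  simp only [Pi.div_apply, Function.comp]
  rw [eval_zero_orthonormalPoly, hcp, hpb, add_comm _ (1 : ℂ)]
  have := hp (α - Complex.I * β)
  have := hp (α + Complex.I * β)
  generalize (n : ℂ) ^ (α - Complex.I * β) = x at *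
  generalize (n : ℂ) ^ (α + Complex.I * β) = y at *
  generalize Complex.Gamma (α - Complex.I * β) = g at *
  generalize Complex.Gamma (1 + (α + Complex.I * β)) = g' at *
  generalize ((α : ℂ) - Complex.I * β) + n = w at *
  generalize poch (1 + (α + Complex.I * β)) n = A at *
  generalize poch (1 + (α - Complex.I * β)) n = B at *
  field_simp

/-- (1+a)_n and (1+b)_n are conjugate, so in modulus only the first factor of (b)_n and the extra
factor b + n remain. -/
lemma norm_rCoeff (hα : -1 / 2 < α) {n : ℕ} (hn : 0 < n) :
    ‖rCoeff (orthonormalPoly α β) n‖ = ‖(α : ℂ) + Complex.I * β‖ / ‖(n : ℂ) + α - Complex.I * β‖ := by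
  have hbn := conj_exponent_add_ne_zero β hα hn
  have hpA := poch_ne_zero (one_add_exponent_ne_zero β hα) n
  have hpb : poch (α - Complex.I * β) n =
      (α - Complex.I * β) * poch (1 + (α - Complex.I * β)) n / ((α - Complex.I * β) + n) := by
    rw [eq_div_iff hbn, poch_mul_add]
  rw [rCoeff_orthonormalPoly β hα, hpb, ← conj_poch_exponent, norm_div, norm_div, norm_mul,
    RCLike.norm_conj, ← conj_exponent, RCLike.norm_conj, conj_exponent,
    show (n : ℂ) + α - Complex.I * β = (α - Complex.I * β) + n by ring]
  have := norm_ne_zero_iff.2 hpA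
  have := norm_ne_zero_iff.2 hbn
  field_simp

/-- `|1 + (α - iβ)/n|^n → e^α`. -/
lemma tendsto_norm_add_div_pow (α β : ℝ) :
    Tendsto (fun n : ℕ => (‖(n : ℂ) + α - Complex.I * β‖ / n) ^ n) atTop (𝓝 (Real.exp α)) := by
  have h := (Complex.tendsto_one_add_div_pow_exp (α - Complex.I * β)).norm
  rw [Complex.norm_exp] at h
  have hre : (α - Complex.I * β : ℂ).re = α := by simp
  rw [hre] at h
  refine h.congr' ?_
  filter_upwards [eventually_gt_atTop 0] with n hn
  have hnc : (n : ℂ) ≠ 0 := by exact_mod_cast hn.ne'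
  rw [norm_pow, show (1 : ℂ) + (α - Complex.I * β) / n = ((n : ℂ) + α - Complex.I * β) / n by
    field_simp; ring, norm_div, Complex.norm_natCast]

lemma tendsto_norm_add_div (α β : ℝ) :
    Tendsto (fun n : ℕ => ‖(n : ℂ) + α - Complex.I * β‖ / n) atTop (𝓝 1) := by
  have h := ((tendsto_natCast_div_add (α - Complex.I * β)).inv₀ one_ne_zero).norm
  rw [inv_one, norm_one] at h
  refine h.congr fun n => ?_
  rw [inv_div, norm_div, Complex.norm_natCast,
    show (n : ℂ) + α - Complex.I * β = (α - Complex.I * β) + n by ring]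

lemma isEquivalent_norm_rCoeff_pow (hα : -1 / 2 < α) (h0 : (α : ℂ) + Complex.I * β ≠ 0) :
    (fun n : ℕ => ‖rCoeff (orthonormalPoly α β) n‖ ^ (n - 1)) ~[atTop]
      (fun n : ℕ => Real.exp (-α) * (‖(α : ℂ) + Complex.I * β‖ / n) ^ (n - 1)) := by
  apply isEquivalent_of_tendsto_one
  -- The exponent n - 1 is treated as n, and the missing factor |n+b|/n tends to 1.
  have h := ((tendsto_norm_add_div α β).div (tendsto_norm_add_div_pow α β)
    (Real.exp_pos α).ne').const_mul (Real.exp α)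
  rw [mul_one_div_cancel (Real.exp_pos α).ne'] at h
  refine h.congr' ?_
  filter_upwards [eventually_gt_atTop 0] with n hn
  obtain ⟨m, rfl⟩ : ∃ m, n = m + 1 := ⟨n - 1, by omega⟩
  have hbn := conj_exponent_add_ne_zero β hα hn
  rw [show ((α : ℂ) - Complex.I * β) + (m + 1 : ℕ) = ((m + 1 : ℕ) : ℂ) + α - Complex.I * β by ring]
    at hbn
  simp only [Pi.div_apply]
  rw [norm_rCoeff β hα hn, Nat.add_sub_cancel, Real.exp_neg, div_pow, div_pow, div_pow]
  have h1 := norm_ne_zero_iff.2 hbn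
  have h2 := norm_ne_zero_iff.2 h0
  have h3 : ((m + 1 : ℕ) : ℝ) ≠ 0 := by exact_mod_cast m.succ_ne_zero
  have h4 := (Real.exp_pos α).ne'
  generalize ‖((m + 1 : ℕ) : ℂ) + α - Complex.I * β‖ = x at *
  generalize ‖(α : ℂ) + Complex.I * β‖ = y at *
  generalize ((m + 1 : ℕ) : ℝ) = z at *
  field_simp
  ring
end


/-! ### Toeplitz asymptotics and the Barnes product -/

/-- A Stolz-type lemma: a null sequence with differences `~ c / (n (n + 1))` is `~ c / n`. -/
lemma tendsto_natCast_mul_of_sub {x : ℕ → ℝ} {c : ℝ} (hx : Tendsto x atTop (𝓝 0))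
    (hd : Tendsto (fun n : ℕ => (n * (n + 1)) * (x n - x (n + 1))) atTop (𝓝 c)) :
    Tendsto (fun n : ℕ => n * x n) atTop (𝓝 c) := by
  have hinv : ∀ e : ℝ, Tendsto (fun n : ℕ => x n - e / n) atTop (𝓝 0) := fun e => by
    simpa using hx.sub (tendsto_const_div_atTop_nhds_zero_nat e)
  have hstep : ∀ (e : ℝ) (n : ℕ), 0 < n → (x n - e / n) - (x (n + 1) - e / (n + 1 : ℕ)) =
      ((n * (n + 1)) * (x n - x (n + 1)) - e) / (n * (n + 1)) := by
    intro e n hn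
    have h1 : (n : ℝ) ≠ 0 := by exact_mod_cast hn.ne'
    have h2 : (n : ℝ) + 1 ≠ 0 := by exact_mod_cast n.succ_ne_zero
    push_cast
    field_simp
    ring
  rw [tendsto_order]
  constructor
  · intro e he
    obtain ⟨e', h1, h2⟩ := exists_between he
    obtain ⟨N, hN⟩ := eventually_atTop.1 ((tendsto_order.1 hd).1 e' h2)
    filter_upwards [eventually_ge_atTop (max N 1)] with n hn
    have hnN : N ≤ n := (le_max_left _ _).trans hn
    have hn1 : 1 ≤ n := (le_max_right _ _).trans hn
    -- Since e'/n - e'/(n+1) = e'/(n(n+1)), the hypothesis makes x_n - e'/n eventually decreasing.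
    -- Its limit is 0, so it is nonnegative.
    have hanti : Antitone fun k : ℕ => x (n + k) - e' / (n + k : ℕ) :=
      antitone_nat_of_succ_le fun k => by
        have h := hstep e' (n + k) (by omega)
        have := hN (n + k) (by omega)
        have h' : 0 ≤ (((n + k : ℕ) * ((n + k : ℕ) + 1)) * (x (n + k) - x (n + k + 1)) - e') /
            (((n + k : ℕ) : ℝ) * ((n + k : ℕ) + 1)) := div_nonneg (by linarith) (by positivity)
        rw [← h] at h'
        rw [← add_assoc]
        linarith
    have hlim := (tendsto_add_atTop_iff_nat n).2 (hinv e')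
    have h0 := hanti.le_of_tendsto (hlim.congr fun k => by rw [add_comm k n]) 0
    have hpos : (0 : ℝ) < n := by exact_mod_cast hn1
    simp only [add_zero] at h0
    have : e' ≤ n * x n := by
      have h3 : e' / n ≤ x n := by linarith
      rw [div_le_iff₀ hpos] at h3; linarith
    linarith
  · intro e he
    obtain ⟨e', h1, h2⟩ := exists_between he
    obtain ⟨N, hN⟩ := eventually_atTop.1 ((tendsto_order.1 hd).2 e' h1)
    filter_upwards [eventually_ge_atTop (max N 1)] with n hn
    have hnN : N ≤ n := (le_max_left _ _).trans hn
    have hn1 : 1 ≤ n := (le_max_right _ _).trans hn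
    have hmono : Monotone fun k : ℕ => x (n + k) - e' / (n + k : ℕ) :=
      monotone_nat_of_le_succ fun k => by
        have h := hstep e' (n + k) (by omega)
        have := hN (n + k) (by omega)
        have h' : (((n + k : ℕ) * ((n + k : ℕ) + 1)) * (x (n + k) - x (n + k + 1)) - e') /
            (((n + k : ℕ) : ℝ) * ((n + k : ℕ) + 1)) ≤ 0 :=
          div_nonpos_of_nonpos_of_nonneg (by linarith) (by positivity)
        rw [← h] at h'
        rw [← add_assoc]
        linarith
    have hlim := (tendsto_add_atTop_iff_nat n).2 (hinv e')
    have h0 := hmono.ge_of_tendsto (hlim.congr fun k => by rw [add_comm k n]) 0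
    have hpos : (0 : ℝ) < n := by exact_mod_cast hn1
    simp only [add_zero] at h0
    have : n * x n ≤ e' := by
      have h3 : x n ≤ e' / n := by linarith
      rw [le_div_iff₀ hpos] at h3; linarith
    linarith

/-- The `k`-th factor of the Weierstrass product of `G(1 + u)`. -/
def barnesFactor (u : ℂ) (k : ℕ) : ℂ :=
  (1 + u / ((k : ℂ) + 1)) ^ (k + 1) * Complex.exp (u ^ 2 / (2 * ((k : ℂ) + 1)) - u)

/-- A logarithm of `barnesFactor u k`. -/
def barnesLogFactor (u : ℂ) (k : ℕ) : ℂ :=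
  (k + 1) * Complex.log (1 + u / ((k : ℂ) + 1)) + (u ^ 2 / (2 * ((k : ℂ) + 1)) - u)

lemma one_add_div_ne_zero {u : ℂ} (hu : -1 < u.re) (k : ℕ) : 1 + u / ((k : ℂ) + 1) ≠ 0 := by
  have hk : (k : ℂ) + 1 ≠ 0 := by exact_mod_cast k.succ_ne_zero
  intro h
  apply one_add_add_nat_ne_zero hu k
  field_simp at h
  linear_combination h

lemma exp_barnesLogFactor {u : ℂ} (hu : -1 < u.re) (k : ℕ) :
    Complex.exp (barnesLogFactor u k) = barnesFactor u k := by
  rw [barnesLogFactor, barnesFactor, Complex.exp_add,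
    show (k : ℂ) + 1 = ((k + 1 : ℕ) : ℂ) by push_cast; rfl, Complex.exp_nat_mul, Complex.exp_log]
  simpa using one_add_div_ne_zero hu k

/-- The exponential in the Weierstrass factor removes the first two Taylor terms of the logarithm at
z = u/(k+1), leaving (k+1) O(|z|³) = O(1/k²). -/
lemma summable_barnesLogFactor (u : ℂ) : Summable (barnesLogFactor u) := by
  have hs : Summable fun k : ℕ => ‖u‖ ^ 3 * (1 / ((k + 1 : ℕ) : ℝ) ^ 2) :=
    ((summable_nat_add_iff 1).2 (Real.summable_one_div_nat_pow.2 one_lt_two)).mul_left _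
  refine Summable.of_norm_bounded_eventually_nat hs ?_
  obtain ⟨N, hN⟩ := exists_nat_ge (2 * ‖u‖)
  filter_upwards [eventually_ge_atTop N] with k hk
  have hk1 : (0 : ℝ) < (k : ℝ) + 1 := by positivity
  have hkc : (k : ℂ) + 1 ≠ 0 := by exact_mod_cast k.succ_ne_zero
  have hkN : (N : ℝ) ≤ k := by exact_mod_cast hk
  set z := u / ((k : ℂ) + 1) with hz
  have hnk : ‖(k : ℂ) + 1‖ = (k : ℝ) + 1 := by
    rw [show (k : ℂ) + 1 = ((k + 1 : ℕ) : ℂ) by push_cast; rfl, Complex.norm_natCast]; push_cast; rfl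
  have hnz : ‖z‖ = ‖u‖ / (k + 1) := by rw [hz, norm_div, hnk]
  -- The choice N ≥ 2|u| bounds the factor 1/(1-|z|) of the Taylor remainder by 2.
  have hz2 : ‖z‖ ≤ 1 / 2 := by
    rw [hnz, div_le_iff₀ hk1]; linarith
  have h := Complex.norm_log_sub_logTaylor_le 2 (z := z) (by linarith)
  have hT : Complex.logTaylor (2 + 1) z = z - z ^ 2 / 2 := by
    simp [Complex.logTaylor_succ, Complex.logTaylor_zero]
    ring
  rw [hT] at h
  have hL : barnesLogFactor u k = (k + 1) * (Complex.log (1 + z) - (z - z ^ 2 / 2)) := by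
    rw [barnesLogFactor, ← hz, hz]; field_simp; ring
  have hinv : (1 - ‖z‖)⁻¹ ≤ 2 := by
    rw [inv_le_comm₀ (by linarith) two_pos]; linarith
  rw [hL, norm_mul, hnk]
  calc ((k : ℝ) + 1) * ‖Complex.log (1 + z) - (z - z ^ 2 / 2)‖
      ≤ (k + 1) * (‖z‖ ^ (2 + 1) * (1 - ‖z‖)⁻¹ / ((2 : ℕ) + 1)) := by gcongr
    _ ≤ (k + 1) * ‖z‖ ^ 3 := by
        have h3 : ‖z‖ ^ 3 * (1 - ‖z‖)⁻¹ ≤ ‖z‖ ^ 3 * 2 := by gcongr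
        have h4 : 0 ≤ ‖z‖ ^ 3 := by positivity
        gcongr
        push_cast
        linarith
    _ = ‖u‖ ^ 3 * (1 / ((k + 1 : ℕ) : ℝ) ^ 2) := by
        rw [hnz]; push_cast; field_simp

lemma hasProd_barnesFactor {u : ℂ} (hu : -1 < u.re) :
    HasProd (barnesFactor u) (Complex.exp (∑' k, barnesLogFactor u k)) := by
  have h := (summable_barnesLogFactor u).hasSum.cexp
  rwa [show Complex.exp ∘ barnesLogFactor u = barnesFactor u from
    funext fun k => exp_barnesLogFactor hu k] at h

lemma barnesG_one_add {u : ℂ} (hu : -1 < u.re) :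
    barnesG (u + 1) = (2 * (Real.pi : ℂ)) ^ (u / 2) *
      Complex.exp (-(u + u ^ 2 * (1 + (Real.eulerMascheroniConstant : ℂ))) / 2) *
        Complex.exp (∑' k, barnesLogFactor u k) := by
  rw [barnesG, add_sub_cancel_right, ← (hasProd_barnesFactor hu).tprod_eq]
  rfl

section
variable {α : ℝ} (β : ℝ)

lemma one_add_two_mul_add_pos (hα : -1 / 2 < α) (n : ℕ) : 0 < 1 + 2 * α + n := by
  have : (0 : ℝ) ≤ n := n.cast_nonneg
  linarith

/-- The normalised squared norm `Γ(n+1) Γ(n+1+2α) / |Γ(n+1+α+iβ)|^2`. -/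
def gammaQuotient (α β : ℝ) (n : ℕ) : ℝ :=
  n.factorial * Real.Gamma (1 + 2 * α + n) /
    ‖Complex.Gamma (1 + (α + Complex.I * β) + n)‖ ^ 2

lemma norm_Gamma_add_nat_pos (hα : -1 / 2 < α) (n : ℕ) :
    0 < ‖Complex.Gamma (1 + (α + Complex.I * β) + n)‖ := by
  refine norm_pos_iff.2 (Complex.Gamma_ne_zero_of_re_pos ?_)
  have : (0 : ℝ) ≤ n := n.cast_nonneg
  simp
  linarith

lemma gammaQuotient_pos (hα : -1 / 2 < α) (n : ℕ) : 0 < gammaQuotient α β n := by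
  have h1 := norm_Gamma_add_nat_pos β hα n
  have h2 := Real.Gamma_pos_of_pos (one_add_two_mul_add_pos hα n)
  have h3 : (0 : ℝ) < n.factorial := by exact_mod_cast n.factorial_pos
  unfold gammaQuotient
  positivity

lemma tendsto_gammaQuotient (hα : -1 / 2 < α) :
    Tendsto (gammaQuotient α β) atTop (𝓝 1) := by
  have h1 := (tendsto_norm_Gamma_add_nat (z := α + Complex.I * β) (by simp; linarith)).pow 2
  have h2 := tendsto_real_Gamma_add_nat (s := 2 * α) (by linarith)
  have h := h2.div h1 (by norm_num)
  rw [one_pow, div_one] at h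
  refine h.congr' ?_
  filter_upwards [eventually_gt_atTop 0] with n hn
  have hn' : (0 : ℝ) < n := by exact_mod_cast hn
  have hre : (α + Complex.I * β : ℂ).re = α := by simp
  have h3 := norm_Gamma_add_nat_pos β hα n
  rw [Pi.div_apply, gammaQuotient, hre, mul_comm 2 α, Real.rpow_mul hn'.le, Real.rpow_two]
  have : (n : ℝ) ^ α ≠ 0 := (Real.rpow_pos_of_pos hn' _).ne'
  have : (n.factorial : ℝ) ≠ 0 := by exact_mod_cast n.factorial_ne_zero
  field_simp

/-- The ratio of consecutive normalised squared norms. -/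
def ratioFactor (α β : ℝ) (n : ℕ) : ℝ :=
  1 + (α ^ 2 + β ^ 2) / ((n + 1) * (1 + 2 * α + n))

lemma gammaQuotient_eq_mul (hα : -1 / 2 < α) (n : ℕ) :
    gammaQuotient α β n = ratioFactor α β n * gammaQuotient α β (n + 1) := by
  have h0 := (one_add_two_mul_add_pos hα n).ne'
  have hne := one_add_exponent_ne_zero β hα n
  have hG : Real.Gamma (1 + 2 * α + (n + 1 : ℕ)) =
      (1 + 2 * α + n) * Real.Gamma (1 + 2 * α + n) := by
    rw [← Real.Gamma_add_one h0]; push_cast; ring_nf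
  have hC : Complex.Gamma (1 + (α + Complex.I * β) + (n + 1 : ℕ)) =
      (1 + (α + Complex.I * β) + n) * Complex.Gamma (1 + (α + Complex.I * β) + n) := by
    rw [← Complex.Gamma_add_one _ hne]; push_cast; ring_nf
  have hsq : ‖(1 : ℂ) + (α + Complex.I * β) + n‖ ^ 2 =
      (n + 1) * (1 + 2 * α + n) + (α ^ 2 + β ^ 2) := by
    rw [← Complex.normSq_eq_norm_sq, Complex.normSq_apply]
    simp
    ring
  have h2 := (norm_Gamma_add_nat_pos β hα n).ne'
  have h3 := norm_ne_zero_iff.2 hne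
  have h4 : (n : ℝ) + 1 ≠ 0 := by exact_mod_cast n.succ_ne_zero
  unfold gammaQuotient ratioFactor
  rw [hG, hC, norm_mul, mul_pow, Nat.factorial_succ]
  have h5 : ‖(1 : ℂ) + (α + Complex.I * β) + n‖ ^ 2 ≠ 0 := pow_ne_zero 2 h3
  have hfac : 1 + (α ^ 2 + β ^ 2) / (((n : ℝ) + 1) * (1 + 2 * α + n)) =
      ‖(1 : ℂ) + (α + Complex.I * β) + n‖ ^ 2 / ((n + 1) * (1 + 2 * α + n)) := by
    rw [hsq, eq_div_iff (mul_ne_zero h4 h0), add_mul, div_mul_cancel₀ _ (mul_ne_zero h4 h0), one_mul]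
  rw [hfac]
  generalize ‖(1 : ℂ) + (α + Complex.I * β) + n‖ ^ 2 = x at *
  push_cast
  field_simp

lemma ratioFactor_pos (hα : -1 / 2 < α) (n : ℕ) : 0 < ratioFactor α β n := by
  have := one_add_two_mul_add_pos hα n
  unfold ratioFactor
  positivity

/-- Squeeze by 1 - 1/x ≤ log x ≤ x - 1; both bounds have the limit α² + β². -/
lemma tendsto_mul_log_ratioFactor (hα : -1 / 2 < α) :
    Tendsto (fun n : ℕ => (n * (n + 1)) * Real.log (ratioFactor α β n)) atTop
      (𝓝 (α ^ 2 + β ^ 2)) := by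
  have h0 : Tendsto (fun n : ℕ => (n : ℝ) / (n + (1 + 2 * α))) atTop (𝓝 1) :=
    tendsto_natCast_div_add_atTop (1 + 2 * α)
  have hup : Tendsto (fun n : ℕ => (α ^ 2 + β ^ 2) * ((n : ℝ) / (n + (1 + 2 * α)))) atTop
      (𝓝 (α ^ 2 + β ^ 2)) := by simpa using h0.const_mul (α ^ 2 + β ^ 2)
  have hinv : Tendsto (fun n : ℕ => ((n : ℝ) + 1)⁻¹) atTop (𝓝 0) :=
    tendsto_inv_atTop_zero.comp (tendsto_natCast_atTop_atTop.atTop_add tendsto_const_nhds)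
  have hinv2 : Tendsto (fun n : ℕ => (1 + 2 * α + (n : ℝ))⁻¹) atTop (𝓝 0) :=
    tendsto_inv_atTop_zero.comp (tendsto_const_nhds.add_atTop tendsto_natCast_atTop_atTop)
  have hr : Tendsto (fun n : ℕ => ratioFactor α β n) atTop (𝓝 1) := by
    have h := ((hinv.mul hinv2).const_mul (α ^ 2 + β ^ 2)).const_add 1
    simp only [mul_zero, add_zero] at h
    refine h.congr fun n => ?_
    rw [ratioFactor, div_eq_mul_inv, mul_inv]
  have hlow := hup.div hr one_ne_zero
  rw [div_one] at hlow
  have he : ∀ n : ℕ, ((n : ℝ) * (n + 1)) * (ratioFactor α β n - 1) =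
      (α ^ 2 + β ^ 2) * ((n : ℝ) / (n + (1 + 2 * α))) := by
    intro n
    have h1 := (one_add_two_mul_add_pos hα n).ne'
    have h2 : (n : ℝ) + (1 + 2 * α) ≠ 0 := by rwa [add_comm]
    have h4 : (n : ℝ) + 1 ≠ 0 := by exact_mod_cast n.succ_ne_zero
    rw [ratioFactor, add_sub_cancel_left, add_comm (1 + 2 * α) (n : ℝ)]
    field_simp
  refine tendsto_of_tendsto_of_tendsto_of_le_of_le hlow hup (fun n => ?_) (fun n => ?_)
  · have hp := ratioFactor_pos β hα n
    have hl := Real.one_sub_inv_le_log_of_pos hp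
    have : (α ^ 2 + β ^ 2) * ((n : ℝ) / (n + (1 + 2 * α))) / ratioFactor α β n =
        ((n : ℝ) * (n + 1)) * (1 - (ratioFactor α β n)⁻¹) := by
      rw [← he]; field_simp
    rw [Pi.div_apply, this]
    gcongr
  · have hp := ratioFactor_pos β hα n
    have hl := Real.log_le_sub_one_of_pos hp
    dsimp only
    rw [← he]
    gcongr

lemma tendsto_gammaQuotient_pow (hα : -1 / 2 < α) :
    Tendsto (fun n : ℕ => gammaQuotient α β n ^ n) atTop (𝓝 (Real.exp (α ^ 2 + β ^ 2))) := by
  have h1 : Tendsto (fun n => Real.log (gammaQuotient α β n)) atTop (𝓝 0) := by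
    simpa using (tendsto_gammaQuotient β hα).log one_ne_zero
  have h2 : Tendsto (fun n : ℕ => n * Real.log (gammaQuotient α β n)) atTop
      (𝓝 (α ^ 2 + β ^ 2)) := by
    refine tendsto_natCast_mul_of_sub h1 ((tendsto_mul_log_ratioFactor β hα).congr fun n => ?_)
    rw [gammaQuotient_eq_mul β hα n, Real.log_mul (ratioFactor_pos β hα n).ne'
      (gammaQuotient_pos β hα _).ne', add_sub_cancel_right]
  refine h2.rexp.congr fun n => ?_
  rw [Real.exp_nat_mul, Real.exp_log (gammaQuotient_pos β hα n)]

/-- Summation by parts for products: it trades the slowly converging g_j for the ratios g_m/g_{m+1},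
whose exponents m + 1 are those of the Barnes product. -/
lemma prod_gammaQuotient (hα : -1 / 2 < α) (n : ℕ) :
    ∏ j ∈ Finset.range n, gammaQuotient α β j =
      gammaQuotient α β n ^ n * ∏ m ∈ Finset.range n, ratioFactor α β m ^ (m + 1) := by
  induction n with
  | zero => simp
  | succ n ih =>
    rw [Finset.prod_range_succ, Finset.prod_range_succ, ih, gammaQuotient_eq_mul β hα n]
    ring

lemma barnesFactor_conj (α β : ℝ) (k : ℕ) :
    barnesFactor (α - Complex.I * β) k =
      (starRingEnd ℂ) (barnesFactor (α + Complex.I * β) k) := by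
  rw [barnesFactor, barnesFactor, map_mul, map_pow, ← Complex.exp_conj]
  simp only [map_add, map_sub, map_div₀, map_pow, map_mul, map_one, map_natCast, map_ofNat,
    Complex.conj_ofReal, Complex.conj_I, neg_mul, ← sub_eq_add_neg]

/-- Rests on (1 + a/y)(1 + b/y) = ρ(1 + 2α/y) with y = k + 1 and ρ the ratio factor. In the
exponents a² + b² = (2α)² - 2(α²+β²), whence the correction by 1/(k+1). -/
lemma normSq_barnesFactor (hα : -1 / 2 < α) (k : ℕ) :
    ((‖barnesFactor (α + Complex.I * β) k‖ ^ 2 : ℝ) : ℂ) =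
      ((ratioFactor α β k ^ (k + 1) * Real.exp (-(α ^ 2 + β ^ 2) * (k + 1 : ℝ)⁻¹) : ℝ) : ℂ) *
        barnesFactor (2 * α) k := by
  have hk : (k : ℂ) + 1 ≠ 0 := by exact_mod_cast k.succ_ne_zero
  have h2 := one_add_two_mul_ne_zero hα k
  rw [Complex.ofReal_pow, ← Complex.mul_conj', ← barnesFactor_conj, barnesFactor, barnesFactor,
    barnesFactor]
  have e1 : Complex.exp ((α + Complex.I * β) ^ 2 / (2 * ((k : ℂ) + 1)) - (α + Complex.I * β)) *
      Complex.exp ((α - Complex.I * β) ^ 2 / (2 * ((k : ℂ) + 1)) - (α - Complex.I * β)) =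
      Complex.exp (-((α : ℂ) ^ 2 + β ^ 2) * ((k : ℂ) + 1)⁻¹) *
        Complex.exp ((2 * α) ^ 2 / (2 * ((k : ℂ) + 1)) - 2 * α) := by
    rw [← Complex.exp_add, ← Complex.exp_add]
    congr 1
    field_simp
    linear_combination (2 * (β : ℂ) ^ 2) * Complex.I_sq
  have e2 : (1 + (α + Complex.I * β) / ((k : ℂ) + 1)) * (1 + (α - Complex.I * β) / ((k : ℂ) + 1)) =
      (ratioFactor α β k : ℂ) * (1 + 2 * α / ((k : ℂ) + 1)) := by
    rw [ratioFactor]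
    push_cast
    generalize hy : (k : ℂ) + 1 = y at *
    have hk' : (k : ℂ) = y - 1 := by rw [← hy]; ring
    rw [hk'] at h2 ⊢
    have h3 : y + 2 * α ≠ 0 := by intro h; apply h2; rw [← h]; ring
    have h4 : y + α * 2 ≠ 0 := by rwa [mul_comm (α : ℂ)]
    rw [show (1 : ℂ) + 2 * α + (y - 1) = y + 2 * α by ring]
    field_simp
    linear_combination (-(β : ℂ) ^ 2) * Complex.I_sq
  push_cast
  calc _ = ((1 + (α + Complex.I * β) / ((k : ℂ) + 1)) *
        (1 + (α - Complex.I * β) / ((k : ℂ) + 1))) ^ (k + 1) *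
        (Complex.exp ((α + Complex.I * β) ^ 2 / (2 * ((k : ℂ) + 1)) - (α + Complex.I * β)) *
      Complex.exp ((α - Complex.I * β) ^ 2 / (2 * ((k : ℂ) + 1)) - (α - Complex.I * β))) := by
        rw [mul_pow]; ring
    _ = _ := by rw [e1, e2, mul_pow]; ring

lemma prod_ratioFactor (hα : -1 / 2 < α) (n : ℕ) :
    ((∏ m ∈ Finset.range n, ratioFactor α β m ^ (m + 1) : ℝ) : ℂ) =
      ((‖∏ k ∈ Finset.range n, barnesFactor (α + Complex.I * β) k‖ ^ 2 : ℝ) : ℂ) /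
        (∏ k ∈ Finset.range n, barnesFactor (2 * α) k) *
        ((Real.exp ((α ^ 2 + β ^ 2) * (harmonic n : ℝ)) : ℝ) : ℂ) := by
  have hne : ∀ k, barnesFactor (2 * α) k ≠ 0 := fun k => by
    rw [← exp_barnesLogFactor (by simp; linarith)]; exact Complex.exp_ne_zero _
  induction n with
  | zero => simp
  | succ n ih =>
    rw [Finset.prod_range_succ, Finset.prod_range_succ, Finset.prod_range_succ, Complex.ofReal_mul,
      ih, norm_mul, mul_pow, Complex.ofReal_mul (_ ^ 2) (_ ^ 2), normSq_barnesFactor β hα,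
      harmonic_succ]
    have hP : ∏ k ∈ Finset.range n, barnesFactor (2 * α) k ≠ 0 :=
      Finset.prod_ne_zero_iff.2 fun k _ => hne k
    have hn := hne n
    have hx := Real.exp_pos ((α ^ 2 + β ^ 2) * ((n : ℝ) + 1)⁻¹)
    have hexp : Real.exp (-(α ^ 2 + β ^ 2) * ((n : ℝ) + 1)⁻¹) =
        (Real.exp ((α ^ 2 + β ^ 2) * ((n : ℝ) + 1)⁻¹))⁻¹ := by rw [← Real.exp_neg]; ring_nf
    have hadd : Real.exp ((α ^ 2 + β ^ 2) * ((harmonic n + (↑(n + 1))⁻¹ : ℚ) : ℝ)) =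
        Real.exp ((α ^ 2 + β ^ 2) * (harmonic n : ℝ)) *
          Real.exp ((α ^ 2 + β ^ 2) * ((n : ℝ) + 1)⁻¹) := by
      rw [← Real.exp_add]; push_cast; ring_nf
    rw [hexp, hadd]
    have hxc : ((Real.exp ((α ^ 2 + β ^ 2) * ((n : ℝ) + 1)⁻¹) : ℝ) : ℂ) ≠ 0 := by
      exact_mod_cast hx.ne'
    generalize Real.exp ((α ^ 2 + β ^ 2) * ((n : ℝ) + 1)⁻¹) = x at *
    rw [Complex.ofReal_mul, Complex.ofReal_mul, Complex.ofReal_inv]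
    generalize barnesFactor (2 * α) = F at *
    field_simp

/-- The constant of the Toeplitz determinant asymptotics in terms of Barnes' function. -/
def barnesConst (α β : ℝ) : ℂ :=
  ((‖barnesG (α + Complex.I * β + 1)‖ ^ 2 : ℝ) : ℂ) / barnesG (2 * α + 1)

/-- The powers of 2π and the linear exponents cancel; the quadratic ones leave 2α² - (α²-β²) = α² +
β² times 1 + γ. Here 1 matches the limit of g_n^n, and γ that of H_n - log n. -/
lemma barnesConst_eq (hα : -1 / 2 < α) : barnesConst α β =
    ((Real.exp ((α ^ 2 + β ^ 2) * (1 + Real.eulerMascheroniConstant)) : ℝ) : ℂ) *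
      (((‖Complex.exp (∑' k, barnesLogFactor (α + Complex.I * β) k)‖ ^ 2 : ℝ) : ℂ) /
        Complex.exp (∑' k, barnesLogFactor (2 * α) k)) := by
  have h2π : (0 : ℝ) < 2 * Real.pi := by positivity
  rw [barnesConst, barnesG_one_add (by simp; linarith), barnesG_one_add (by simp; linarith),
    norm_mul, norm_mul]
  set γ := Real.eulerMascheroniConstant
  have e1 : ‖(2 * (Real.pi : ℂ)) ^ ((α + Complex.I * β) / 2)‖ ^ 2 = (2 * Real.pi) ^ α := by
    rw [show (2 * (Real.pi : ℂ)) = ((2 * Real.pi : ℝ) : ℂ) by push_cast; rfl,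
      Complex.norm_cpow_eq_rpow_re_of_pos h2π, ← Real.rpow_natCast, ← Real.rpow_mul h2π.le]
    congr 1
    simp
  have e2 : ‖Complex.exp (-((α + Complex.I * β) + (α + Complex.I * β) ^ 2 * (1 + (γ : ℂ))) / 2)‖ ^ 2 =
      Real.exp (-(α + (α ^ 2 - β ^ 2) * (1 + γ))) := by
    rw [Complex.norm_exp, ← Real.exp_nat_mul]
    congr 1
    rw [show -((α + Complex.I * β) + (α + Complex.I * β) ^ 2 * (1 + (γ : ℂ))) / 2 =
      ((-(α + (α ^ 2 - β ^ 2) * (1 + γ)) / 2 : ℝ) : ℂ) +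
        ((-(β + 2 * α * β * (1 + γ)) / 2 : ℝ) : ℂ) * Complex.I by
      push_cast
      linear_combination (-(β : ℂ) ^ 2 * (1 + γ) / 2) * Complex.I_sq]
    rw [Complex.add_re, Complex.ofReal_re, Complex.re_ofReal_mul, Complex.I_re]
    push_cast
    ring
  have e3 : (2 * (Real.pi : ℂ)) ^ ((2 * α : ℂ) / 2) = (((2 * Real.pi) ^ α : ℝ) : ℂ) := by
    rw [Complex.ofReal_cpow h2π.le]; push_cast; congr 1; ring
  have e4 : Complex.exp (-((2 * α : ℂ) + (2 * α) ^ 2 * (1 + (γ : ℂ))) / 2) =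
      ((Real.exp (-(α + 2 * α ^ 2 * (1 + γ))) : ℝ) : ℂ) := by
    rw [Complex.ofReal_exp]; congr 1; push_cast; ring
  have e5 : Real.exp (-(α + (α ^ 2 - β ^ 2) * (1 + γ))) =
      Real.exp ((α ^ 2 + β ^ 2) * (1 + γ)) * Real.exp (-(α + 2 * α ^ 2 * (1 + γ))) := by
    rw [← Real.exp_add]; congr 1; ring
  rw [mul_pow, mul_pow, e1, e2, e3, e4, e5]
  have h1 : (((2 * Real.pi) ^ α : ℝ) : ℂ) ≠ 0 := by
    exact_mod_cast (Real.rpow_pos_of_pos h2π α).ne'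
  have h3 : ((Real.exp (-(α + 2 * α ^ 2 * (1 + γ))) : ℝ) : ℂ) ≠ 0 := by
    exact_mod_cast (Real.exp_pos _).ne'
  have h4 := Complex.exp_ne_zero (∑' k, barnesLogFactor (2 * α) k)
  generalize (2 * Real.pi) ^ α = x at *
  generalize Real.exp (-(α + 2 * α ^ 2 * (1 + γ))) = y at *
  rw [Complex.ofReal_mul, Complex.ofReal_mul, Complex.ofReal_mul]
  field_simp

lemma barnesConst_ne_zero (hα : -1 / 2 < α) : barnesConst α β ≠ 0 := by
  rw [barnesConst_eq β hα]
  refine mul_ne_zero (by exact_mod_cast (Real.exp_pos _).ne') (div_ne_zero ?_ (Complex.exp_ne_zero _))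
  exact_mod_cast pow_ne_zero 2 (norm_ne_zero_iff.2 (Complex.exp_ne_zero _))

lemma tendsto_prod_gammaQuotient (hα : -1 / 2 < α) :
    Tendsto (fun n : ℕ => ((∏ j ∈ Finset.range n, gammaQuotient α β j : ℝ) : ℂ) /
      (((n : ℝ) ^ (α ^ 2 + β ^ 2) : ℝ) : ℂ)) atTop (𝓝 (barnesConst α β)) := by
  have hof := Complex.continuous_ofReal
  have h1 := (hof.tendsto _).comp (tendsto_gammaQuotient_pow β hα)
  have h2 := (hof.tendsto _).comp
    ((hasProd_barnesFactor (u := α + Complex.I * β) (by simp; linarith)).tendsto_prod_nat.norm.pow 2)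
  have h3 := (hasProd_barnesFactor (u := 2 * α) (by simp; linarith)).tendsto_prod_nat
  have h4 := (hof.tendsto _).comp
    ((Real.tendsto_harmonic_sub_log.const_mul (α ^ 2 + β ^ 2)).rexp)
  have h := (h1.mul (h2.div h3 (Complex.exp_ne_zero _))).mul h4
  have hlim : barnesConst α β = ((Real.exp (α ^ 2 + β ^ 2) : ℝ) : ℂ) *
      (((‖Complex.exp (∑' k, barnesLogFactor (α + Complex.I * β) k)‖ ^ 2 : ℝ) : ℂ) /
        Complex.exp (∑' k, barnesLogFactor (2 * α) k)) *
      ((Real.exp ((α ^ 2 + β ^ 2) * Real.eulerMascheroniConstant) : ℝ) : ℂ) := by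
    rw [barnesConst_eq β hα, mul_add, mul_one, Real.exp_add, Complex.ofReal_mul]
    ring
  rw [hlim]
  refine h.congr' ?_
  filter_upwards [eventually_gt_atTop 0] with n hn
  have hn' : (0 : ℝ) < n := by exact_mod_cast hn
  simp only [Function.comp, Pi.div_apply]
  rw [prod_gammaQuotient β hα, Complex.ofReal_mul, prod_ratioFactor β hα, mul_sub, Real.exp_sub,
    mul_comm _ (Real.log n), ← Real.rpow_def_of_pos hn', Complex.ofReal_div]
  ring
end


/-! ### Toeplitz determinant and discriminant asymptotics -/

section
variable {α : ℝ} (β : ℝ)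

/-- The real value of the normalisation constant of the weight. -/
def normConstReal (α β : ℝ) : ℝ :=
  ‖Complex.Gamma (1 + (α + Complex.I * β))‖ ^ 2 / (2 * Real.pi * Real.Gamma (1 + 2 * α))

lemma normConstReal_pos (hα : -1 / 2 < α) : 0 < normConstReal α β := by
  have h1 := norm_Gamma_add_nat_pos β hα 0
  have h2 := Real.Gamma_pos_of_pos (one_add_two_mul_add_pos hα 0)
  simp only [Nat.cast_zero, add_zero] at h1 h2
  unfold normConstReal
  positivity

lemma real_Gamma_add_nat (hα : -1 / 2 < α) (n : ℕ) : Real.Gamma (1 + 2 * α + n) =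
    Real.Gamma (1 + 2 * α) * ∏ i ∈ Finset.range n, (1 + 2 * α + i) := by
  have h := Gamma_add_nat (1 + 2 * α) (one_add_two_mul_ne_zero hα) n
  rw [show (1 : ℂ) + 2 * α = ((1 + 2 * α : ℝ) : ℂ) by push_cast; rfl, poch_ofReal,
    show ((1 + 2 * α : ℝ) : ℂ) + n = ((1 + 2 * α + n : ℝ) : ℂ) by push_cast; rfl,
    Complex.Gamma_ofReal, Complex.Gamma_ofReal] at h
  exact_mod_cast h

/-- Extracting C from each norm leaves factors tending to 1, so C^n carries all the exponential
growth of Δ_n. -/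
lemma normSqMonic_eq_gammaQuotient (hα : -1 / 2 < α) (n : ℕ) :
    (2 * Real.pi)⁻¹ * normSqMonic α β n = normConstReal α β * gammaQuotient α β n := by
  have h1 := norm_Gamma_add_nat_pos β hα 0
  have h2 := Real.Gamma_pos_of_pos (one_add_two_mul_add_pos hα 0)
  simp only [Nat.cast_zero, add_zero] at h1 h2
  have h3 := norm_ne_zero_iff.2 (poch_ne_zero (one_add_exponent_ne_zero β hα) n)
  rw [normSqMonic, normConstReal, gammaQuotient, real_Gamma_add_nat hα,
    Gamma_add_nat _ (one_add_exponent_ne_zero β hα), norm_mul]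
  have h2' := h2.ne'
  have h1' := h1.ne'
  generalize Real.Gamma (1 + 2 * α) = g at *
  generalize ‖Complex.Gamma (1 + (α + Complex.I * β))‖ = g' at *
  generalize ‖poch (1 + (α + Complex.I * β)) n‖ = A at *
  generalize ∏ i ∈ Finset.range n, (1 + 2 * α + i) = S at *
  field_simp

lemma toeplitzValue_eq (hα : -1 / 2 < α) (n : ℕ) : toeplitzValue α β n =
    normConstReal α β ^ n * ∏ j ∈ Finset.range n, gammaQuotient α β j := by
  have h : ∀ c : ℝ, c ^ n = ∏ _j ∈ Finset.range n, c := fun c => by simp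
  rw [toeplitzValue, h, h, ← Finset.prod_mul_distrib, ← Finset.prod_mul_distrib]
  exact Finset.prod_congr rfl fun j _ => normSqMonic_eq_gammaQuotient β hα j

lemma isEquivalent_toeplitzDet (hα : -1 / 2 < α) :
    (fun n : ℕ => toeplitzDet (weight α β) n) ~[atTop]
      (fun n : ℕ => barnesConst α β * normConst α β ^ n *
        (((n : ℝ) ^ (α ^ 2 + β ^ 2) : ℝ) : ℂ)) := by
  apply isEquivalent_of_tendsto_one
  have h := (tendsto_prod_gammaQuotient β hα).div_const (barnesConst α β)
  rw [div_self (barnesConst_ne_zero β hα)] at h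
  refine h.congr' ?_
  filter_upwards [eventually_gt_atTop 0] with n hn
  have hn' : (0 : ℝ) < n := by exact_mod_cast hn
  have h1 : (((n : ℝ) ^ (α ^ 2 + β ^ 2) : ℝ) : ℂ) ≠ 0 := by
    exact_mod_cast (Real.rpow_pos_of_pos hn' _).ne'
  have h2 := barnesConst_ne_zero β hα
  have h3 : (normConstReal α β : ℂ) ≠ 0 := by exact_mod_cast (normConstReal_pos β hα).ne'
  rw [Pi.div_apply, toeplitzDet_eq β hα, ← toeplitzValue, toeplitzValue_eq β hα, normConst_eq hα,
    ← normConstReal, Complex.ofReal_mul, Complex.ofReal_pow]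
  field_simp

lemma isEquivalent_ofReal {f g : ℕ → ℝ} (h : f ~[atTop] g) :
    (fun n => (f n : ℂ)) ~[atTop] fun n => (g n : ℂ) := by
  have h' : (fun n => ((f n - g n : ℝ) : ℂ)) =o[atTop] fun n => (g n : ℂ) := by
    rw [Complex.isLittleO_ofReal_left, Complex.isLittleO_ofReal_right]
    exact h
  refine IsLittleO.congr_left h' fun n => ?_
  rw [Complex.ofReal_sub]; rfl

lemma isEquivalent_norm_add_pow (α β : ℝ) :
    (fun n : ℕ => (‖(n : ℂ) + α - Complex.I * β‖ / (2 * Real.pi)) ^ n) ~[atTop]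
      fun n : ℕ => Real.exp α * (n / (2 * Real.pi)) ^ n := by
  apply isEquivalent_of_tendsto_one
  have h := (tendsto_norm_add_div_pow α β).div_const (Real.exp α)
  rw [div_self (Real.exp_pos α).ne'] at h
  refine h.congr' ?_
  filter_upwards [eventually_gt_atTop 0] with n hn
  have hn' : (n : ℝ) ≠ 0 := by exact_mod_cast hn.ne'
  rw [Pi.div_apply, div_pow, div_pow, div_pow]
  field_simp

lemma isEquivalent_norm_discriminant (hα : -1 / 2 < α) (h0 : (α : ℂ) + Complex.I * β ≠ 0) :
    (fun n : ℕ => (‖discriminant (orthonormalPoly α β n)‖ : ℂ)) ~[atTop]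
      (fun n : ℕ =>
        ((‖Complex.Gamma (α + Complex.I * β + 1)‖ / ‖(α : ℂ) + Complex.I * β‖ : ℝ) : ℂ) *
        (barnesG (2 * α + 1) / ((‖barnesG (α + Complex.I * β + 1)‖ ^ 2 : ℝ) : ℂ)) *
        (((Real.Gamma (2 * α + 1) / (‖(α : ℂ) + Complex.I * β‖ *
          ‖Complex.Gamma (α + Complex.I * β)‖ ^ 2)) ^ n *
          (n : ℝ) ^ (1 - α - α ^ 2 - β ^ 2) : ℝ) : ℂ)) := by
  -- The exact identity for Δ_n k_n |D| is solved for |D|. The real factors are cast to ℂ because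
  -- `barnesG` is complex-valued.
  have hN := isEquivalent_ofReal ((((isEquivalent_norm_add_pow α β).mul
    (isEquivalent_norm_rCoeff_pow β hα h0)).mul (isEquivalent_norm_prod β hα)).div
      (isEquivalent_leadCoeff β hα))
  have h := hN.div (isEquivalent_toeplitzDet β hα)
  refine (h.congr_left ?_).congr_right ?_
  · filter_upwards [eventually_ge_atTop 1] with n hn
    have h1 := toeplitz_discriminant_norm β hα hn
    have hT := (toeplitzValue_pos β hα n).ne'
    have hk := (leadCoeff_pos β hα n).ne'
    simp only [Pi.mul_apply, Pi.div_apply]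
    rw [← h1, toeplitzDet_eq β hα, ← toeplitzValue, ← Complex.ofReal_div]
    congr 1
    field_simp
  · filter_upwards [eventually_gt_atTop 0] with n hn
    have hn' : (0 : ℝ) < n := by exact_mod_cast hn
    have hW := barnesConst_ne_zero β hα
    have hC := (normConstReal_pos β hα).ne'
    have hG2 : 0 < Real.Gamma (2 * α + 1) := Real.Gamma_pos_of_pos (by linarith)
    have hΓ : ‖Complex.Gamma (α + Complex.I * β + 1)‖ =
        ‖(α : ℂ) + Complex.I * β‖ * ‖Complex.Gamma (α + Complex.I * β)‖ := by
      rw [Complex.Gamma_add_one _ h0, norm_mul]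
    have hΓ0 : ‖Complex.Gamma (α + Complex.I * β + 1)‖ ≠ 0 := by
      rw [add_comm]; exact norm_ne_zero_iff.2 (Gamma_one_add_ne_zero (by simp; linarith))
    have ha := norm_ne_zero_iff.2 h0
    have hΓa : ‖Complex.Gamma (α + Complex.I * β)‖ ≠ 0 := fun h => hΓ0 (by rw [hΓ, h, mul_zero])
    have hs : √(Real.Gamma (2 * α + 1)) ≠ 0 := (Real.sqrt_pos.2 hG2).ne'
    have hWinv : barnesG (2 * α + 1) / ((‖barnesG (α + Complex.I * β + 1)‖ ^ 2 : ℝ) : ℂ) =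
        (barnesConst α β)⁻¹ := by rw [barnesConst, inv_div]
    have hpow : (n : ℝ) ^ (1 - α - α ^ 2 - β ^ 2) =
        n / ((n : ℝ) ^ α * (n : ℝ) ^ (α ^ 2 + β ^ 2)) := by
      rw [← Real.rpow_add hn', show 1 - α - α ^ 2 - β ^ 2 = 1 - (α + (α ^ 2 + β ^ 2)) by ring,
        Real.rpow_sub hn', Real.rpow_one]
    -- Here e^α and the square roots cancel, and n^n / n^{n-1} contributes the single factor n.
    have hreal : Real.exp α * (n / (2 * Real.pi)) ^ n *
        (Real.exp (-α) * (‖(α : ℂ) + Complex.I * β‖ / n) ^ (n - 1)) *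
        (√(Real.Gamma (2 * α + 1)) / (n : ℝ) ^ α) /
        (√(Real.Gamma (2 * α + 1)) / ‖Complex.Gamma (α + Complex.I * β + 1)‖) =
        ‖Complex.Gamma (α + Complex.I * β + 1)‖ / ‖(α : ℂ) + Complex.I * β‖ *
        ((Real.Gamma (2 * α + 1) / (‖(α : ℂ) + Complex.I * β‖ *
          ‖Complex.Gamma (α + Complex.I * β)‖ ^ 2)) ^ n *
          (n : ℝ) ^ (1 - α - α ^ 2 - β ^ 2)) *
          (normConstReal α β ^ n * (n : ℝ) ^ (α ^ 2 + β ^ 2)) := by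
      have hp1 := (Real.rpow_pos_of_pos hn' α).ne'
      have hp2 := (Real.rpow_pos_of_pos hn' (α ^ 2 + β ^ 2)).ne'
      have he := (Real.exp_pos α).ne'
      obtain ⟨m, rfl⟩ : ∃ m, n = m + 1 := ⟨n - 1, by omega⟩
      rw [normConstReal, hpow, Real.exp_neg, Nat.add_sub_cancel, add_comm (1 : ℂ), hΓ,
        add_comm 1 (2 * α)]
      have hπ := Real.pi_ne_zero
      have hn0 := hn'.ne'
      have hG0 := hG2.ne'
      generalize Real.Gamma (2 * α + 1) = g at *
      generalize ‖(α : ℂ) + Complex.I * β‖ = x at *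
      generalize ‖Complex.Gamma (α + Complex.I * β)‖ = y at *
      generalize ((m + 1 : ℕ) : ℝ) ^ α = u at *
      generalize ((m + 1 : ℕ) : ℝ) ^ (α ^ 2 + β ^ 2) = v at *
      generalize ((m + 1 : ℕ) : ℝ) = z at *
      generalize Real.exp α = e at *
      -- The base of the exponential term is |a|/(2π) divided by C, using |Γ(a+1)| = |a| |Γ(a)|.
      have hcomb : (g / (x * y ^ 2)) ^ (m + 1) * ((x * y) ^ 2 / (2 * Real.pi * g)) ^ (m + 1) =
          (x / (2 * Real.pi)) ^ (m + 1) := by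
        rw [← mul_pow]; congr 1; field_simp
      calc _ = y * (x / (2 * Real.pi)) ^ (m + 1) * z / u := by
            simp only [div_pow]; field_simp; ring
        _ = _ := by rw [← hcomb]; field_simp
    simp only [Pi.mul_apply, Pi.div_apply]
    rw [hreal, hWinv, normConst_eq hα, ← normConstReal]
    have h1 : (((n : ℝ) ^ (α ^ 2 + β ^ 2) : ℝ) : ℂ) ≠ 0 := by
      exact_mod_cast (Real.rpow_pos_of_pos hn' _).ne'
    have h3 : (normConstReal α β : ℂ) ≠ 0 := by exact_mod_cast hC
    rw [Complex.ofReal_mul, Complex.ofReal_mul, Complex.ofReal_mul (normConstReal α β ^ n),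
      Complex.ofReal_pow]
    generalize ((((n : ℝ) ^ (α ^ 2 + β ^ 2) : ℝ)) : ℂ) = v at *
    field_simp
end

end FisherHartwig

end

/-! ### The main theorem -/

theorem mainTheorem5 (α β : ℝ) (hα : -1 / 2 < α) :
    (∃! φ : ℕ → ℂ[X], IsOrthonormalSystem (weight α β) φ) ∧
    ∀ φ : ℕ → ℂ[X], IsOrthonormalSystem (weight α β) φ →
      -- exact formulas
      (∀ n : ℕ, 1 ≤ n →
        (φ n).eval 1 = ∏ j ∈ Finset.Icc 1 n, aCoeff α β φ j / bCoeff j ∧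
        discriminant (φ n) =
          (-1) ^ (n * (n + 1) / 2) * (Complex.I * β - α - n) ^ n *
            (rCoeff φ n ^ (n - 1) / (kCoeff φ n : ℂ)) *
            (∏ j ∈ Finset.Icc 1 (n - 1), (kCoeff φ j : ℂ) ^ 2) *
            ∏ j ∈ Finset.Icc 1 n, bCoeff j / aCoeff α β φ j ∧
        discriminant (φ n) =
          (-1) ^ (n * (n + 3) / 2) * (((n : ℂ) + α - Complex.I * β) / (2 * Real.pi)) ^ n *
            (rCoeff φ n ^ (n - 1) / (kCoeff φ n : ℂ)) *
            (toeplitzDet (weight α β) n)⁻¹ *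
            ∏ j ∈ Finset.Icc 1 n, bCoeff j / aCoeff α β φ j ∧
        -- the square root is the product of the principal square roots of the factors
        (∏ j ∈ Finset.Icc 1 n, bCoeff j / aCoeff α β φ j =
          ∏ j ∈ Finset.Icc 1 n,
            (((α : ℂ) + Complex.I * β + j) / ((α : ℂ) - Complex.I * β + j) *
              ((j : ℂ) / (j + 2 * α))) ^ (1 / 2 : ℂ)) ∧
        (∏ j ∈ Finset.Icc 1 n, bCoeff j / aCoeff α β φ j) ^ 2 =
          Complex.Gamma (n + 1 + α + Complex.I * β) / Complex.Gamma (n + 1 + α - Complex.I * β) *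
            (Complex.Gamma (α - Complex.I * β + 1) / Complex.Gamma (α + Complex.I * β + 1)) *
            (Complex.Gamma (2 * α + 1) * Complex.Gamma (n + 1) /
              Complex.Gamma (n + 2 * α + 1)) ∧
        toeplitzDet (weight α β) n ≠ 0 ∧
        toeplitzDet (weight α β) n * (kCoeff φ n : ℂ) * (‖discriminant (φ n)‖ : ℂ) =
          ((‖(n : ℂ) + α - Complex.I * β‖ / (2 * Real.pi)) ^ n * ‖rCoeff φ n‖ ^ (n - 1) *
            ‖∏ j ∈ Finset.Icc 1 n, bCoeff j / aCoeff α β φ j‖ : ℝ)) ∧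
      -- asymptotics of the single factors
      Tendsto (fun n => kCoeff φ n) atTop
        (𝓝 (√(Real.Gamma (2 * α + 1)) / ‖Complex.Gamma (α + Complex.I * β + 1)‖)) ∧
      (fun n : ℕ => ‖∏ j ∈ Finset.Icc 1 n, bCoeff j / aCoeff α β φ j‖) ~[atTop]
        (fun n : ℕ => √(Real.Gamma (2 * α + 1)) / (n : ℝ) ^ α) ∧
      (fun n : ℕ => toeplitzDet (weight α β) n) ~[atTop]
        (fun n : ℕ => ((‖barnesG (α + Complex.I * β + 1)‖ ^ 2 : ℝ) : ℂ) / barnesG (2 * α + 1) *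
          normConst α β ^ n * (((n : ℝ) ^ (α ^ 2 + β ^ 2) : ℝ) : ℂ)) ∧
      ((α : ℂ) + Complex.I * β ≠ 0 →
        (fun n : ℕ => (φ n).eval 0) ~[atTop]
          (fun n : ℕ =>
            ((√(Real.Gamma (2 * α + 1)) / ‖Complex.Gamma (α + Complex.I * β + 1)‖ : ℝ) : ℂ) *
            (Complex.Gamma (α + Complex.I * β + 1) / Complex.Gamma (α - Complex.I * β)) *
            (n : ℂ) ^ (-1 - 2 * Complex.I * β)) ∧
        (fun n : ℕ => ‖rCoeff φ n‖ ^ (n - 1)) ~[atTop]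
          (fun n : ℕ => Real.exp (-α) * (‖(α : ℂ) + Complex.I * β‖ / n) ^ (n - 1)) ∧
        -- asymptotics of the discriminant
        (fun n : ℕ => (‖discriminant (φ n)‖ : ℂ)) ~[atTop]
          (fun n : ℕ =>
            ((‖Complex.Gamma (α + Complex.I * β + 1)‖ / ‖(α : ℂ) + Complex.I * β‖ : ℝ) : ℂ) *
            (barnesG (2 * α + 1) / ((‖barnesG (α + Complex.I * β + 1)‖ ^ 2 : ℝ) : ℂ)) *
            (((Real.Gamma (2 * α + 1) / (‖(α : ℂ) + Complex.I * β‖ *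
              ‖Complex.Gamma (α + Complex.I * β)‖ ^ 2)) ^ n *
              (n : ℝ) ^ (1 - α - α ^ 2 - β ^ 2) : ℝ) : ℂ))) := by
  refine ⟨⟨orthonormalPoly α β, isOrthonormalSystem_orthonormalPoly β hα,
    fun φ hφ => hφ.eq_orthonormalPoly β hα⟩, fun φ hφ => ?_⟩
  -- Uniqueness reduces every claim to the explicit system.
  obtain rfl := hφ.eq_orthonormalPoly β hα
  have hT : ∀ n, toeplitzDet (weight α β) n = (toeplitzValue α β n : ℂ) :=
    fun n => toeplitzDet_eq β hα n
  simp only [kCoeff_orthonormalPoly β hα]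
  refine ⟨fun n hn => ⟨eval_one_orthonormalPoly β hα n, ?_, ?_, prod_eq_prod_sqrt β hα n,
    prod_sq_eq_Gamma β hα n, ?_, ?_⟩, tendsto_leadCoeff β hα, isEquivalent_norm_prod β hα,
    isEquivalent_toeplitzDet β hα, fun h0 => ⟨isEquivalent_eval_zero β hα h0,
    isEquivalent_norm_rCoeff_pow β hα h0, isEquivalent_norm_discriminant β hα h0⟩⟩
  · have h := discriminant_formula_leadCoeff β hα hn
    simpa only [kCoeff_orthonormalPoly β hα] using h
  · have h := discriminant_formula_toeplitzDet β hα hn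
    simpa only [kCoeff_orthonormalPoly β hα] using h
  · rw [hT]
    exact_mod_cast (toeplitzValue_pos β hα n).ne'
  · rw [hT, ← toeplitz_discriminant_norm β hα hn, Complex.ofReal_mul, Complex.ofReal_mul]
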